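/- Let $X$ be a smooth variety over a field $k$ and let $\Delta=\sum_{i\in I} D_i$ be a simple normal crossing divisor on $X$ ($I$ finite). A stratum of $(X,\Delta)$ is an irreducible component of an intersection $D_{i_1}\cap\dots\cap D_{i_r}$, $r\ge 1$. An ideal sheaf is called toroidal if, locally on $X$, it is a (possibly empty) sum of ideal sheaves $\mathcal O_X(-\sum_i a_iD_i)$ with $a_i\in\mathbb N$. The toroidal hull $J^t$ of an ideal sheaf $J\subset\mathcal O_X$ is the smallest toroidal ideal sheaf containing $J$. The multiplicity $\operatorname{mult}_W J$ along a stratum $W$ with generic point $\eta$ is the largest $n$ with $J_\eta\subset\mathfrak m_\eta^n$. Let $Z\subset X$ be a stratum or a disjoint union of strata and assume that $J$ is toroidally equimultiple along $Z$ with multiplicity $m\in\mathbb N$, that is, $\operatorname{mult}_W J=m$ for every stratum $W\subset Z$. Let $\pi:B_ZX\to X$ be the blow-up of $Z$, with exceptional divisor $E=\pi^{-1}(Z)$, $\mathcal O(-E)=I_Z\cdot\mathcal O_{B_ZX}$. On $B_ZX$, toroidal ideal sheaves and toroidal hulls are taken with respect to the divisor $\sum_i\pi^{-1}_*D_i+E$,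 where $\pi^{-1}_*D_i$ is the closure of $\pi^{-1}(D_i\setminus Z)$. Write $\pi^*J$ for the inverse image ideal sheaf and $\pi^{-1}_*J:=\mathcal O_{B_ZX}(mE)\cdot\pi^*J$ for the birational (weak) transform. Then $J^t$ exists and is again toroidally equimultiple along $Z$ with the same multiplicity $m$; the transforms $\pi^{-1}_*J$ and $\pi^{-1}_*(J^t):=\mathcal O_{B_ZX}(mE)\cdot\pi^*(J^t)$ are ideal sheaves on $B_ZX$; the toroidal hull of $\pi^{-1}_*J$ exists; and $$\bigl(\pi^{-1}_*J\bigr)^t=\pi^{-1}_*\bigl(J^t\bigr).$$ -/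

import Mathlib

open AlgebraicGeometry CategoryTheory TopologicalSpace

universe u

noncomputable section

namespace Toroidal

/-- The stalk `I_x` of an ideal sheaf, as an ideal of the local ring of `X` at `x`. -/
def stalkIdeal {X : Scheme.{u}} (I : X.IdealSheafData) (x : X) : Ideal (X.presheaf.stalk x) :=
  ⨆ (U : X.affineOpens) (hx : x ∈ U.1), (I.ideal U).map (X.presheaf.germ U.1 x hx).hom

/-- The multiplicity (order of vanishing) of `I` at the point `x`: the largest `n` such that
the stalk of `I` lies in the `n`-th power of the maximal ideal (infinite for the zero ideal). -/
def mult {X : Scheme.{u}} (I : X.IdealSheafData) (x : X) : ℕ∞ :=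
  ⨆ (n : ℕ) (_ : stalkIdeal I x ≤ IsLocalRing.maximalIdeal (X.presheaf.stalk x) ^ n), (n : ℕ∞)

/-- The ideal sheaf `𝒪_X(-D)` of a reduced divisor, given by its closed set of points. -/
def divisorIdeal {X : Scheme.{u}} (D : Closeds X) : X.IdealSheafData :=
  Scheme.IdealSheafData.vanishingIdeal D

/-- `∑ D i` is a simple normal crossing divisor: at every point `x` there is a regular system of
parameters `z` of the local ring (that is, `dim` many generators of the maximal ideal)
such that the divisors through `x` are defined near `x` by pairwise distinct members of `z`. -/
def IsSNC {X : Scheme.{u}} {ι : Type*} (D : ι → Closeds X) : Prop :=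
  ∀ x : X, ∃ (n : ℕ) (z : Fin n → X.presheaf.stalk x) (c : {i // x ∈ D i} → Fin n),
    ringKrullDim (X.presheaf.stalk x) = n ∧
    Ideal.span (Set.range z) = IsLocalRing.maximalIdeal (X.presheaf.stalk x) ∧
    Function.Injective c ∧
    ∀ i : {i // x ∈ D i}, stalkIdeal (divisorIdeal (D i.1)) x = Ideal.span {z (c i)}

/-- A stratum: an irreducible component of a (nonempty) intersection `D i₁ ∩ ⋯ ∩ D iᵣ`,
where `1 ≤ r`. -/
def IsStratum {X : Scheme.{u}} {ι : Type*} (D : ι → Closeds X) (W : Set X) : Prop :=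
  ∃ T : Finset ι, T.Nonempty ∧
    Maximal (fun V : Set X => IsIrreducible V ∧ V ⊆ ⋂ i ∈ T, (D i : Set X)) W

/-- A toroidal center: a disjoint union of strata (for instance a single stratum). -/
def IsToroidalCenter {X : Scheme.{u}} {ι : Type*} (D : ι → Closeds X) (Z : Closeds X) : Prop :=
  ∃ S : Set (Set X), S.Nonempty ∧ (∀ W ∈ S, IsStratum D W) ∧ S.PairwiseDisjoint id ∧
    (Z : Set X) = ⋃₀ S

/-- `J` is toroidally equimultiple along `Z`, of multiplicity `m`: for every stratum `W ⊆ Z`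
the multiplicity of `J` along `W`, that is, at the generic point of `W`, equals `m`. -/
def IsToroidallyEquimultiple {X : Scheme.{u}} {ι : Type*} (D : ι → Closeds X)
    (J : X.IdealSheafData) (Z : Closeds X) (m : ℕ) : Prop :=
  ∀ W : Set X, IsStratum D W → W ⊆ Z → ∀ η : X, IsGenericPoint η W → mult J η = m

/-- `I` is toroidal: locally it is a sum of ideal sheaves `𝒪(-∑ a i • D i)` with `a i ∈ ℕ`.
(The empty sum is the zero ideal.) -/
def IsToroidal {X : Scheme.{u}} {ι : Type*} [Fintype ι] (D : ι → Closeds X)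
    (I : X.IdealSheafData) : Prop :=
  ∀ x : X, ∃ U : X.affineOpens, x ∈ U.1 ∧ ∃ M : Set (ι → ℕ),
    I.ideal U = ⨆ a ∈ M, ∏ i, (divisorIdeal (D i)).ideal U ^ a i

/-- The toroidal ideal sheaves containing `J`. -/
def toroidalAbove {X : Scheme.{u}} {ι : Type*} [Fintype ι] (D : ι → Closeds X)
    (J : X.IdealSheafData) : Set X.IdealSheafData :=
  {I | IsToroidal D I ∧ J ≤ I}

/-- The toroidal hull `Jᵗ`: the smallest toroidal ideal sheaf containing `J`. -/
def toroidalHull {X : Scheme.{u}} {ι : Type*} [Fintype ι] (D : ι → Closeds X)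
    (J : X.IdealSheafData) : X.IdealSheafData :=
  sInf (toroidalAbove D J)

/-- An invertible ideal sheaf (ideal of an effective Cartier divisor): locally generated by one
nonzerodivisor. -/
def IsInvertible {X : Scheme.{u}} (I : X.IdealSheafData) : Prop :=
  ∀ x : X, ∃ U : X.affineOpens, x ∈ U.1 ∧
    ∃ f ∈ nonZeroDivisors Γ(X, U.1), I.ideal U = Ideal.span {f}

/-- `π : B ⟶ X` is the blow-up of the ideal sheaf `I`: the terminal object among
the morphisms to `X` that pull `I` back to an invertible ideal sheaf. -/
structure IsBlowup {B X : Scheme.{u}} (π : B ⟶ X) (I : X.IdealSheafData) : Prop where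
  invertible : IsInvertible (I.comap π)
  existsUnique_lift : ∀ {T : Scheme.{u}} (g : T ⟶ X), IsInvertible (I.comap g) →
    ∃! h : T ⟶ B, h ≫ π = g

/-- The boundary of the blow-up `π` of `Z`: the birational transforms of the `D i`
(the closure of the preimage of `D i \ Z`), indexed by `some i`, together with the
exceptional divisor `E = π⁻¹(Z)`, indexed by `none`. -/
def blowupBoundary {B X : Scheme.{u}} {ι : Type*} (π : B ⟶ X) (Z : Closeds X)
    (D : ι → Closeds X) : Option ι → Closeds B
  | none => Z.preimage π.continuous
  | some i => Closeds.closure (π ⁻¹' ((D i : Set X) \ Z))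

/-- The ideal sheaf `𝒪_B(-E) = I_Z · 𝒪_B` of the exceptional divisor of the blow-up of `Z`. -/
def exceptionalIdeal {B X : Scheme.{u}} (π : B ⟶ X) (Z : Closeds X) : B.IdealSheafData :=
  (Scheme.IdealSheafData.vanishingIdeal Z).comap π

/-- The birational (weak, controlled) transform `𝒪_B(mE) · π^*J`, as the largest ideal sheaf `K`
with `𝒪_B(-mE) · K ⊆ π^*J`. It satisfies `𝒪_B(-mE) · K = π^*J`, and so is
`𝒪_B(mE) · π^*J`, if and only if the latter is an ideal sheaf. -/
def birationalTransform {B X : Scheme.{u}} (π : B ⟶ X) (Z : Closeds X) (m : ℕ)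
    (J : X.IdealSheafData) : B.IdealSheafData :=
  sSup {K | exceptionalIdeal π Z ^ m * K ≤ J.comap π}

end Toroidal

end

/-! Everything is checked on stalks. Let `A` be the local ring of `X` at a point, with regular
parameters `z` among which are the equations of the `D i` through the point. Every `f` in `A` is a
finite sum of terms `v a * z^a`, where `z^a` is a monomial in the boundary parameters and `v a` is
outside the ideal they generate (`exists_expansion`, from Dickson's lemma and Krull's intersection
theorem). If such a sum lies in an ideal generated by boundary monomials, then so does each `z^a`
(`IsRSP.mon_mem_of_sum_mem`). This rests on `IsRSP.sum_ne_zero`, a consequence of the height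
theorem. So an ideal has a smallest monomial ideal above it, generated by the monomials that occur
in its elements. The exponents needed at `x` also serve at nearby points, and these stalkwise hulls
glue to `Jᵗ` (`exists_hull`).

Equimultiplicity puts `J` into `I_Z^m` at the generic points of the strata. Powers of `I_Z` are
monomial ideals modulo which elements outside `I_Z` are nonzerodivisors, so `J ≤ I_Z^m` everywhere.
As `I_Z^m` is monomial, also `Jᵗ ≤ I_Z^m`. This fixes the multiplicity of `Jᵗ` and makes both
pullbacks divisible by `𝒪(-mE)`.

On the blow-up `z^a` pulls back to `e^(deg_T a) * y^a`, where `e` is the equation of `E`, the `y i`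
are the transforms of the `z i` and `deg_T` is the degree in the parameters that define `Z`. Hence
the transform of `Jᵗ` is toroidal, and it contains that of `J`. For minimality let `K` be toroidal
and contain the transform of `J`. Then `𝒪(-mE) * K` is a monomial ideal containing `π^*J`, and it
has to contain `π^*Jᵗ`. This reduces to `IsBlowupStalk.map_mon_mem`: a monomial ideal upstairs
containing the image of an expansion contains the images of all its monomials. Its proof clears
denominators and compares monomials in `A`, so it does not need `B` to be regular. The input about
`B` is that its local rings consist of fractions of elements of powers of `I_Z`, which follows from
the universal property (`IsBlowup.exists_fraction`). -/

namespace Toroidal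

/-! ### Monomial expansions in a Noetherian local ring -/

section Monomials

variable {A : Type*} [CommRing A] {n : ℕ}

/-- The monomial `∏ z i ^ a i`. -/
def mon (z : Fin n → A) (a : Fin n → ℕ) : A := ∏ i, z i ^ a i

/-- The ideal generated by the monomials in `z` with exponents in `M`. -/
def monIdeal (z : Fin n → A) (M : Set (Fin n → ℕ)) : Ideal A := Ideal.span (mon z '' M)

/-- The total degree of an exponent. -/
def deg (a : Fin n → ℕ) : ℕ := ∑ i, a i

lemma deg_add (a b : Fin n → ℕ) : deg (a + b) = deg a + deg b := Finset.sum_add_distrib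

lemma mon_add (z : Fin n → A) (a b : Fin n → ℕ) : mon z (a + b) = mon z a * mon z b := by
  simp [mon, pow_add, Finset.prod_mul_distrib]

@[simp] lemma mon_zero (z : Fin n → A) : mon z 0 = 1 := by simp [mon]

@[simp] lemma mon_single (z : Fin n → A) (i : Fin n) (k : ℕ) :
    mon z (Pi.single i k) = z i ^ k := by
  rw [mon, Finset.prod_eq_single i] <;> simp +contextual

lemma mon_dvd_mon (z : Fin n → A) {a b : Fin n → ℕ} (h : a ≤ b) : mon z a ∣ mon z b :=
  Finset.prod_dvd_prod_of_dvd _ _ fun i _ ↦ pow_dvd_pow _ (h i)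

lemma map_mon {B : Type*} [CommRing B] (φ : A →+* B) (z : Fin n → A) (a : Fin n → ℕ) :
    φ (mon z a) = mon (fun i ↦ φ (z i)) a := by
  simp [mon]

lemma mon_mem_monIdeal (z : Fin n → A) {M : Set (Fin n → ℕ)} {a b : Fin n → ℕ}
    (hb : b ∈ M) (h : b ≤ a) : mon z a ∈ monIdeal z M :=
  Ideal.mem_of_dvd _ (mon_dvd_mon z h) (Ideal.subset_span ⟨b, hb, rfl⟩)

lemma monIdeal_mono (z : Fin n → A) {M N : Set (Fin n → ℕ)} (h : M ⊆ N) :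
    monIdeal z M ≤ monIdeal z N :=
  Ideal.span_mono (Set.image_mono h)

lemma mem_monIdeal_iff (z : Fin n → A) (M : Set (Fin n → ℕ)) (x : A) :
    x ∈ monIdeal z M ↔ ∃ (t : Finset (Fin n → ℕ)) (g : (Fin n → ℕ) → A),
      (∀ a ∈ t, a ∈ M) ∧ x = ∑ a ∈ t, g a * mon z a := by
  constructor
  · intro h
    rw [monIdeal, Ideal.span, Finsupp.mem_span_image_iff_linearCombination] at h
    obtain ⟨l, hl, rfl⟩ := h
    refine ⟨l.support, l, fun a ha ↦ hl ha, ?_⟩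
    simp [Finsupp.linearCombination_apply, Finsupp.sum]
  · rintro ⟨t, g, ht, rfl⟩
    exact sum_mem fun a ha ↦ Ideal.mul_mem_left _ _ (mon_mem_monIdeal z (ht a ha) le_rfl)

lemma mon_mem_pow_deg (z : Fin n → A) (S : Set (Fin n)) {a : Fin n → ℕ}
    (ha : ∀ i ∉ S, a i = 0) : mon z a ∈ Ideal.span (z '' S) ^ deg a := by
  rw [mon, deg, ← Finset.prod_pow_eq_pow_sum]
  refine Ideal.prod_mem_prod fun i _ ↦ ?_
  by_cases hi : i ∈ S
  · exact Ideal.pow_mem_pow (Ideal.subset_span (Set.mem_image_of_mem z hi)) _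
  · simp [ha i hi]

lemma mon_mem_span (z : Fin n → A) (S : Set (Fin n)) {a : Fin n → ℕ} {i : Fin n} (hi : i ∈ S)
    (ha : a i ≠ 0) : mon z a ∈ Ideal.span (z '' S) := by
  refine Ideal.mem_of_dvd _ ?_ (Ideal.subset_span ⟨i, hi, rfl⟩)
  rw [mon]
  exact (dvd_pow_self _ ha).trans (Finset.dvd_prod_of_mem _ (Finset.mem_univ i))

/-- Dickson's lemma: in an infinite strictly growing chain of upper sets, exponents picked when they
first appear would form a sequence in which no term lies below a later one. This is the termination
measure of the expansion algorithm. -/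
lemma upperClosure_wellFounded :
    WellFounded fun C D : Finset (Fin n → ℕ) ↦
      (upperClosure (D : Set (Fin n → ℕ)) : Set (Fin n → ℕ)) ⊂ upperClosure (C : Set (Fin n → ℕ)) := by
  have : IsStrictOrder (Finset (Fin n → ℕ)) fun C D ↦
      (upperClosure (D : Set (Fin n → ℕ)) : Set (Fin n → ℕ)) ⊂
        upperClosure (C : Set (Fin n → ℕ)) :=
    { irrefl := fun C h ↦ (ssubset_irrefl _) h
      trans := fun a b c h h' ↦ h'.trans h }
  rw [RelEmbedding.wellFounded_iff_isEmpty]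
  refine IsEmpty.mk fun f ↦ ?_
  have hlt : ∀ i j : ℕ, i < j → (upperClosure (f i : Set (Fin n → ℕ)) : Set (Fin n → ℕ)) ⊂
      upperClosure (f j : Set (Fin n → ℕ)) := fun i j hij ↦ f.map_rel_iff.2 hij
  choose g hg hg' using fun i : ℕ ↦ Set.exists_of_ssubset (hlt i (i + 1) (Nat.lt_succ_self i))
  obtain ⟨i, j, hij, hle⟩ := wellQuasiOrdered_le (α := Fin n → ℕ) g
  refine hg' j ?_
  have : g i ∈ (upperClosure (f j : Set (Fin n → ℕ)) : Set (Fin n → ℕ)) := by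
    rcases (Nat.succ_le_of_lt hij).eq_or_lt with h | h
    · rw [← h]; exact hg i
    · exact (hlt _ _ h).subset (hg i)
  exact (upperClosure (f j : Set (Fin n → ℕ))).upper hle this

/-- Krull's intersection theorem in `A ⧸ J`. -/
lemma mem_of_forall_mem_sup_pow [IsNoetherianRing A] [IsLocalRing A] {I J : Ideal A}
    (hI : I ≤ IsLocalRing.maximalIdeal A) {x : A} {N : ℕ} (h : ∀ k, x ∈ J ⊔ I ^ (N + k)) :
    x ∈ J := by
  have key := Ideal.iInf_pow_smul_eq_bot_of_isLocalRing (M := A ⧸ J) I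
    (fun h ↦ (IsLocalRing.maximalIdeal.isMaximal A).ne_top (top_le_iff.1 (h ▸ hI)))
  have : Ideal.Quotient.mk J x ∈ (⨅ i : ℕ, I ^ i • ⊤ : Submodule A (A ⧸ J)) := by
    rw [Submodule.mem_iInf]
    intro k
    have hle : J ⊔ I ^ (N + k) ≤ J ⊔ I ^ k :=
      sup_le_sup_left (Ideal.pow_le_pow_right (Nat.le_add_left _ _)) _
    have hk : x ∈ J ⊔ I ^ k := hle (h k)
    obtain ⟨a, ha, b, hb, rfl⟩ := Submodule.mem_sup.1 hk
    rw [map_add, Ideal.Quotient.eq_zero_iff_mem.2 ha, zero_add]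
    have : (Ideal.Quotient.mk J b : A ⧸ J) = b • (1 : A ⧸ J) := by
      rw [Algebra.smul_def, mul_one]; rfl
    rw [this]
    exact Submodule.smul_mem_smul hb trivial
  rw [key, Submodule.mem_bot] at this
  exact Ideal.Quotient.eq_zero_iff_mem.1 this

/-- Writing the remainder over the fixed set `C` with coefficients in `p` allows it to be absorbed
into the coefficients of an expansion. -/
lemma mem_mul_monIdeal (z : Fin n → A) (p : Ideal A) (C : Finset (Fin n → ℕ)) {x : A}
    (h : x ∈ p * monIdeal z C) :
    ∃ g : (Fin n → ℕ) → A, (∀ a, g a ∈ p) ∧ x = ∑ a ∈ C, g a * mon z a := by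
  classical
  rw [← smul_eq_mul, monIdeal, Ideal.span] at h
  refine Submodule.smul_induction_on h ?_ ?_
  · intro r hr y hy
    obtain ⟨t, g, ht, rfl⟩ := (mem_monIdeal_iff z C y).1 hy
    refine ⟨fun a ↦ if a ∈ t then r * g a else 0, fun a ↦ ?_, ?_⟩
    · dsimp only
      split_ifs
      · exact Ideal.mul_mem_right _ _ hr
      · exact zero_mem _
    · rw [smul_eq_mul, Finset.mul_sum, ← Finset.sum_subset (s₁ := t) (fun a ha ↦ ht a ha)]
      · exact Finset.sum_congr rfl fun a ha ↦ by simp [ha, mul_assoc]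
      · intro a _ ha; simp [ha]
  · rintro x y ⟨g, hg, rfl⟩ ⟨g', hg', rfl⟩
    exact ⟨g + g', fun a ↦ add_mem (hg a) (hg' a), by simp [add_mul, Finset.sum_add_distrib]⟩

/-- The elements of degree at least `N` of a monomial ideal, up to higher degree and up to
multiples of given monomials, are sums of monomials of degree `N` with coefficients outside `p`. -/
lemma exists_expansion_step (z : Fin n → A) (S : Set (Fin n)) (M : Set (Fin n → ℕ))
    (hS : ∀ a ∈ M, ∀ i ∉ S, a i = 0) (hM : ∀ a ∈ M, ∀ i ∈ S, a + Pi.single i 1 ∈ M)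
    (N : ℕ) (C : Finset (Fin n → ℕ)) (hC : ∀ a ∈ C, deg a < N) {x : A}
    (hx : x ∈ monIdeal z {a ∈ M | N ≤ deg a}) :
    ∃ (D : Finset (Fin n → ℕ)) (w : (Fin n → ℕ) → A),
      (∀ a ∈ D, a ∈ M ∧ deg a = N ∧ a ∉ upperClosure (C : Set (Fin n → ℕ)) ∧
        w a ∉ Ideal.span (z '' S)) ∧
      x - ∑ a ∈ D, w a * mon z a ∈
        Ideal.span (z '' S) * monIdeal z C ⊔ monIdeal z {a ∈ M | N + 1 ≤ deg a} := by
  classical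
  obtain ⟨t, g, ht, rfl⟩ := (mem_monIdeal_iff z _ x).1 hx
  -- Only these terms are kept. A term of degree `N` above some `c ∈ C` has a nontrivial cofactor
  -- because `deg c < N`, and a coefficient in the ideal of the variables pushes its term into
  -- degree `N + 1`.
  let Q : (Fin n → ℕ) → Prop := fun a ↦
    deg a = N ∧ a ∉ upperClosure (C : Set (Fin n → ℕ)) ∧ g a ∉ Ideal.span (z '' S)
  refine ⟨t.filter Q, g, fun a ha ↦ ?_, ?_⟩
  · rw [Finset.mem_filter] at ha
    exact ⟨(ht a ha.1).1, ha.2⟩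
  rw [← Finset.sum_filter_add_sum_filter_not t Q, add_sub_cancel_left]
  refine sum_mem fun a ha ↦ ?_
  rw [Finset.mem_filter] at ha
  obtain ⟨haM, haN⟩ := ht a ha.1
  by_cases h1 : deg a = N
  · by_cases h2 : a ∈ upperClosure (C : Set (Fin n → ℕ))
    · obtain ⟨c, hc, hca⟩ := mem_upperClosure.1 h2
      refine Ideal.mul_mem_left _ _ (Ideal.mem_sup_left ?_)
      obtain ⟨d, rfl⟩ := exists_add_of_le hca
      rw [mon_add, mul_comm (mon z c)]
      refine Ideal.mul_mem_mul ?_ (mon_mem_monIdeal (M := C) (b := c) z hc le_rfl)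
      have hd : d ≠ 0 := by
        rintro rfl
        have := hC c hc
        rw [add_zero] at h1
        omega
      obtain ⟨i, hi⟩ := Function.ne_iff.1 hd
      refine mon_mem_span z S (i := i) ?_ hi
      by_contra hiS
      have := hS _ haM i hiS
      simp at this hi
      omega
    · have h3 : g a ∈ Ideal.span (z '' S) := by
        by_contra h3
        exact ha.2 ⟨h1, h2, h3⟩
      refine Ideal.mem_sup_right ?_
      have hle : Ideal.span (z '' S) ≤ Submodule.comap (LinearMap.mulRight A (mon z a))
          (monIdeal z {a ∈ M | N + 1 ≤ deg a}) := by
        rw [Ideal.span_le]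
        rintro _ ⟨i, hi, rfl⟩
        have : z i * mon z a = mon z (a + Pi.single i 1) := by
          rw [mon_add, mon_single, pow_one, mul_comm]
        simp only [SetLike.mem_coe, Submodule.mem_comap, LinearMap.mulRight_apply, this]
        refine mon_mem_monIdeal z (b := a + Pi.single i 1) ⟨hM a haM i hi, ?_⟩ le_rfl
        rw [deg_add, h1]
        simp [deg]
      exact hle h3
  · refine Ideal.mem_sup_right (Ideal.mul_mem_left _ _ (mon_mem_monIdeal z ⟨haM, ?_⟩ le_rfl))
    exact Nat.lt_of_le_of_ne haN (Ne.symm h1)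

/-- Every element of a monomial ideal is a finite sum of monomials of that ideal with
coefficients outside of the ideal generated by the variables. -/
theorem exists_expansion_of_mem [IsNoetherianRing A] [IsLocalRing A] (z : Fin n → A)
    (S : Set (Fin n)) (hz : ∀ i ∈ S, z i ∈ IsLocalRing.maximalIdeal A) (M : Set (Fin n → ℕ))
    (hS : ∀ a ∈ M, ∀ i ∉ S, a i = 0) (hM : ∀ a ∈ M, ∀ i ∈ S, a + Pi.single i 1 ∈ M)
    {x : A} (hx : x ∈ monIdeal z M) :
    ∃ (C : Finset (Fin n → ℕ)) (v : (Fin n → ℕ) → A),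
      (∀ a ∈ C, a ∈ M) ∧ (∀ a ∈ C, v a ∉ Ideal.span (z '' S)) ∧
      x = ∑ a ∈ C, v a * mon z a := by
  classical
  set p := Ideal.span (z '' S) with hp
  have hpm : p ≤ IsLocalRing.maximalIdeal A := by
    rw [hp, Ideal.span_le]; rintro _ ⟨i, hi, rfl⟩; exact hz i hi
  -- The state after treating degrees below `N`: the remainder is absorbable into the coefficients,
  -- up to terms of degree at least `N`.
  let P : ℕ → Finset (Fin n → ℕ) → ((Fin n → ℕ) → A) → Prop := fun N C v ↦
    (∀ a ∈ C, a ∈ M ∧ deg a < N ∧ v a ∉ p) ∧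
      x - ∑ a ∈ C, v a * mon z a ∈ p * monIdeal z C ⊔ monIdeal z {a ∈ M | N ≤ deg a}
  have step : ∀ N C v, P N C v → ∃ C' v', P (N + 1) C' v' ∧ C ⊆ C' ∧ (∀ a ∈ C, v' a = v a) ∧
      ∀ a ∈ C', a ∈ C ∨ a ∉ upperClosure (C : Set (Fin n → ℕ)) := by
    rintro N C v ⟨h1, h2⟩
    obtain ⟨r, hr, g, hg, hrg⟩ := Submodule.mem_sup.1 h2
    obtain ⟨D, w, hD, hw⟩ := exists_expansion_step z S M hS hM N C (fun a ha ↦ (h1 a ha).2.1) hg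
    have hdisj : Disjoint C D := by
      rw [Finset.disjoint_left]
      intro a ha ha'
      exact (hD a ha').2.2.1 (subset_upperClosure ha)
    have hmono : p * monIdeal z C ≤ p * monIdeal z ↑(C ∪ D) :=
      Ideal.mul_mono_right (monIdeal_mono z (by simp))
    refine ⟨C ∪ D, fun a ↦ if a ∈ C then v a else w a, ⟨fun a ha ↦ ?_, ?_⟩,
      Finset.subset_union_left, fun a ha ↦ by simp [ha], fun a ha ↦ ?_⟩
    · by_cases hC : a ∈ C
      · simp only [hC, if_true]
        exact ⟨(h1 a hC).1, (h1 a hC).2.1.trans (Nat.lt_succ_self N), (h1 a hC).2.2⟩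
      · have hD' := hD a ((Finset.mem_union.1 ha).resolve_left hC)
        simp only [hC, if_false]
        exact ⟨hD'.1, by omega, hD'.2.2.2⟩
    · rw [Finset.sum_union hdisj]
      have e1 : ∑ a ∈ C, (if a ∈ C then v a else w a) * mon z a = ∑ a ∈ C, v a * mon z a :=
        Finset.sum_congr rfl fun a ha ↦ by simp [ha]
      have e2 : ∑ a ∈ D, (if a ∈ C then v a else w a) * mon z a = ∑ a ∈ D, w a * mon z a :=
        Finset.sum_congr rfl fun a ha ↦ by simp [Finset.disjoint_right.1 hdisj ha]
      rw [e1, e2, ← sub_sub, ← hrg, add_sub_assoc]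
      exact add_mem (Ideal.mem_sup_left (hmono hr)) (sup_le_sup_right hmono _ hw)
    · rcases Finset.mem_union.1 ha with h | h
      · exact Or.inl h
      · exact Or.inr (hD a h).2.2.1
  suffices H : ∀ C N v, P N C v → ∃ (C : Finset (Fin n → ℕ)) (v : (Fin n → ℕ) → A),
      (∀ a ∈ C, a ∈ M) ∧ (∀ a ∈ C, v a ∉ p) ∧ x = ∑ a ∈ C, v a * mon z a by
    refine H ∅ 0 0 ⟨by simp, Ideal.mem_sup_right ?_⟩
    simpa using hx
  intro C
  induction C using upperClosure_wellFounded.induction with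
  | _ C ih =>
  intro N v hP
  -- Either some later stage enlarges the upper closure of `C`, and the induction applies, or `C` is
  -- final. In the second case the remainder lies in `p * monIdeal z C ⊔ p ^ (N + k)` for all `k`,
  -- and Krull's theorem removes the power.
  by_cases hex : ∃ N' C' v', P N' C' v' ∧ C ⊆ C' ∧ ∃ a ∈ C', a ∉ upperClosure (C : Set (Fin n → ℕ))
  · obtain ⟨N', C', v', hP', hCC', a, haC', haC⟩ := hex
    refine ih C' ⟨?_, ?_⟩ N' v' hP'
    · exact (upperClosure_anti (Finset.coe_subset.2 hCC'))
    · intro h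
      exact haC (h (subset_upperClosure haC'))
  · have hall : ∀ k, P (N + k) C v := by
      intro k
      induction k with
      | zero => exact hP
      | succ k ihk =>
        obtain ⟨C', v', hP', hCC', hv, hnew⟩ := step _ _ _ ihk
        have : C' = C := by
          refine Finset.Subset.antisymm (fun a ha ↦ ?_) hCC'
          by_contra haC
          exact hex ⟨_, C', v', hP', hCC', a, ha, (hnew a ha).resolve_left haC⟩
        subst this
        refine ⟨fun a ha ↦ ?_, ?_⟩
        · have := hP'.1 a ha
          rwa [hv a ha] at this
        · have := hP'.2
          rwa [Finset.sum_congr rfl fun a ha ↦ by rw [hv a ha]] at this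
    have hmem : x - ∑ a ∈ C, v a * mon z a ∈ p * monIdeal z C := by
      refine mem_of_forall_mem_sup_pow hpm (N := N) fun k ↦ ?_
      suffices h : monIdeal z {a ∈ M | N + k ≤ deg a} ≤ p ^ (N + k) from
        (sup_le_sup_left h _ : p * monIdeal z C ⊔ _ ≤ p * monIdeal z C ⊔ _) (hall k).2
      rw [monIdeal, Ideal.span_le]
      rintro _ ⟨a, ⟨haM, ha⟩, rfl⟩
      exact Ideal.pow_le_pow_right ha (mon_mem_pow_deg z S (hS a haM))
    obtain ⟨g, hg, hx'⟩ := mem_mul_monIdeal z p C hmem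
    -- The corrections `g a` lie in `p`, so the coefficients stay outside `p`.
    refine ⟨C, v + g, fun a ha ↦ (hP.1 a ha).1, fun a ha h ↦ (hP.1 a ha).2.2 ?_, ?_⟩
    · simpa using sub_mem h (hg a)
    · simp only [Pi.add_apply, add_mul, Finset.sum_add_distrib, ← hx']
      ring

/-- The monomials supported on `S` include `1`, so they generate the unit ideal. -/
theorem exists_expansion [IsNoetherianRing A] [IsLocalRing A] (z : Fin n → A)
    (S : Set (Fin n)) (hz : ∀ i ∈ S, z i ∈ IsLocalRing.maximalIdeal A) (x : A) :
    ∃ (C : Finset (Fin n → ℕ)) (v : (Fin n → ℕ) → A),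
      (∀ a ∈ C, ∀ i ∉ S, a i = 0) ∧ (∀ a ∈ C, v a ∉ Ideal.span (z '' S)) ∧
      x = ∑ a ∈ C, v a * mon z a := by
  refine exists_expansion_of_mem z S hz {a | ∀ i ∉ S, a i = 0} (fun a ha ↦ ha) ?_ ?_
  · intro a ha i hi j hj
    have : j ≠ i := fun h ↦ hj (h ▸ hi)
    simp [ha j hj, this]
  · have : monIdeal z {a | ∀ i ∉ S, a i = 0} = ⊤ := by
      rw [Ideal.eq_top_iff_one, ← mon_zero z]
      exact mon_mem_monIdeal z (b := 0) (by simp) le_rfl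
    rw [this]; trivial

end Monomials

end Toroidal

namespace Toroidal

/-! ### Monomials in a regular system of parameters -/

section RegularSystem

variable {A : Type*} [CommRing A] {n : ℕ}

/-- A regular system of parameters of a local ring. -/
structure IsRSP [IsLocalRing A] (z : Fin n → A) : Prop where
  dim : ringKrullDim A = n
  span : Ideal.span (Set.range z) = IsLocalRing.maximalIdeal A

lemma IsRSP.mem [IsLocalRing A] {z : Fin n → A} (hz : IsRSP z) (i : Fin n) :
    z i ∈ IsLocalRing.maximalIdeal A :=
  hz.span ▸ Ideal.subset_span ⟨i, rfl⟩

/-- A weight function with pairwise different values on a finite set of exponents. -/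
lemma exists_weight (C : Finset (Fin n → ℕ)) :
    ∃ B : ℕ, 1 ≤ B ∧
      Set.InjOn (fun a : Fin n → ℕ ↦ ∑ i, a i * B ^ (i : ℕ)) (C : Set (Fin n → ℕ)) := by
  let B := (∑ a ∈ C, ∑ i, a i) + 1
  have hB : ∀ a ∈ C, ∀ i, a i < B := fun a ha i ↦ by
    refine Nat.lt_succ_of_le ?_
    exact (Finset.single_le_sum (f := a) (fun _ _ ↦ Nat.zero_le _) (Finset.mem_univ i)).trans
      (Finset.single_le_sum (f := fun a : Fin n → ℕ ↦ ∑ i, a i) (fun _ _ ↦ Nat.zero_le _) ha)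
  refine ⟨B, by omega, fun a ha b hb hab ↦ ?_⟩
  -- The weight is the base `B` number with digits `a i < B`.
  have key : finFunctionFinEquiv (fun i ↦ (⟨a i, hB a ha i⟩ : Fin B)) =
      finFunctionFinEquiv (fun i ↦ (⟨b i, hB b hb i⟩ : Fin B)) := by
    apply Fin.ext
    rw [finFunctionFinEquiv_apply, finFunctionFinEquiv_apply]
    exact hab
  have := finFunctionFinEquiv.injective key
  funext i
  have := congrFun this i
  simpa using this

/-- A nonempty sum of distinct monomials with unit coefficients in a regular system of
parameters is nonzero. -/
theorem IsRSP.sum_ne_zero [IsNoetherianRing A] [IsLocalRing A] {z : Fin n → A} (hz : IsRSP z)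
    (C : Finset (Fin n → ℕ)) (hC : C.Nonempty) (v : (Fin n → ℕ) → A) (hv : ∀ a ∈ C, IsUnit (v a)) :
    ∑ a ∈ C, v a * mon z a ≠ 0 := by
  intro h0
  obtain ⟨B, hB, hinj⟩ := exists_weight C
  rcases n with _ | n
  · obtain ⟨c, hc⟩ := hC
    have : C = {c} := Finset.eq_singleton_iff_unique_mem.2 ⟨hc, fun _ _ ↦ Subsingleton.elim _ _⟩
    subst this
    simp only [Finset.sum_singleton, mon, Finset.univ_eq_empty, Finset.prod_empty, mul_one] at h0
    exact (hv c hc).ne_zero h0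
  let W : (Fin (n + 1) → ℕ) → ℕ := fun a ↦ ∑ i, a i * B ^ (i : ℕ)
  -- Restrict to the curve `z i = z 0 ^ B ^ i`: monomials become powers of `z 0` with different
  -- exponents, so the sum becomes a unit times the lowest one.
  let y : Fin n → A := fun i ↦ z i.succ - z 0 ^ B ^ (i.succ : ℕ)
  let Y := Ideal.span (Set.range y)
  have hz0 : ∀ i, Ideal.Quotient.mk Y (z i) = Ideal.Quotient.mk Y (z 0) ^ B ^ (i : ℕ) := by
    intro i
    refine Fin.cases ?_ (fun i ↦ ?_) i
    · simp
    · rw [← map_pow, Ideal.Quotient.eq]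
      exact Ideal.subset_span ⟨i, rfl⟩
  have hmon : ∀ a, Ideal.Quotient.mk Y (mon z a) = Ideal.Quotient.mk Y (z 0) ^ W a := by
    intro a
    rw [map_mon, mon, ← Finset.prod_pow_eq_pow_sum]
    exact Finset.prod_congr rfl fun i _ ↦ by rw [hz0, ← pow_mul, mul_comm]
  obtain ⟨a₀, ha₀, hmin⟩ := C.exists_min_image W hC
  obtain ⟨r, hr⟩ : ∃ r, Ideal.Quotient.mk Y (∑ a ∈ C, v a * mon z a) =
      Ideal.Quotient.mk Y ((v a₀ + z 0 * r) * z 0 ^ W a₀) := by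
    classical
    have : ∀ a ∈ C.erase a₀, W a₀ < W a := fun a ha ↦ by
      rw [Finset.mem_erase] at ha
      refine lt_of_le_of_ne (hmin a ha.2) fun h ↦ ha.1 (hinj ha.2 ha₀ h.symm)
    refine ⟨∑ a ∈ C.erase a₀, v a * z 0 ^ (W a - W a₀ - 1), ?_⟩
    rw [← Finset.add_sum_erase C _ ha₀, add_mul, map_add, map_add, map_mul, hmon]
    refine congrArg₂ (· + ·) (by rw [map_mul, map_pow]) ?_
    · rw [Finset.mul_sum, Finset.sum_mul, map_sum, map_sum]
      refine Finset.sum_congr rfl fun a ha ↦ ?_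
      have := this a ha
      simp only [map_mul, map_pow, hmon]
      obtain ⟨k, hk⟩ := Nat.exists_eq_add_of_lt this
      rw [show W a = W a₀ + k + 1 from hk, show W a₀ + k + 1 - W a₀ - 1 = k by omega]
      ring
  have hunit : IsUnit (v a₀ + z 0 * r) := by
    by_contra hn
    have h1 : v a₀ + z 0 * r ∈ IsLocalRing.maximalIdeal A := hn
    have h2 : z 0 * r ∈ IsLocalRing.maximalIdeal A := Ideal.mul_mem_right _ _ (hz.mem 0)
    exact ((IsLocalRing.mem_maximalIdeal _).1 ((Ideal.add_mem_iff_left _ h2).1 h1)) (hv a₀ ha₀)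
  have hpow : z 0 ^ W a₀ ∈ Y := by
    rw [h0, map_zero, eq_comm, Ideal.Quotient.eq_zero_iff_mem] at hr
    exact (Ideal.unit_mul_mem_iff_mem _ hunit).1 hr
  -- A prime over `Y` contains `z 0`, hence every `z i`. So the maximal ideal would be minimal over
  -- `n` elements, against the height theorem in dimension `n + 1`.
  have hminp : IsLocalRing.maximalIdeal A ∈ Y.minimalPrimes := by
    refine ⟨⟨inferInstance, ?_⟩, fun P hP _ ↦ ?_⟩
    · rw [Ideal.span_le]
      rintro _ ⟨i, rfl⟩
      exact sub_mem (hz.mem _) (Ideal.pow_mem_of_mem _ (hz.mem 0) _ (by positivity))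
    · have h1 : z 0 ∈ P := hP.1.mem_of_pow_mem _ (hP.2 hpow)
      rw [← hz.span, Ideal.span_le]
      rintro _ ⟨i, rfl⟩
      refine Fin.cases h1 (fun i ↦ ?_) i
      have h2 : y i ∈ P := hP.2 (Ideal.subset_span ⟨i, rfl⟩)
      have h3 : z 0 ^ B ^ (i.succ : ℕ) ∈ P := Ideal.pow_mem_of_mem _ h1 _ (by positivity)
      simpa [y] using add_mem h2 h3
  have hht := Ideal.height_le_card_of_mem_minimalPrimes_span (Set.finite_range y) hminp
  have hcard : (Set.range y).ncard ≤ n := by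
    rw [← Set.image_univ]
    refine (Set.ncard_image_le (Set.finite_univ)).trans ?_
    simp [Set.ncard_univ]
  have hdim := hz.dim
  rw [← IsLocalRing.maximalIdeal_height_eq_ringKrullDim] at hdim
  have h3 : (IsLocalRing.maximalIdeal A).height = ((n + 1 : ℕ) : ℕ∞) := by exact_mod_cast hdim
  rw [h3] at hht
  have : n + 1 ≤ (Set.range y).ncard := by exact_mod_cast hht
  omega

/-- The monomial conjecture for a regular system of parameters. -/
lemma IsRSP.mon_notMem [IsNoetherianRing A] [IsLocalRing A] {z : Fin n → A} (hz : IsRSP z)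
    (c : Fin n → ℕ) : mon z c ∉ monIdeal z {a | ∃ i, c i < a i} := by
  classical
  intro h
  -- With all parameters as variables the coefficients are units, so `z^c` minus this expansion
  -- would be a forbidden vanishing sum.
  obtain ⟨C, v, hC, hv, hx⟩ := exists_expansion_of_mem z Set.univ (fun i _ ↦ hz.mem i)
    {a | ∃ i, c i < a i} (by simp) (fun a ⟨i, hi⟩ j _ ↦ ⟨i, hi.trans_le (by simp)⟩) h
  rw [Set.image_univ, hz.span] at hv
  have hcC : c ∉ C := fun hc ↦ by
    obtain ⟨i, hi⟩ := hC c hc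
    exact lt_irrefl _ hi
  refine hz.sum_ne_zero (insert c C) ⟨c, by simp⟩ (fun a ↦ if a = c then 1 else - v a) ?_ ?_
  · intro a ha
    by_cases hac : a = c
    · simp [hac]
    · simp only [hac, if_false, IsUnit.neg_iff]
      by_contra hn
      exact hv a ((Finset.mem_insert.1 ha).resolve_left hac) hn
  · rw [Finset.sum_insert hcC]
    simp only [if_true, one_mul]
    rw [hx, ← Finset.sum_add_distrib]
    refine Finset.sum_eq_zero fun a ha ↦ ?_
    have : a ≠ c := fun h ↦ hcC (h ▸ ha)
    simp [this]

/-- Independence of monomials over the quotient by some of the parameters. -/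
lemma IsRSP.mem_span_of_mul_mon_mem [IsNoetherianRing A] [IsLocalRing A] {z : Fin n → A}
    (hz : IsRSP z) (S : Set (Fin n)) {b : Fin n → ℕ} {v : A}
    (h : v * mon z b ∈ monIdeal z {a | ∃ i ∈ S, b i < a i}) : v ∈ Ideal.span (z '' S) := by
  classical
  by_contra hvS
  obtain ⟨C, w, -, hw, hx⟩ := exists_expansion z Set.univ (fun i _ ↦ hz.mem i) v
  rw [Set.image_univ, hz.span] at hw
  have hex : (C.filter fun e ↦ ∀ i ∈ S, e i = 0).Nonempty := by
    by_contra hne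
    rw [Finset.not_nonempty_iff_eq_empty, Finset.filter_eq_empty_iff] at hne
    refine hvS (hx ▸ sum_mem fun e he ↦ Ideal.mul_mem_left _ _ ?_)
    have := hne he
    push Not at this
    obtain ⟨i, hi, hi0⟩ := this
    exact mon_mem_span z S hi hi0
  -- By minimality among the exponents vanishing on `S`, no other term of `v * z^b` has exponent
  -- below `b + e`. So `z^(b + e)` would lie in the ideal excluded by `IsRSP.mon_notMem`.
  obtain ⟨e, he⟩ := Finset.exists_minimal hex
  have heC := (Finset.mem_filter.1 he.prop).1
  have he0 := (Finset.mem_filter.1 he.prop).2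
  have hu : IsUnit (w e) := by
    by_contra hn
    exact hw e heC hn
  refine hz.mon_notMem (b + e) ?_
  rw [← Ideal.unit_mul_mem_iff_mem _ hu]
  have h1 : v * mon z b ∈ monIdeal z {a | ∃ i, (b + e) i < a i} := by
    refine monIdeal_mono z ?_ h
    rintro a ⟨i, hi, hlt⟩
    exact ⟨i, by simpa [he0 i hi] using hlt⟩
  rw [hx, ← Finset.add_sum_erase C _ heC, add_mul, mul_assoc, ← mon_add, add_comm e b] at h1
  refine (Ideal.add_mem_iff_left _ ?_).1 h1
  rw [Finset.sum_mul]
  refine sum_mem fun a ha ↦ ?_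
  rw [Finset.mem_erase] at ha
  rw [mul_assoc, ← mon_add]
  refine Ideal.mul_mem_left _ _ (mon_mem_monIdeal z (b := a + b) ?_ le_rfl)
  by_contra hn
  have hae : a ≤ e := fun i ↦ by
    have h2 : (a + b) i ≤ (b + e) i := not_lt.1 fun hlt ↦ hn ⟨i, hlt⟩
    simp only [Pi.add_apply] at h2
    exact Nat.le_of_add_le_add_left (h2.trans' (Nat.add_comm _ _).le)
  refine ha.1 (le_antisymm hae (he.le_of_le (Finset.mem_filter.2 ⟨ha.2, fun i hi ↦ ?_⟩) hae))
  exact Nat.le_zero.1 ((hae i).trans (he0 i hi).le)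

/-- If a sum of monomials lies in a monomial ideal, then so does every monomial of the sum which
has a coefficient outside of the ideal of the variables and is not a multiple of another one. -/
theorem IsRSP.exists_le_of_sum_mem [IsNoetherianRing A] [IsLocalRing A] {z : Fin n → A}
    (hz : IsRSP z) (S : Set (Fin n)) {M : Set (Fin n → ℕ)} (hM : ∀ a ∈ M, ∀ i ∉ S, a i = 0)
    {κ : Type*} (K : Finset κ) (v : κ → A) (b : κ → Fin n → ℕ)
    (k : κ) (hk : k ∈ K) (hv : v k ∉ Ideal.span (z '' S))
    (hS : ∀ l ∈ K, ∀ i ∉ S, b l i = 0)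
    (hmin : ∀ l ∈ K, b l ≤ b k → l = k) (h : ∑ l ∈ K, v l * mon z (b l) ∈ monIdeal z M) :
    ∃ d ∈ M, d ≤ b k := by
  classical
  by_contra hne
  push Not at hne
  -- An exponent supported on `S` and not below `b k` exceeds it somewhere on `S`. This covers both
  -- `M` and the other terms of the sum.
  have key : ∀ a : Fin n → ℕ, (∀ i ∉ S, a i = 0) → ¬ a ≤ b k →
      a ∈ {a : Fin n → ℕ | ∃ i ∈ S, b k i < a i} := by
    intro a ha hle
    rw [Pi.le_def] at hle
    push Not at hle
    obtain ⟨i, hi⟩ := hle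
    refine ⟨i, ?_, hi⟩
    by_contra hiS
    rw [ha i hiS] at hi
    omega
  refine hv (hz.mem_span_of_mul_mon_mem S (b := b k) ?_)
  have h1 : ∑ l ∈ K, v l * mon z (b l) ∈ monIdeal z {a | ∃ i ∈ S, b k i < a i} :=
    monIdeal_mono z (fun a ha ↦ key a (hM a ha) (hne a ha)) h
  rw [← Finset.add_sum_erase K _ hk] at h1
  refine (Ideal.add_mem_iff_left _ ?_).1 h1
  refine sum_mem fun l hl ↦ Ideal.mul_mem_left _ _ (mon_mem_monIdeal z (b := b l) ?_ le_rfl)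
  rw [Finset.mem_erase] at hl
  exact key _ (hS l hl.2) fun hle ↦ hl.1 (hmin l hl.2 hle)

/-- Sums of two sets of exponents contain a sum which has a unique decomposition and is not
larger than any other sum. -/
lemma exists_isolated_sum {C D : Finset (Fin n → ℕ)} (hC : C.Nonempty) (hD : D.Nonempty) :
    ∃ a₀ ∈ C, ∃ b₀ ∈ D, ∀ a ∈ C, ∀ b ∈ D, a + b ≤ a₀ + b₀ → a = a₀ ∧ b = b₀ := by
  -- Lexicographic minima work: the lexicographic order refines the componentwise one and is
  -- strictly compatible with addition.
  obtain ⟨a₀, ha₀, hamin⟩ := C.exists_min_image toLex hC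
  obtain ⟨b₀, hb₀, hbmin⟩ := D.exists_min_image toLex hD
  refine ⟨a₀, ha₀, b₀, hb₀, fun a ha b hb hle ↦ ?_⟩
  have h1 := hamin a ha
  have h2 := hbmin b hb
  have h3 : toLex a + toLex b ≤ toLex a₀ + toLex b₀ := Pi.toLex_monotone hle
  constructor <;> rw [← toLex_inj] <;> by_contra hne
  · exact absurd h3 (not_le.2 (add_lt_add_of_lt_of_le (lt_of_le_of_ne h1 (Ne.symm hne)) h2))
  · exact absurd h3 (not_le.2 (add_lt_add_of_le_of_lt h1 (lt_of_le_of_ne h2 (Ne.symm hne))))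

/-- Parameters of a regular system generate a prime ideal. -/
theorem IsRSP.isPrime_span [IsNoetherianRing A] [IsLocalRing A] {z : Fin n → A}
    (hz : IsRSP z) (S : Set (Fin n)) : (Ideal.span (z '' S)).IsPrime := by
  classical
  refine ⟨fun h ↦ ?_, fun {x y} hxy ↦ ?_⟩
  · have : Ideal.span (z '' S) ≤ IsLocalRing.maximalIdeal A := by
      rw [Ideal.span_le]; rintro _ ⟨i, -, rfl⟩; exact hz.mem i
    exact (IsLocalRing.maximalIdeal.isMaximal A).ne_top (top_le_iff.1 (h ▸ this))
  by_contra! hne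
  obtain ⟨hx, hy⟩ := hne
  have main : ∀ x ∉ Ideal.span (z '' S), ∃ (C : Finset (Fin n → ℕ)) (v : (Fin n → ℕ) → A),
      x = ∑ a ∈ C, v a * mon z a ∧ (∀ a ∈ C, IsUnit (v a)) ∧
      (C.filter fun e ↦ ∀ i ∈ S, e i = 0).Nonempty := by
    intro x hx
    obtain ⟨C, v, -, hv, hxv⟩ := exists_expansion z Set.univ (fun i _ ↦ hz.mem i) x
    rw [Set.image_univ, hz.span] at hv
    refine ⟨C, v, hxv, fun a ha ↦ by_contra (hv a ha), ?_⟩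
    by_contra hne
    rw [Finset.not_nonempty_iff_eq_empty, Finset.filter_eq_empty_iff] at hne
    refine hx (hxv ▸ sum_mem fun e he ↦ Ideal.mul_mem_left _ _ ?_)
    have := hne he
    push Not at this
    obtain ⟨i, hi, hi0⟩ := this
    exact mon_mem_span z S hi hi0
  obtain ⟨C, v, hxv, hv, hC⟩ := main x hx
  obtain ⟨D, w, hyw, hw, hD⟩ := main y hy
  -- Isolation among exponents vanishing on `S` suffices: a pair whose sum lies below the chosen one
  -- vanishes on `S` too.
  obtain ⟨a₀, ha₀, b₀, hb₀, hmin⟩ := exists_isolated_sum hC hD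
  rw [Finset.mem_filter] at ha₀ hb₀
  have hmem : Ideal.span (z '' S) = monIdeal z ((fun i ↦ Pi.single i 1) '' S) := by
    rw [monIdeal, Set.image_image]
    simp
  have h := hz.exists_le_of_sum_mem Set.univ (M := (fun i ↦ Pi.single i 1) '' S) (by simp)
    (C ×ˢ D) (fun k ↦ v k.1 * w k.2) (fun k ↦ k.1 + k.2) (a₀, b₀) (by simp [ha₀.1, hb₀.1])
    ?_ (by simp) ?_ ?_
  · obtain ⟨_, ⟨i, hi, rfl⟩, hle⟩ := h
    have := hle i
    simp [ha₀.2 i hi, hb₀.2 i hi] at this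
  · rw [Set.image_univ, hz.span]
    exact fun h ↦ h ((hv _ ha₀.1).mul (hw _ hb₀.1))
  · rintro ⟨a, b⟩ hab hle
    simp only [Finset.mem_product] at hab
    have hS : ∀ i ∈ S, a i = 0 ∧ b i = 0 := fun i hi ↦ by
      have := hle i
      simpa [ha₀.2 i hi, hb₀.2 i hi] using this
    have := hmin a (Finset.mem_filter.2 ⟨hab.1, fun i hi ↦ (hS i hi).1⟩)
      b (Finset.mem_filter.2 ⟨hab.2, fun i hi ↦ (hS i hi).2⟩) hle
    simp [this.1, this.2]
  · rw [← hmem]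
    convert hxy using 1
    rw [hxv, hyw, Finset.sum_mul_sum, Finset.sum_product]
    refine Finset.sum_congr rfl fun a _ ↦ Finset.sum_congr rfl fun b _ ↦ ?_
    rw [mon_add]
    ring

/-- All monomials of an element of a monomial ideal lie in this ideal. -/
theorem IsRSP.mon_mem_of_sum_mem [IsNoetherianRing A] [IsLocalRing A] {z : Fin n → A}
    (hz : IsRSP z) (S : Set (Fin n)) {M : Set (Fin n → ℕ)} (hM : ∀ a ∈ M, ∀ i ∉ S, a i = 0)
    (C : Finset (Fin n → ℕ)) (v : (Fin n → ℕ) → A) (hC : ∀ a ∈ C, ∀ i ∉ S, a i = 0)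
    (hv : ∀ a ∈ C, v a ∉ Ideal.span (z '' S)) (h : ∑ a ∈ C, v a * mon z a ∈ monIdeal z M)
    (a : Fin n → ℕ) (ha : a ∈ C) : ∃ d ∈ M, d ≤ a := by
  classical
  by_contra hne
  have hex : (C.filter fun a ↦ ¬ ∃ d ∈ M, d ≤ a).Nonempty := ⟨a, by simp only [Finset.mem_filter]; exact ⟨ha, hne⟩⟩
  -- A minimal counterexample is isolated, since any exponent of the sum below it is a
  -- counterexample as well.
  obtain ⟨c, hc⟩ := Finset.exists_minimal hex
  have hcC := Finset.mem_filter.1 hc.prop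
  refine hcC.2 (hz.exists_le_of_sum_mem S hM C v id c hcC.1 (hv c hcC.1)
    (fun l hl ↦ hC l hl) (fun l hl hle ↦ ?_) h)
  refine le_antisymm hle (hc.le_of_le (Finset.mem_filter.2 ⟨hl, ?_⟩) hle)
  rintro ⟨d, hd, hdl⟩
  exact hcC.2 ⟨d, hd, hdl.trans hle⟩

lemma span_pow_eq_monIdeal (z : Fin n → A) (S : Set (Fin n)) (N : ℕ) :
    Ideal.span (z '' S) ^ N = monIdeal z {a | (∀ i ∉ S, a i = 0) ∧ deg a = N} := by
  apply le_antisymm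
  · induction N with
    | zero =>
      rw [pow_zero, Ideal.one_eq_top, top_le_iff, Ideal.eq_top_iff_one, ← mon_zero z]
      exact mon_mem_monIdeal z (b := 0) (by simp [deg]) le_rfl
    | succ N ih =>
      rw [pow_succ]
      refine (Ideal.mul_mono_left ih).trans ?_
      rw [monIdeal, Ideal.span_mul_span', Ideal.span_le]
      rintro _ ⟨_, ⟨a, ⟨ha, haN⟩, rfl⟩, _, ⟨i, hi, rfl⟩, rfl⟩
      have : mon z a * z i = mon z (a + Pi.single i 1) := by
        rw [mon_add, mon_single, pow_one]
      dsimp only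
      rw [this]
      refine mon_mem_monIdeal z (b := a + Pi.single i 1) ⟨fun j hj ↦ ?_, ?_⟩ le_rfl
      · have : j ≠ i := fun h ↦ hj (h ▸ hi)
        simp [ha j hj, this]
      · rw [deg_add, haN]; simp [deg]
  · rw [monIdeal, Ideal.span_le]
    rintro _ ⟨a, ⟨ha, rfl⟩, rfl⟩
    exact mon_mem_pow_deg z S ha

/-- Elements outside of the ideal of the variables are nonzerodivisors modulo monomial ideals. -/
theorem IsRSP.mem_of_mul_mem [IsNoetherianRing A] [IsLocalRing A] {z : Fin n → A}
    (hz : IsRSP z) (S : Set (Fin n)) {M : Set (Fin n → ℕ)} (hM : ∀ a ∈ M, ∀ i ∉ S, a i = 0)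
    {u x : A} (hu : u ∉ Ideal.span (z '' S)) (h : u * x ∈ monIdeal z M) : x ∈ monIdeal z M := by
  obtain ⟨C, v, hC, hv, rfl⟩ := exists_expansion z S (fun i _ ↦ hz.mem i) x
  refine sum_mem fun a ha ↦ Ideal.mul_mem_left _ _ ?_
  obtain ⟨d, hd, hda⟩ := hz.mon_mem_of_sum_mem S hM C (fun a ↦ u * v a) hC
    (fun a ha hmem ↦ ((hz.isPrime_span S).mem_or_mem hmem).elim hu (hv a ha))
    (by simpa only [Finset.mul_sum, mul_assoc] using h) a ha
  exact mon_mem_monIdeal z hd hda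

/-- The order of vanishing along some of the parameters is additive. -/
theorem IsRSP.mul_notMem_pow [IsNoetherianRing A] [IsLocalRing A] {z : Fin n → A}
    (hz : IsRSP z) (S : Set (Fin n)) {p q : ℕ} {x y : A} (hx : x ∉ Ideal.span (z '' S) ^ (p + 1))
    (hy : y ∉ Ideal.span (z '' S) ^ (q + 1)) : x * y ∉ Ideal.span (z '' S) ^ (p + q + 1) := by
  classical
  have main : ∀ (p : ℕ) (x : A), x ∉ Ideal.span (z '' S) ^ (p + 1) →
      ∃ (C : Finset (Fin n → ℕ)) (v : (Fin n → ℕ) → A) (d : ℕ), d ≤ p ∧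
      x = ∑ a ∈ C, v a * mon z a ∧ (∀ a ∈ C, v a ∉ Ideal.span (z '' S)) ∧
      (∀ a ∈ C, ∀ i ∉ S, a i = 0) ∧ (∀ a ∈ C, d ≤ deg a) ∧
      (C.filter fun e ↦ deg e = d).Nonempty := by
    intro p x hx
    obtain ⟨C, v, hC, hv, hxv⟩ := exists_expansion z S (fun i _ ↦ hz.mem i) x
    have hex : ∃ a ∈ C, deg a ≤ p := by
      by_contra! hne
      refine hx (hxv ▸ sum_mem fun e he ↦ Ideal.mul_mem_left _ _ ?_)
      exact Ideal.pow_le_pow_right (hne e he) (mon_mem_pow_deg z S (hC e he))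
    obtain ⟨a, ha, hap⟩ := hex
    obtain ⟨a₀, ha₀, hmin⟩ := C.exists_min_image deg ⟨a, ha⟩
    exact ⟨C, v, deg a₀, (hmin a ha).trans hap, hxv, hv, hC, hmin,
      ⟨a₀, Finset.mem_filter.2 ⟨ha₀, rfl⟩⟩⟩
  intro hxy
  obtain ⟨C, v, d, hd, hxv, hv, hCS, hCd, hC⟩ := main p x hx
  obtain ⟨D, w, d', hd', hyw, hw, hDS, hDd, hD⟩ := main q y hy
  -- Product of leading forms: an isolated sum of lowest-degree exponents survives, in degree at
  -- most `p + q`.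
  obtain ⟨a₀, ha₀, b₀, hb₀, hmin⟩ := exists_isolated_sum hC hD
  rw [Finset.mem_filter] at ha₀ hb₀
  rw [span_pow_eq_monIdeal] at hxy
  have h := hz.exists_le_of_sum_mem S (M := {a | (∀ i ∉ S, a i = 0) ∧ deg a = p + q + 1})
    (fun a ha ↦ ha.1)
    (C ×ˢ D) (fun k ↦ v k.1 * w k.2) (fun k ↦ k.1 + k.2) (a₀, b₀) (by simp [ha₀.1, hb₀.1])
    (fun h ↦ ((hz.isPrime_span S).mem_or_mem h).elim (hv _ ha₀.1) (hw _ hb₀.1)) ?_ ?_ ?_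
  · obtain ⟨c, ⟨-, hc⟩, hle⟩ := h
    have : deg c ≤ deg (a₀ + b₀) := Finset.sum_le_sum fun i _ ↦ hle i
    rw [deg_add, hc] at this
    omega
  · rintro ⟨a, b⟩ hab i hi
    rw [Finset.mem_product] at hab
    simp [hCS a hab.1 i hi, hDS b hab.2 i hi]
  · rintro ⟨a, b⟩ hab hle
    simp only [Finset.mem_product] at hab
    have : deg (a + b) ≤ deg (a₀ + b₀) := Finset.sum_le_sum fun i _ ↦ hle i
    rw [deg_add, deg_add, ha₀.2, hb₀.2] at this
    have h1 := hCd a hab.1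
    have h2 := hDd b hab.2
    have := hmin a (Finset.mem_filter.2 ⟨hab.1, by omega⟩)
      b (Finset.mem_filter.2 ⟨hab.2, by omega⟩) hle
    simp [this.1, this.2]
  · convert hxy using 1
    rw [hxv, hyw, Finset.sum_mul_sum, Finset.sum_product]
    refine Finset.sum_congr rfl fun a _ ↦ Finset.sum_congr rfl fun b _ ↦ ?_
    rw [mon_add]
    ring

end RegularSystem

end Toroidal

namespace Toroidal

/-! ### Monomials in a local ring of the blow-up -/

section BlowupStalk

variable {A O : Type*} [CommRing A] [CommRing O] {n : ℕ}

/-- The local ring `O` is, via `φ : A →+* O`, a local ring of the blow-up of the ideal generated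
by the `z i` with `i ∈ T`, in the chart of `z t`. The elements `y i` are the transforms of
the `z i`. -/
structure IsBlowupStalk [IsLocalRing O] (φ : A →+* O) (z : Fin n → A) (T : Set (Fin n))
    (t : Fin n) (y : Fin n → O) : Prop where
  mem : t ∈ T
  local_hom : IsLocalHom φ
  injective : Function.Injective φ
  regular : φ (z t) ∈ nonZeroDivisors O
  map_of_mem : ∀ i ∈ T, φ (z i) = φ (z t) * y i
  map_of_notMem : ∀ i ∉ T, φ (z i) = y i
  exists_fraction : ∀ β : O, ∃ (N : ℕ) (f h : A) (u : O), f ∈ Ideal.span (z '' T) ^ N ∧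
    h ∈ Ideal.span (z '' T) ^ N ∧ IsUnit u ∧ φ h = φ (z t) ^ N * u ∧ φ h * β = φ f

namespace IsBlowupStalk

variable [IsLocalRing O] {φ : A →+* O} {z : Fin n → A}
  {T : Set (Fin n)} {t : Fin n} {y : Fin n → O}

lemma map_mem_pow (H : IsBlowupStalk φ z T t y) {N : ℕ} {f : A}
    (hf : f ∈ Ideal.span (z '' T) ^ N) : ∃ γ, φ f = φ (z t) ^ N * γ := by
  have h1 : φ f ∈ (Ideal.span (z '' T) ^ N).map φ := Ideal.mem_map_of_mem _ hf
  have h2 : (Ideal.span (z '' T)).map φ ≤ Ideal.span {φ (z t)} := by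
    rw [Ideal.map_span, Ideal.span_le]
    rintro _ ⟨_, ⟨i, hi, rfl⟩, rfl⟩
    exact Ideal.mem_span_singleton.2 ⟨_, H.map_of_mem i hi⟩
  rw [Ideal.map_pow] at h1
  have h3 := Ideal.pow_right_mono h2 N h1
  rw [Ideal.span_singleton_pow] at h3
  exact Ideal.mem_span_singleton.1 h3

lemma cancel (H : IsBlowupStalk φ z T t y) {N : ℕ} {a b : O}
    (h : φ (z t) ^ N * a = φ (z t) ^ N * b) : a = b :=
  (mul_cancel_left_mem_nonZeroDivisors (pow_mem H.regular N)).1 h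

lemma exists_common_fraction (H : IsBlowupStalk φ z T t y) {κ : Type*} (K : Finset κ)
    (β : κ → O) : ∃ (N : ℕ) (f : κ → A) (h : A) (u : O),
      (∀ k ∈ K, f k ∈ Ideal.span (z '' T) ^ N) ∧ h ∈ Ideal.span (z '' T) ^ N ∧ IsUnit u ∧
      φ h = φ (z t) ^ N * u ∧ ∀ k ∈ K, φ h * β k = φ (f k) := by
  classical
  induction K using Finset.induction_on with
  | empty => exact ⟨0, 0, 1, 1, by simp⟩
  | insert k K hk ih =>
    obtain ⟨N, f, h, u, hf, hh, hu, h1, h2⟩ := ih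
    obtain ⟨N', f', h', u', hf', hh', hu', h1', h2'⟩ := H.exists_fraction (β k)
    refine ⟨N + N', fun l ↦ if l = k then h * f' else f l * h', h * h', u * u', ?_, ?_,
      hu.mul hu', ?_, ?_⟩
    · intro l hl
      rw [pow_add]
      by_cases hlk : l = k
      · simpa [hlk] using Ideal.mul_mem_mul hh hf'
      · simpa [hlk] using Ideal.mul_mem_mul (hf l ((Finset.mem_insert.1 hl).resolve_left hlk)) hh'
    · rw [pow_add]; exact Ideal.mul_mem_mul hh hh'
    · rw [map_mul, h1, h1']; ring
    · intro l hl
      by_cases hlk : l = k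
      · subst hlk
        simp only [if_true, map_mul, ← h2']; ring
      · simp only [hlk, if_false, map_mul, ← h2 l ((Finset.mem_insert.1 hl).resolve_left hlk)]
        ring

open Classical in
/-- The order of a monomial along the center. -/
noncomputable def _root_.Toroidal.degOn (T : Set (Fin n)) (a : Fin n → ℕ) : ℕ :=
  ∑ i, if i ∈ T then a i else 0

lemma _root_.Toroidal.degOn_add (T : Set (Fin n)) (a b : Fin n → ℕ) :
    degOn T (a + b) = degOn T a + degOn T b := by
  classical
  rw [degOn, degOn, degOn, ← Finset.sum_add_distrib]
  refine Finset.sum_congr rfl fun i _ ↦ ?_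
  split_ifs <;> simp

lemma _root_.Toroidal.degOn_mono (T : Set (Fin n)) {a b : Fin n → ℕ} (h : a ≤ b) :
    degOn T a ≤ degOn T b := by
  classical
  refine Finset.sum_le_sum fun i _ ↦ ?_
  split_ifs
  · exact h i
  · rfl

lemma _root_.Toroidal.degOn_eq_deg (T : Set (Fin n)) {a : Fin n → ℕ} (h : ∀ i ∉ T, a i = 0) :
    degOn T a = deg a := by
  classical
  refine Finset.sum_congr rfl fun i _ ↦ ?_
  split_ifs with hi
  · rfl
  · exact (h i hi).symm

lemma map_mon_eq (H : IsBlowupStalk φ z T t y) (a : Fin n → ℕ) :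
    φ (mon z a) = φ (z t) ^ degOn T a * mon y a := by
  classical
  rw [map_mon, mon, mon, degOn, ← Finset.prod_pow_eq_pow_sum, ← Finset.prod_mul_distrib]
  refine Finset.prod_congr rfl fun i _ ↦ ?_
  split_ifs with hi
  · rw [H.map_of_mem i hi, mul_pow]
  · rw [H.map_of_notMem i hi, pow_zero, one_mul]

variable [IsLocalRing A]

lemma map_mem_maximalIdeal (H : IsBlowupStalk φ z T t y) {x : A}
    (hx : x ∈ IsLocalRing.maximalIdeal A) : φ x ∈ IsLocalRing.maximalIdeal O := by
  have := H.local_hom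
  exact fun hu ↦ hx ((isUnit_map_iff φ x).1 hu)

/-- A denominator has order exactly `N` along the center; otherwise the nonunit `φ (z t)` would
divide the unit `u`. -/
lemma notMem_pow (H : IsBlowupStalk φ z T t y) (hz : IsRSP z) {N : ℕ} {h : A} {u : O}
    (hu : IsUnit u) (hh : φ h = φ (z t) ^ N * u) : h ∉ Ideal.span (z '' T) ^ (N + 1) := by
  intro hmem
  obtain ⟨γ, hγ⟩ := H.map_mem_pow hmem
  rw [hh, pow_succ, mul_assoc] at hγ
  rw [H.cancel hγ] at hu
  exact H.map_mem_maximalIdeal (hz.mem t) (isUnit_of_mul_isUnit_left hu)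

variable [IsNoetherianRing A]

/-- Orders along the center can be read off upstairs: if `x` had too small an order, multiplying by
a denominator of `β` would contradict additivity of orders. -/
lemma mem_pow_of_map (H : IsBlowupStalk φ z T t y) (hz : IsRSP z) {N : ℕ} {x : A} {β : O}
    (hx : φ x = φ (z t) ^ N * β) : x ∈ Ideal.span (z '' T) ^ N := by
  rcases N with _ | N
  · simp
  obtain ⟨M, f, h, u, hf, hh, hu, h1, h2⟩ := H.exists_fraction β
  by_contra hn
  refine hz.mul_notMem_pow T hn (H.notMem_pow hz hu h1) ?_
  have : x * h = z t ^ (N + 1) * f := by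
    apply H.injective
    rw [map_mul, map_mul, map_pow, hx, ← h2]
    ring
  rw [this, show N + M + 1 = N + 1 + M by ring, pow_add]
  exact Ideal.mul_mem_mul
    (Ideal.pow_mem_pow (Ideal.subset_span (Set.mem_image_of_mem z H.mem)) _) hf

/-- The exceptional divisor is locally integral. -/
lemma isPrime_span (H : IsBlowupStalk φ z T t y) (hz : IsRSP z) :
    (Ideal.span {φ (z t)}).IsPrime := by
  refine ⟨fun h ↦ ?_, fun {β β'} hββ' ↦ ?_⟩
  · rw [Ideal.span_singleton_eq_top] at h
    exact H.map_mem_maximalIdeal (hz.mem t) h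
  obtain ⟨γ, hγ⟩ := Ideal.mem_span_singleton.1 hββ'
  obtain ⟨N, f, h, u, hf, hh, hu, h1, h2⟩ := H.exists_fraction β
  obtain ⟨N', f', h', u', hf', hh', hu', h1', h2'⟩ := H.exists_fraction β'
  have key : φ (f * f') = φ (z t) ^ (N + N' + 1) * (u * u' * γ) := by
    rw [map_mul, ← h2, ← h2', h1, h1']
    linear_combination φ (z t) ^ N * u * φ (z t) ^ N' * u' * hγ
  have hmem := H.mem_pow_of_map hz key
  -- A fraction whose numerator has larger order than its denominator is divisible by the
  -- exceptional equation. Additivity of orders provides such a numerator for one of the two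
  -- factors.
  have aux : ∀ {β : O} {N : ℕ} {f h : A} {u : O}, IsUnit u → φ h = φ (z t) ^ N * u →
      φ h * β = φ f → f ∈ Ideal.span (z '' T) ^ (N + 1) → β ∈ Ideal.span {φ (z t)} := by
    intro β N f h u hu h1 h2 hmem
    obtain ⟨γ, hγ⟩ := H.map_mem_pow hmem
    rw [← h2, h1, pow_succ, mul_assoc, mul_assoc] at hγ
    have := H.cancel hγ
    rw [← Ideal.unit_mul_mem_iff_mem _ hu, this]
    exact Ideal.mul_mem_right _ _ (Ideal.mem_span_singleton_self _)
  by_contra! hne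
  exact hz.mul_notMem_pow T (fun h ↦ hne.1 (aux hu h1 h2 h)) (fun h ↦ hne.2 (aux hu' h1' h2' h))
    hmem

lemma _root_.Toroidal.IsRSP.exists_le_of_mem (hz : IsRSP z) {M : Set (Fin n → ℕ)} {i : Fin n}
    (h : z i ∈ monIdeal z M) : ∃ d ∈ M, d ≤ Pi.single i 1 := by
  have h1 : ∀ a ∈ ({Pi.single i 1} : Finset (Fin n → ℕ)),
      (1 : (Fin n → ℕ) → A) a ∉ Ideal.span (z '' Set.univ) :=
    fun _ _ h ↦ (hz.isPrime_span Set.univ).ne_top ((Ideal.eq_top_iff_one _).2 h)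
  exact hz.mon_mem_of_sum_mem Set.univ (by simp) {Pi.single i 1} 1 (by simp) h1 (by simpa using h)
    (Pi.single i 1) (by simp)

lemma _root_.Toroidal.IsRSP.notMem_span (hz : IsRSP z) {S : Set (Fin n)} {i : Fin n} (hi : i ∉ S) :
    z i ∉ Ideal.span (z '' S) := by
  intro h
  have h1 : Ideal.span (z '' S) = monIdeal z ((fun i ↦ Pi.single i 1) '' S) := by
    rw [monIdeal, Set.image_image]
    simp
  rw [h1] at h
  obtain ⟨d, ⟨j, hj, rfl⟩, hle⟩ := hz.exists_le_of_mem h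
  have hij : j ≠ i := fun h ↦ hi (h ▸ hj)
  have := hle j
  simp [hij] at this

lemma _root_.Toroidal.IsRSP.notMem_span_sq (hz : IsRSP z) {S : Set (Fin n)} {i : Fin n} :
    z i ∉ Ideal.span (z '' S) ^ 2 := by
  intro h
  rw [span_pow_eq_monIdeal] at h
  obtain ⟨d, ⟨-, hd⟩, hle⟩ := hz.exists_le_of_mem h
  have h2 : deg d ≤ deg (Pi.single i 1 : Fin n → ℕ) := Finset.sum_le_sum fun j _ ↦ hle j
  rw [hd] at h2
  simp [deg] at h2

/-- For `i ∈ T` the order of `z i` is one, so `x` has order at least `N - 1`. For `i ∉ T` the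
parameter is a nonzerodivisor modulo `I ^ N`, so `x` has order at least `N`. Either way `y i` splits
off. -/
lemma map_mul_mem (H : IsBlowupStalk φ z T t y) (hz : IsRSP z) (i : Fin n) {N : ℕ} {x : A}
    (hx : z i * x ∈ Ideal.span (z '' T) ^ N) :
    ∃ γ, φ (z i * x) = φ (z t) ^ N * (y i * γ) := by
  by_cases hi : i ∈ T
  · rcases N with _ | N
    · exact ⟨φ (z t) * φ x, by rw [map_mul, H.map_of_mem i hi]; ring⟩
    have hxN : x ∈ Ideal.span (z '' T) ^ N := by
      rcases N with _ | N
      · simp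
      by_contra hn
      have := hz.mul_notMem_pow T (p := 1) (hz.notMem_span_sq (i := i)) hn
      rw [add_comm 1 N] at this
      exact this hx
    obtain ⟨γ, hγ⟩ := H.map_mem_pow hxN
    exact ⟨γ, by rw [map_mul, H.map_of_mem i hi, hγ]; ring⟩
  · have hxN : x ∈ Ideal.span (z '' T) ^ N := by
      rw [span_pow_eq_monIdeal] at hx ⊢
      exact hz.mem_of_mul_mem T (fun a ha ↦ ha.1) (hz.notMem_span hi) hx
    obtain ⟨γ, hγ⟩ := H.map_mem_pow hxN
    exact ⟨γ, by rw [map_mul, H.map_of_notMem i hi, hγ]; ring⟩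

/-- The element `y i` defines the birational transform of the divisor of `z i`. -/
theorem mul_mem_radical_iff (H : IsBlowupStalk φ z T t y) (hz : IsRSP z) (i : Fin n) (β : O) :
    φ (z t) * β ∈ (Ideal.span {φ (z i)}).radical ↔ β ∈ Ideal.span {y i} := by
  constructor
  · rintro ⟨k, hk⟩
    by_cases hyi : IsUnit (y i)
    · rw [Ideal.span_singleton_eq_top.2 hyi]; trivial
    have hit : i ≠ t := by
      rintro rfl
      have h1 := H.map_of_mem i H.mem
      have : y i = 1 := (H.cancel (N := 1) (by simpa using h1)).symm
      exact hyi (this ▸ isUnit_one)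
    have hni : z t ∉ Ideal.span {z i} := by
      have := hz.notMem_span (S := {i}) (i := t) (by simpa using hit.symm)
      rwa [Set.image_singleton] at this
    have hpr : (Ideal.span {z i}).IsPrime := by
      have := hz.isPrime_span {i}
      rwa [Set.image_singleton] at this
    obtain ⟨γ, hγ⟩ := Ideal.mem_span_singleton.1 hk
    obtain ⟨N, f, h, u, hf, hh, hu, h1, h2⟩ := H.exists_fraction β
    obtain ⟨N', f', h', u', hf', hh', hu', h1', h2'⟩ := H.exists_fraction γ
    -- Clearing denominators moves the relation to `A`, where `(z i)` is prime. It contains neither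
    -- `z t` nor `h'`, since a denominator divisible by `z i` would make `y i` a unit. So it
    -- contains the numerator `f`.
    have key : z t ^ k * f ^ k * h' = z i * (h ^ k * f') := by
      apply H.injective
      simp only [map_mul, map_pow, ← h2, ← h2']
      linear_combination φ h ^ k * φ h' * hγ
    have hmem : z t ^ k * f ^ k * h' ∈ Ideal.span {z i} := by
      rw [key]; exact Ideal.mul_mem_right _ _ (Ideal.mem_span_singleton_self _)
    have hh'n : h' ∉ Ideal.span {z i} := by
      intro hmem
      obtain ⟨x, rfl⟩ := Ideal.mem_span_singleton.1 hmem
      obtain ⟨δ, hδ⟩ := H.map_mul_mem hz i hh'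
      rw [h1'] at hδ
      exact hyi (isUnit_of_mul_isUnit_left (H.cancel hδ ▸ hu'))
    have hfmem : f ∈ Ideal.span {z i} := by
      rcases hpr.mem_or_mem hmem with h | h
      · rcases hpr.mem_or_mem h with h | h
        · exact absurd (hpr.mem_of_pow_mem _ h) hni
        · exact hpr.mem_of_pow_mem _ h
      · exact absurd h hh'n
    obtain ⟨x, rfl⟩ := Ideal.mem_span_singleton.1 hfmem
    obtain ⟨δ, hδ⟩ := H.map_mul_mem hz i hf
    rw [← h2, h1, mul_assoc] at hδ
    rw [← Ideal.unit_mul_mem_iff_mem _ hu, H.cancel hδ]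
    exact Ideal.mul_mem_right _ _ (Ideal.mem_span_singleton_self _)
  · intro hβ
    obtain ⟨γ, rfl⟩ := Ideal.mem_span_singleton.1 hβ
    refine Ideal.le_radical (Ideal.mem_span_singleton.2 ?_)
    by_cases hi : i ∈ T
    · exact ⟨γ, by rw [H.map_of_mem i hi]; ring⟩
    · exact ⟨φ (z t) * γ, by rw [H.map_of_notMem i hi]; ring⟩

/-- If a monomial ideal upstairs contains the image of a sum of monomials, then it contains the
images of all monomials of the sum. -/
theorem map_mon_mem (H : IsBlowupStalk φ z T t y) (hz : IsRSP z) {S : Set (Fin n)} (hTS : T ⊆ S)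
    (𝔑 : Set (ℕ × (Fin n → ℕ))) (h𝔑 : ∀ c ∈ 𝔑, ∀ i ∉ S, c.2 i = 0)
    (C : Finset (Fin n → ℕ)) (v : (Fin n → ℕ) → A) (hC : ∀ a ∈ C, ∀ i ∉ S, a i = 0)
    (hv : ∀ a ∈ C, v a ∉ Ideal.span (z '' S))
    (hf : φ (∑ a ∈ C, v a * mon z a) ∈
      Ideal.span ((fun c : ℕ × (Fin n → ℕ) ↦ φ (z t) ^ c.1 * mon y c.2) '' 𝔑))
    (a : Fin n → ℕ) (ha : a ∈ C) : φ (mon z a) ∈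
      Ideal.span ((fun c : ℕ × (Fin n → ℕ) ↦ φ (z t) ^ c.1 * mon y c.2) '' 𝔑) := by
  classical
  -- Divisibility of `e^(degOn T a) * y^a` by a generator; exponents of those `y i` that are units
  -- do not matter.
  let good : (Fin n → ℕ) → Prop := fun a ↦
    ∃ c ∈ 𝔑, c.1 ≤ degOn T a ∧ ∀ i, ¬ IsUnit (y i) → c.2 i ≤ a i
  suffices hgood : good a by
    obtain ⟨c, hc, hc1, hc2⟩ := hgood
    refine Ideal.mem_of_dvd _ ?_ (Ideal.subset_span ⟨c, hc, rfl⟩)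
    rw [H.map_mon_eq]
    refine mul_dvd_mul (pow_dvd_pow _ hc1) (Finset.prod_dvd_prod_of_dvd _ _ fun i _ ↦ ?_)
    by_cases hi : IsUnit (y i)
    · exact (hi.pow _).dvd
    · exact pow_dvd_pow _ (hc2 i hi)
  -- a common denominator
  set f := ∑ a ∈ C, v a * mon z a with hfdef
  obtain ⟨N₀, h₀, u, hh₀, hu, hφh₀, hmem₀⟩ : ∃ (N : ℕ) (h : A) (u : O),
      h ∈ Ideal.span (z '' T) ^ N ∧ IsUnit u ∧ φ h = φ (z t) ^ N * u ∧
      h * f ∈ monIdeal z {a | (∀ i ∉ S, a i = 0) ∧ ∃ c ∈ 𝔑, c.2 ≤ a ∧ N + c.1 ≤ degOn T a} := by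
    rw [Ideal.span, Finsupp.mem_span_image_iff_linearCombination] at hf
    obtain ⟨l, hl, hlf⟩ := hf
    rw [Finsupp.linearCombination_apply, Finsupp.sum] at hlf
    obtain ⟨N, g, h, u, hg, hh, hu, hφh, hgh⟩ := H.exists_common_fraction l.support l
    -- Multiplying by `z t ^ m` turns every `y^(c.2)` into `z^(c.2)` without negative powers of `z
    -- t`, so the truncated subtractions below are exact.
    let m := ∑ c ∈ l.support, degOn T c.2
    have hm : ∀ c ∈ l.support, degOn T c.2 ≤ m := fun c hc ↦
      Finset.single_le_sum (f := fun c : ℕ × (Fin n → ℕ) ↦ degOn T c.2)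
        (fun _ _ ↦ Nat.zero_le _) hc
    have hzt : z t ∈ Ideal.span (z '' T) := Ideal.subset_span (Set.mem_image_of_mem z H.mem)
    refine ⟨N + m, h * z t ^ m, u, ?_, hu, ?_, ?_⟩
    · rw [pow_add]; exact Ideal.mul_mem_mul hh (Ideal.pow_mem_pow hzt _)
    · rw [map_mul, hφh, map_pow]; ring
    have key : h * z t ^ m * f =
        ∑ c ∈ l.support, g c * z t ^ (m + c.1 - degOn T c.2) * mon z c.2 := by
      apply H.injective
      rw [map_mul, map_mul, ← hlf, map_sum, Finset.mul_sum]
      refine Finset.sum_congr rfl fun c hc ↦ ?_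
      rw [map_mul, map_mul, ← hgh c hc, map_pow, map_pow, H.map_mon_eq, smul_eq_mul]
      have : φ (z t) ^ (m + c.1) =
          φ (z t) ^ (m + c.1 - degOn T c.2) * φ (z t) ^ degOn T c.2 := by
        rw [← pow_add, Nat.sub_add_cancel ((hm c hc).trans (Nat.le_add_right _ _))]
      rw [pow_add] at this
      linear_combination φ h * l c * mon y c.2 * this
    rw [key]
    refine sum_mem fun c hc ↦ ?_
    have h1 : g c * z t ^ (m + c.1 - degOn T c.2) ∈
        Ideal.span (z '' T) ^ (N + (m + c.1 - degOn T c.2)) := by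
      rw [pow_add]; exact Ideal.mul_mem_mul (hg c hc) (Ideal.pow_mem_pow hzt _)
    rw [span_pow_eq_monIdeal, mem_monIdeal_iff] at h1
    obtain ⟨s, w, hs, hsw⟩ := h1
    rw [hsw, Finset.sum_mul]
    refine sum_mem fun a ha ↦ ?_
    rw [mul_assoc, ← mon_add]
    obtain ⟨ha1, ha2⟩ := hs a ha
    refine Ideal.mul_mem_left _ _ (mon_mem_monIdeal z (b := a + c.2)
      ⟨fun i hi ↦ ?_, c, hl hc, ?_, ?_⟩ le_rfl)
    · simp [ha1 i (fun h ↦ hi (hTS h)), h𝔑 c (hl hc) i hi]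
    · exact fun i ↦ Nat.le_add_left _ _
    · rw [degOn_add, degOn_eq_deg T ha1, ha2]
      have := hm c hc
      omega
  -- the leading part of the denominator
  obtain ⟨D, w, hD, hw, hDh⟩ := exists_expansion z S (fun i _ ↦ hz.mem i) h₀
  have hDdeg : ∀ e ∈ D, N₀ ≤ degOn T e := by
    intro e he
    rw [span_pow_eq_monIdeal, hDh] at hh₀
    obtain ⟨d, ⟨hd1, hd2⟩, hde⟩ := hz.mon_mem_of_sum_mem S
      (fun a ha i hi ↦ ha.1 i (fun h ↦ hi (hTS h))) D w hD hw hh₀ e he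
    rw [← hd2, ← degOn_eq_deg T hd1]
    exact degOn_mono T hde
  -- Otherwise every term of `h₀`, divided by `φ (z t) ^ N₀`, would carry a factor `φ (z t)` or a
  -- nonunit `y i`, and the unit `u` would lie in the maximal ideal.
  have hD₀ : (D.filter fun e ↦ degOn T e = N₀ ∧ ∀ i, ¬ IsUnit (y i) → e i = 0).Nonempty := by
    by_contra hne
    rw [Finset.not_nonempty_iff_eq_empty, Finset.filter_eq_empty_iff] at hne
    have hmax : ∀ e ∈ D, φ (z t) ^ (degOn T e - N₀) * mon y e ∈ IsLocalRing.maximalIdeal O := by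
      intro e he
      by_cases heN : degOn T e = N₀
      · have := hne he
        push Not at this
        obtain ⟨i, hi, hi0⟩ := this heN
        have h1 : mon y e ∈ Ideal.span (y '' {i}) := mon_mem_span y {i} rfl hi0
        rw [Set.image_singleton] at h1
        refine Ideal.mul_mem_left _ _ ?_
        exact (Ideal.span_singleton_le_iff_mem _).2 hi h1
      · have := hDdeg e he
        exact Ideal.mul_mem_right _ _ (Ideal.pow_mem_of_mem _
          (H.map_mem_maximalIdeal (hz.mem t)) _ (by omega))
    have hcalc : φ (z t) ^ N₀ * u =
        φ (z t) ^ N₀ * ∑ e ∈ D, φ (w e) * (φ (z t) ^ (degOn T e - N₀) * mon y e) := by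
      rw [← hφh₀, hDh, map_sum, Finset.mul_sum]
      refine Finset.sum_congr rfl fun e he ↦ ?_
      rw [map_mul, H.map_mon_eq]
      have : φ (z t) ^ degOn T e = φ (z t) ^ N₀ * φ (z t) ^ (degOn T e - N₀) := by
        rw [← pow_add, Nat.add_sub_cancel' (hDdeg e he)]
      rw [this]; ring
    have hum : u ∈ IsLocalRing.maximalIdeal O := by
      rw [H.cancel hcalc]
      exact sum_mem fun e he ↦ Ideal.mul_mem_left _ _ (hmax e he)
    exact hum hu
  -- an isolated monomial of the product
  by_contra hbad
  -- If `a + e ≤ a₀ + e₀` with `a₀` bad of minimal `μ` and `e₀` leading, then `a` is bad as well.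
  -- Minimality forces equal measures, which makes `e` leading. So only pairs for which the sum is
  -- known to be isolated compete.
  let μ : (Fin n → ℕ) → ℕ := fun a ↦ degOn T a + degOn {i | ¬ IsUnit (y i)} a
  obtain ⟨a₁, ha₁, hmin⟩ := (C.filter fun a ↦ ¬ good a).exists_min_image μ
    ⟨a, Finset.mem_filter.2 ⟨ha, hbad⟩⟩
  rw [Finset.mem_filter] at ha₁
  obtain ⟨a₀, ha₀, e₀, he₀, hiso⟩ := exists_isolated_sum
    (C := C.filter fun a ↦ ¬ good a ∧ μ a = μ a₁) (D := D.filter fun e ↦ degOn T e = N₀ ∧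
      ∀ i, ¬ IsUnit (y i) → e i = 0) ⟨a₁, Finset.mem_filter.2 ⟨ha₁.1, ha₁.2, rfl⟩⟩ hD₀
  rw [Finset.mem_filter] at ha₀ he₀
  obtain ⟨d, ⟨-, c, hc, hcd, hdeg⟩, hle⟩ := hz.exists_le_of_sum_mem S
    (M := {a | (∀ i ∉ S, a i = 0) ∧ ∃ c ∈ 𝔑, c.2 ≤ a ∧ N₀ + c.1 ≤ degOn T a}) (fun a ha ↦ ha.1)
    (C ×ˢ D) (fun k ↦ v k.1 * w k.2) (fun k ↦ k.1 + k.2) (a₀, e₀) (by simp [ha₀.1, he₀.1])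
    (fun h ↦ ((hz.isPrime_span S).mem_or_mem h).elim (hv _ ha₀.1) (hw _ he₀.1))
    (by
      rintro ⟨a, b⟩ hab i hi
      rw [Finset.mem_product] at hab
      simp [hC a hab.1 i hi, hD b hab.2 i hi])
    (by
      rintro ⟨a, e⟩ hab hle
      simp only [Finset.mem_product] at hab
      replace hle : a + e ≤ a₀ + e₀ := hle
      have h1 := degOn_mono T hle
      rw [degOn_add, degOn_add, he₀.2.1] at h1
      have h2 := hDdeg e hab.2
      have h3 : ∀ i, ¬ IsUnit (y i) → a i + e i ≤ a₀ i := fun i hi ↦ by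
        have := hle i
        simpa [he₀.2.2 i hi] using this
      have h4 : degOn {i | ¬ IsUnit (y i)} a + degOn {i | ¬ IsUnit (y i)} e ≤
          degOn {i | ¬ IsUnit (y i)} a₀ := by
        rw [← degOn_add]
        refine Finset.sum_le_sum fun i _ ↦ ?_
        split_ifs with hi
        · exact h3 i hi
        · rfl
      have hbad' : ¬ good a := by
        rintro ⟨c, hc, hc1, hc2⟩
        exact ha₀.2.1 ⟨c, hc, by omega, fun i hi ↦ (hc2 i hi).trans (by have := h3 i hi; omega)⟩
      have h5 := hmin a (Finset.mem_filter.2 ⟨hab.1, hbad'⟩)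
      have h6 := ha₀.2.2
      simp only [μ] at h5 h6
      have h7 : degOn {i | ¬ IsUnit (y i)} e = 0 := by omega
      have h8 : ∀ i, ¬ IsUnit (y i) → e i = 0 := fun i hi ↦ by
        have := (Finset.sum_eq_zero_iff.1 h7) i (Finset.mem_univ i)
        simpa [hi] using this
      have := hiso a (Finset.mem_filter.2 ⟨hab.1, hbad', by simp only [μ]; omega⟩) e
        (Finset.mem_filter.2 ⟨hab.2, by omega, h8⟩) hle
      simp [this.1, this.2])
    (by
      convert hmem₀ using 1
      rw [mul_comm, hfdef, hDh, Finset.sum_mul_sum, Finset.sum_product]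
      refine Finset.sum_congr rfl fun a _ ↦ Finset.sum_congr rfl fun b _ ↦ ?_
      rw [mon_add]
      ring)
  replace hle : d ≤ a₀ + e₀ := hle
  -- The exponent `e₀` contributes exactly `N₀` along the center and nothing at nonunit `y i`, so
  -- `c` witnesses that the bad `a₀` is good.
  refine ha₀.2.1 ⟨c, hc, ?_, fun i hi ↦ ?_⟩
  · have := degOn_mono T hle
    rw [degOn_add, he₀.2.1] at this
    omega
  · have h1 := hcd i
    have h2 := hle i
    simp only [Pi.add_apply, he₀.2.2 i hi, add_zero] at h2
    exact h1.trans h2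

end IsBlowupStalk

end BlowupStalk

end Toroidal

namespace Toroidal

/-! ### Stalks of ideal sheaves, gluing and vanishing ideals -/

section Stalks

variable {X Y : Scheme.{u}}

lemma exists_affineOpen_mem (x : X) {V : X.Opens} (hx : x ∈ V) :
    ∃ U : X.affineOpens, x ∈ U.1 ∧ U.1 ≤ V := by
  obtain ⟨_, ⟨U, hU, rfl⟩, hxU, hle⟩ := X.isBasis_affineOpens.exists_subset_of_mem_open hx V.2
  exact ⟨⟨U, hU⟩, hxU, hle⟩

lemma map_germ_ideal_of_le (I : X.IdealSheafData) {U V : X.affineOpens} (h : U.1 ≤ V.1) {x : X}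
    (hx : x ∈ U.1) : (I.ideal V).map (X.presheaf.germ V.1 x (h hx)).hom =
      (I.ideal U).map (X.presheaf.germ U.1 x hx).hom := by
  rw [← I.map_ideal (U := U) (V := V) h, Ideal.map_map, ← CommRingCat.hom_comp]
  congr 2
  exact (X.presheaf.germ_res (homOfLE h) x hx).symm

lemma stalkIdeal_eq (I : X.IdealSheafData) {x : X} (U : X.affineOpens) (hx : x ∈ U.1) :
    stalkIdeal I x = (I.ideal U).map (X.presheaf.germ U.1 x hx).hom := by
  refine le_antisymm (iSup₂_le fun V hV ↦ ?_) (le_iSup₂_of_le U hx le_rfl)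
  obtain ⟨W, hxW, hW⟩ := exists_affineOpen_mem x (V := U.1 ⊓ V.1) ⟨hx, hV⟩
  rw [map_germ_ideal_of_le I (hW.trans inf_le_right) hxW,
    map_germ_ideal_of_le I (hW.trans inf_le_left) hxW]

lemma le_iff_stalkIdeal_le {I J : X.IdealSheafData} :
    I ≤ J ↔ ∀ x, stalkIdeal I x ≤ stalkIdeal J x := by
  constructor
  · intro h x
    obtain ⟨U, hxU, -⟩ := exists_affineOpen_mem x (V := ⊤) trivial
    rw [stalkIdeal_eq I U hxU, stalkIdeal_eq J U hxU]
    exact Ideal.map_mono (h U)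
  · intro h U
    rw [U.2.ideal_le_iff]
    intro x hx
    have := h x
    rwa [stalkIdeal_eq I U hx, stalkIdeal_eq J U hx] at this

lemma ext_stalkIdeal {I J : X.IdealSheafData} (h : ∀ x, stalkIdeal I x = stalkIdeal J x) :
    I = J :=
  le_antisymm (le_iff_stalkIdeal_le.2 fun x ↦ (h x).le) (le_iff_stalkIdeal_le.2 fun x ↦ (h x).ge)

lemma stalkIdeal_mono {I J : X.IdealSheafData} (h : I ≤ J) (x : X) :
    stalkIdeal I x ≤ stalkIdeal J x :=
  le_iff_stalkIdeal_le.1 h x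

lemma stalkIdeal_mul (I J : X.IdealSheafData) (x : X) :
    stalkIdeal (I * J) x = stalkIdeal I x * stalkIdeal J x := by
  obtain ⟨U, hxU, -⟩ := exists_affineOpen_mem x (V := ⊤) trivial
  rw [stalkIdeal_eq _ U hxU, stalkIdeal_eq _ U hxU, stalkIdeal_eq _ U hxU,
    Scheme.IdealSheafData.ideal_mul, Pi.mul_apply, Ideal.map_mul]

lemma stalkIdeal_pow (I : X.IdealSheafData) (m : ℕ) (x : X) :
    stalkIdeal (I ^ m) x = stalkIdeal I x ^ m := by
  obtain ⟨U, hxU, -⟩ := exists_affineOpen_mem x (V := ⊤) trivial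
  rw [stalkIdeal_eq _ U hxU, stalkIdeal_eq _ U hxU, Scheme.IdealSheafData.ideal_pow, Pi.pow_apply,
    Ideal.map_pow]

/-- An ideal sheaf restricts on an affine open set to the ideal with the same stalks. -/
lemma ideal_eq_of_stalkIdeal (I : X.IdealSheafData) (U : X.affineOpens) (𝔞 : Ideal Γ(X, U.1))
    (h : ∀ (x : X) (hx : x ∈ U.1),
      stalkIdeal I x = 𝔞.map (X.presheaf.germ U.1 x hx).hom) : I.ideal U = 𝔞 := by
  rw [U.2.ideal_ext_iff]
  intro x hx
  rw [← h x hx, stalkIdeal_eq I U hx]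

lemma stalk_isLocalization (U : X.affineOpens) {x : X} (hx : x ∈ U.1) :
    @IsLocalization.AtPrime Γ(X, U.1) _ (X.presheaf.stalk x) _
      (X.presheaf.germ U.1 x hx).hom.toAlgebra
      ((IsLocalRing.maximalIdeal (X.presheaf.stalk x)).comap (X.presheaf.germ U.1 x hx).hom)
      (Ideal.comap_isPrime _ _) := by
  have := U.2.isLocalization_stalk ⟨x, hx⟩
  have h2 := U.2.primeIdealOf_eq_map_closedPoint ⟨x, hx⟩
  rw [h2] at this
  exact this

lemma germ_mem_map_iff (U : X.affineOpens) {x : X} (hx : x ∈ U.1) (𝔞 : Ideal Γ(X, U.1))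
    (f : Γ(X, U.1)) :
    X.presheaf.germ U.1 x hx f ∈ 𝔞.map (X.presheaf.germ U.1 x hx).hom ↔
      ∃ s : Γ(X, U.1), IsUnit (X.presheaf.germ U.1 x hx s) ∧ s * f ∈ 𝔞 := by
  let := (X.presheaf.germ U.1 x hx).hom.toAlgebra
  have := stalk_isLocalization U hx
  have key := IsLocalization.algebraMap_mem_map_algebraMap_iff
    ((IsLocalRing.maximalIdeal (X.presheaf.stalk x)).comap
      (X.presheaf.germ U.1 x hx).hom).primeCompl (X.presheaf.stalk x) 𝔞 f
  refine key.trans ⟨?_, ?_⟩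
  · rintro ⟨s, hs, h⟩
    exact ⟨s, by_contra fun hn ↦ hs hn, h⟩
  · rintro ⟨s, hs, h⟩
    exact ⟨s, fun hn ↦ hn hs, h⟩

/-- A section whose restriction to a basic open set lies in an ideal does so after multiplication
by a power of the function defining the basic open set. -/
lemma exists_pow_mul_mem (U : X.affineOpens) (𝔞 : Ideal Γ(X, U.1)) (s f : Γ(X, U.1))
    (h : ∀ (x : X) (hx : x ∈ U.1), x ∈ X.basicOpen s →
      X.presheaf.germ U.1 x hx f ∈ 𝔞.map (X.presheaf.germ U.1 x hx).hom) :
    ∃ n, s ^ n * f ∈ 𝔞 := by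
  -- For a prime over the colon ideal that misses `s`, the hypothesis at its point yields an element
  -- of the colon ideal outside the prime.
  suffices s ∈ (𝔞.colon {f}).radical by
    obtain ⟨n, hn⟩ := this
    exact ⟨n, by simpa [Submodule.mem_colon_singleton] using hn⟩
  rw [Ideal.radical_eq_sInf, Ideal.mem_sInf]
  rintro P ⟨hP, hPp⟩
  by_contra hsP
  let x : X := U.2.fromSpec ⟨P, hPp⟩
  have hx : x ∈ U.1 := by
    have : x ∈ Set.range U.2.fromSpec := ⟨_, rfl⟩
    rwa [U.2.range_fromSpec] at this
  have hunit : ∀ r : Γ(X, U.1), IsUnit (X.presheaf.germ U.1 x hx r) ↔ r ∉ P := by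
    intro r
    rw [← X.mem_basicOpen r x hx]
    have h1 : x ∈ X.basicOpen r ↔ (⟨P, hPp⟩ : Spec Γ(X, U.1)) ∈ U.2.fromSpec ⁻¹ᵁ X.basicOpen r :=
      Iff.rfl
    rw [h1, U.2.fromSpec_preimage_basicOpen]
    rfl
  obtain ⟨r, hr, hrf⟩ := (germ_mem_map_iff U hx 𝔞 f).1
    (h x hx ((X.mem_basicOpen s x hx).2 ((hunit s).2 hsP)))
  exact (hunit r).1 hr (hP (by simpa [Submodule.mem_colon_singleton] using hrf))

lemma isUnit_map_basicOpen (U : X.affineOpens) (s : Γ(X, U.1)) :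
    IsUnit (X.presheaf.map (homOfLE (X.basicOpen_le s)).op s) :=
  RingedSpace.isUnit_res_basicOpen _ s

lemma exists_map_eq_mul_pow (U : X.affineOpens) (s : Γ(X, U.1)) (f : Γ(X, X.basicOpen s)) :
    ∃ (n : ℕ) (g : Γ(X, U.1)), X.presheaf.map (homOfLE (X.basicOpen_le s)).op g =
      f * X.presheaf.map (homOfLE (X.basicOpen_le s)).op s ^ n := by
  have := U.2.isLocalization_basicOpen s
  obtain ⟨n, g, hg⟩ := IsLocalization.Away.surj (S := Γ(X, X.basicOpen s)) s f
  exact ⟨n, g, hg.symm⟩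

/-- Ideals of the local rings which locally come from an ideal of sections glue to an ideal
sheaf. -/
theorem exists_stalkIdeal_eq (H : ∀ x : X, Ideal (X.presheaf.stalk x))
    (hH : ∀ x : X, ∃ (U : X.affineOpens) (_ : x ∈ U.1) (𝔞 : Ideal Γ(X, U.1)),
      ∀ (y : X) (hy : y ∈ U.1), H y = 𝔞.map (X.presheaf.germ U.1 y hy).hom) :
    ∃ I : X.IdealSheafData, ∀ x, stalkIdeal I x = H x := by
  -- Sections whose germs all lie in `H`; the content is that they are compatible with localization
  -- to basic open sets.
  let F : ∀ U : X.affineOpens, Ideal Γ(X, U.1) := fun U ↦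
    ⨅ (y : X) (hy : y ∈ U.1), (H y).comap (X.presheaf.germ U.1 y hy).hom
  have hF : ∀ (U : X.affineOpens) (f : Γ(X, U.1)),
      f ∈ F U ↔ ∀ (y : X) (hy : y ∈ U.1), X.presheaf.germ U.1 y hy f ∈ H y := by
    intro U f
    simp only [F, Ideal.mem_iInf]
    rfl
  -- sections over a basic open set extend after multiplication by a power of the function
  have hext : ∀ (U : X.affineOpens) (s f : Γ(X, U.1)),
      (∀ (y : X) (hy : y ∈ U.1), y ∈ X.basicOpen s → X.presheaf.germ U.1 y hy f ∈ H y) →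
      ∃ n, s ^ n * f ∈ F U := by
    intro U s f hf
    have hloc : ∀ x : U.1, ∃ t : Γ(X, U.1), x.1 ∈ X.basicOpen t ∧ ∃ n,
        ∀ (y : X) (hy : y ∈ U.1), y ∈ X.basicOpen t →
          X.presheaf.germ U.1 y hy (s ^ n * f) ∈ H y := by
      rintro ⟨x, hx⟩
      obtain ⟨V, hxV, 𝔞, h𝔞⟩ := hH x
      obtain ⟨t, g, htg, hxt⟩ := exists_basicOpen_le_affine_inter U.2 V.2 x ⟨hx, hxV⟩
      let W : X.affineOpens := X.affineBasicOpen t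
      have hWU : W.1 ≤ U.1 := X.basicOpen_le t
      have hWV : W.1 ≤ V.1 := htg.le.trans (X.basicOpen_le g)
      let rU := X.presheaf.map (homOfLE hWU).op
      let rV := X.presheaf.map (homOfLE hWV).op
      have h𝔞W : ∀ (y : X) (hy : y ∈ W.1),
          H y = (𝔞.map rV.hom).map (X.presheaf.germ W.1 y hy).hom := by
        intro y hy
        rw [h𝔞 y (hWV hy), Ideal.map_map, ← CommRingCat.hom_comp]
        congr 2
        exact (X.presheaf.germ_res (homOfLE hWV) y hy).symm
      have hgerm : ∀ (r : Γ(X, U.1)) (y : X) (hy : y ∈ W.1),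
          X.presheaf.germ W.1 y hy (rU r) = X.presheaf.germ U.1 y (hWU hy) r := by
        intro r y hy
        exact X.presheaf.germ_res_apply (homOfLE hWU) y hy r
      obtain ⟨n, hn⟩ := exists_pow_mul_mem W (𝔞.map rV.hom) (rU s) (rU f) fun y hy hys ↦ by
        rw [← h𝔞W y hy, hgerm]
        refine hf y (hWU hy) ?_
        rw [X.mem_basicOpen _ _ hy, hgerm] at hys
        exact (X.mem_basicOpen _ _ (hWU hy)).2 hys
      refine ⟨t, hxt, n, fun y hy hyt ↦ ?_⟩
      rw [← hgerm _ y hyt, h𝔞W y hyt, map_mul, map_pow]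
      exact Ideal.mem_map_of_mem _ hn
    choose t ht n hn using hloc
    have hcov : Ideal.span (Set.range t) = ⊤ := by
      rw [← U.2.self_le_iSup_basicOpen_iff]
      exact fun x hx ↦ Opens.mem_iSup.2 ⟨⟨_, ⟨⟨x, hx⟩, rfl⟩⟩, ht ⟨x, hx⟩⟩
    obtain ⟨T, hT, hTspan⟩ := (Ideal.span_eq_top_iff_finite _).1 hcov
    choose p hp using fun a : T ↦ hT a.2
    -- The sum bounds the exponents of all members of the finite cover at once.
    refine ⟨∑ a : T, n (p a), (hF U _).2 fun y hy ↦ ?_⟩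
    have hcov' := (U.2.self_le_iSup_basicOpen_iff).2 hTspan hy
    obtain ⟨⟨a, ha⟩, hya⟩ := Opens.mem_iSup.1 hcov'
    have hle : n (p ⟨a, ha⟩) ≤ ∑ a : T, n (p a) :=
      Finset.single_le_sum (f := fun a : T ↦ n (p a)) (fun _ _ ↦ Nat.zero_le _)
        (Finset.mem_univ _)
    obtain ⟨k, hk⟩ := Nat.exists_eq_add_of_le hle
    rw [hk, add_comm, pow_add, mul_assoc, map_mul]
    refine Ideal.mul_mem_left _ _ (hn (p ⟨a, ha⟩) y hy ?_)
    rw [hp ⟨a, ha⟩]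
    exact hya
  let I : X.IdealSheafData :=
    { ideal := F
      map_ideal_basicOpen := by
        intro U s
        let W : X.affineOpens := X.affineBasicOpen s
        have hWU : W.1 ≤ U.1 := X.basicOpen_le s
        let rU := X.presheaf.map (homOfLE hWU).op
        have hgerm : ∀ (r : Γ(X, U.1)) (y : X) (hy : y ∈ W.1),
            X.presheaf.germ W.1 y hy (rU r) = X.presheaf.germ U.1 y (hWU hy) r := by
          intro r y hy
          exact X.presheaf.germ_res_apply (homOfLE hWU) y hy r
        have hle : F W ≤ (F U).map rU.hom := by
          intro f hf
          obtain ⟨n, g, hg⟩ := exists_map_eq_mul_pow U s f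
          have hg' : rU g = f * rU s ^ n := hg
          obtain ⟨k, hk⟩ := hext U s g fun y hy hys ↦ by
            have h1 := (hF W f).1 hf y hys
            rw [← hgerm g y hys, hg', map_mul]
            exact Ideal.mul_mem_right _ _ h1
          have h2 : rU (s ^ k * g) ∈ (F U).map rU.hom := Ideal.mem_map_of_mem _ hk
          have h3 : rU (s ^ k * g) = (rU s ^ (k + n)) * f := by
            rw [map_mul, map_pow, hg']; ring
          rw [h3] at h2
          exact (Ideal.unit_mul_mem_iff_mem _ (IsUnit.pow _ (isUnit_map_basicOpen U s))).1 h2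
        refine le_antisymm (Ideal.map_le_iff_le_comap.2 fun f hf ↦ ?_) hle
        refine (hF W _).2 fun y hy ↦ ?_
        have h1 := (hF U f).1 hf y (hWU hy)
        have h2 : X.presheaf.germ W.1 y hy (rU f) ∈ H y := by rw [hgerm]; exact h1
        exact h2 }
  refine ⟨I, fun x ↦ ?_⟩
  obtain ⟨U, hx, 𝔞, h𝔞⟩ := hH x
  have : F U = 𝔞 := by
    ext f
    rw [hF, U.2.mem_ideal_iff]
    exact forall₂_congr fun y hy ↦ by rw [h𝔞 y hy]
  rw [stalkIdeal_eq I U hx, h𝔞 x hx]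
  exact congrArg _ this

lemma zeroLocus_map_germ (U : X.affineOpens) {x : X} (hx : x ∈ U.1) (𝔞 : Ideal Γ(X, U.1))
    (p : PrimeSpectrum (X.presheaf.stalk x)) :
    𝔞.map (X.presheaf.germ U.1 x hx).hom ≤ p.asIdeal ↔
      𝔞 ≤ (Spec.map (X.presheaf.germ U.1 x hx) p).asIdeal :=
  Ideal.map_le_iff_le_comap

/-- The point of `X` corresponding to a prime ideal of the local ring at `x`. -/
noncomputable def primePt (x : X) (p : PrimeSpectrum (X.presheaf.stalk x)) : X :=
  X.fromSpecStalk x p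

lemma primePt_eq (U : X.affineOpens) {x : X} (hx : x ∈ U.1)
    (p : PrimeSpectrum (X.presheaf.stalk x)) :
    primePt x p = U.2.fromSpec (Spec.map (X.presheaf.germ U.1 x hx) p) := by
  have : X.fromSpecStalk x = Spec.map (X.presheaf.germ U.1 x hx) ≫ U.2.fromSpec :=
    (U.2.fromSpecStalk_eq_fromSpecStalk hx).symm.trans rfl
  rw [primePt, this]
  rfl

lemma primePt_specializes (x : X) (p : PrimeSpectrum (X.presheaf.stalk x)) : primePt x p ⤳ x := by
  have : primePt x p ∈ Set.range (X.fromSpecStalk x) := ⟨p, rfl⟩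
  rwa [Scheme.range_fromSpecStalk] at this

lemma exists_primePt_eq {x y : X} (h : y ⤳ x) : ∃ p, primePt x p = y := by
  have : y ∈ Set.range (X.fromSpecStalk x) := by rwa [Scheme.range_fromSpecStalk]
  exact this

/-- Taking radicals commutes with localization, so vanishing can be tested on the primes of the
local ring, which are the generizations of `x`. -/
theorem mem_stalkIdeal_vanishingIdeal (Z : Closeds X) (x : X) (f : X.presheaf.stalk x) :
    f ∈ stalkIdeal (Scheme.IdealSheafData.vanishingIdeal Z) x ↔
      ∀ p, primePt x p ∈ Z → f ∈ p.asIdeal := by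
  obtain ⟨U, hx, -⟩ := exists_affineOpen_mem x (V := ⊤) trivial
  rw [stalkIdeal_eq _ U hx]
  let := (X.presheaf.germ U.1 x hx).hom.toAlgebra
  have hloc := stalk_isLocalization U hx
  set 𝔞 := (Scheme.IdealSheafData.vanishingIdeal Z).ideal U with h𝔞
  let Z' : Set (PrimeSpectrum Γ(X, U.1)) := U.2.fromSpec ⁻¹' (Z : Set X)
  have h1 : 𝔞 = PrimeSpectrum.vanishingIdeal Z' := rfl
  have hcl : IsClosed Z' := Z.isClosed.preimage U.2.fromSpec.continuous
  have h2 : Z' = PrimeSpectrum.zeroLocus (𝔞 : Set Γ(X, U.1)) := by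
    rw [h1, PrimeSpectrum.zeroLocus_vanishingIdeal_eq_closure, hcl.closure_eq]
  have h3 : ∀ p, primePt x p ∈ Z ↔ p ∈ PrimeSpectrum.zeroLocus
      (𝔞.map (X.presheaf.germ U.1 x hx).hom : Set (X.presheaf.stalk x)) := by
    intro p
    rw [PrimeSpectrum.mem_zeroLocus, SetLike.coe_subset_coe, zeroLocus_map_germ, primePt_eq U hx]
    have : Spec.map (X.presheaf.germ U.1 x hx) p ∈ Z' ↔
      Spec.map (X.presheaf.germ U.1 x hx) p ∈ PrimeSpectrum.zeroLocus (𝔞 : Set Γ(X, U.1)) := by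
      rw [h2]
    exact this
  have h4 : 𝔞.radical = 𝔞 := by
    rw [← PrimeSpectrum.vanishingIdeal_zeroLocus_eq_radical, ← h2, h1]
  have h5 := IsLocalization.map_radical ((IsLocalRing.maximalIdeal (X.presheaf.stalk x)).comap
      (X.presheaf.germ U.1 x hx).hom).primeCompl (X.presheaf.stalk x) 𝔞
  rw [h4] at h5
  have h6 : 𝔞.map (X.presheaf.germ U.1 x hx).hom =
    (𝔞.map (X.presheaf.germ U.1 x hx).hom).radical := h5
  rw [h6, ← PrimeSpectrum.vanishingIdeal_zeroLocus_eq_radical, PrimeSpectrum.mem_vanishingIdeal]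
  exact forall_congr' fun p ↦ by rw [h3]

/-- The stalk of the vanishing ideal of `Z` is the radical of every ideal with zero locus `Z`. -/
theorem stalkIdeal_vanishingIdeal_eq (Z : Closeds X) (x : X) (𝔟 : Ideal (X.presheaf.stalk x))
    (h : ∀ p, primePt x p ∈ Z ↔ 𝔟 ≤ p.asIdeal) :
    stalkIdeal (Scheme.IdealSheafData.vanishingIdeal Z) x = 𝔟.radical := by
  ext f
  rw [mem_stalkIdeal_vanishingIdeal, ← PrimeSpectrum.vanishingIdeal_zeroLocus_eq_radical,
    PrimeSpectrum.mem_vanishingIdeal]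
  exact forall_congr' fun p ↦ by rw [h, PrimeSpectrum.mem_zeroLocus, SetLike.coe_subset_coe]

lemma stalkIdeal_vanishingIdeal_of_notMem (Z : Closeds X) {x : X} (hx : x ∉ Z) :
    stalkIdeal (Scheme.IdealSheafData.vanishingIdeal Z) x = ⊤ := by
  rw [Ideal.eq_top_iff_one, mem_stalkIdeal_vanishingIdeal]
  intro p hp
  exact absurd ((primePt_specializes x p).mem_closed Z.isClosed hp) hx

lemma primePt_mem_iff (Z : Closeds X) {x : X} (p : PrimeSpectrum (X.presheaf.stalk x)) :
    primePt x p ∈ Z ↔ stalkIdeal (Scheme.IdealSheafData.vanishingIdeal Z) x ≤ p.asIdeal := by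
  constructor
  · intro h f hf
    exact (mem_stalkIdeal_vanishingIdeal Z x f).1 hf p h
  · intro h
    obtain ⟨U, hx, -⟩ := exists_affineOpen_mem x (V := ⊤) trivial
    rw [stalkIdeal_eq _ U hx, zeroLocus_map_germ] at h
    rw [primePt_eq U hx]
    let Z' : Set (PrimeSpectrum Γ(X, U.1)) := U.2.fromSpec ⁻¹' (Z : Set X)
    have h1 : (Scheme.IdealSheafData.vanishingIdeal Z).ideal U = PrimeSpectrum.vanishingIdeal Z' :=
      rfl
    have hcl : IsClosed Z' := Z.isClosed.preimage U.2.fromSpec.continuous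
    have h2 : Z' = PrimeSpectrum.zeroLocus
        ((Scheme.IdealSheafData.vanishingIdeal Z).ideal U : Set Γ(X, U.1)) := by
      rw [h1, PrimeSpectrum.zeroLocus_vanishingIdeal_eq_closure, hcl.closure_eq]
    have h3 : Spec.map (X.presheaf.germ U.1 x hx) p ∈ PrimeSpectrum.zeroLocus
      ((Scheme.IdealSheafData.vanishingIdeal Z).ideal U : Set Γ(X, U.1)) := h
    rw [← h2] at h3
    exact h3

lemma stalkIdeal_vanishingIdeal_le_maximalIdeal (Z : Closeds X) {x : X} (hx : x ∈ Z) :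
    stalkIdeal (Scheme.IdealSheafData.vanishingIdeal Z) x ≤
      IsLocalRing.maximalIdeal (X.presheaf.stalk x) := by
  refine (primePt_mem_iff Z (IsLocalRing.closedPoint _)).1 ?_
  rw [primePt, Scheme.fromSpecStalk_closedPoint]
  exact hx

end Stalks

end Toroidal

namespace Toroidal

/-! ### Inverse images of ideal sheaves -/

section Comap

variable {X Y : Scheme.{u}}

/-- The ideal of global sections of an ideal sheaf on an affine scheme. -/
noncomputable def specIdeal {R : CommRingCat.{u}} (I : (Spec R).IdealSheafData) : Ideal R :=
  (I.ideal ⟨⊤, isAffineOpen_top _⟩).comap (Scheme.ΓSpecIso R).inv.hom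

lemma bijective_of_iso {R S : CommRingCat.{u}} (e : R ≅ S) : Function.Bijective e.hom.hom :=
  e.commRingCatIsoToRingEquiv.bijective

lemma exists_specIdeal_eq {R : CommRingCat.{u}} (𝔞 : Ideal R) :
    ∃ I : (Spec R).IdealSheafData, specIdeal I = 𝔞 := by
  refine ⟨Scheme.IdealSheafData.equivOfIsAffine.symm (𝔞.comap (Scheme.ΓSpecIso R).hom.hom), ?_⟩
  have h := Scheme.IdealSheafData.equivOfIsAffine.apply_symm_apply
    (𝔞.comap (Scheme.ΓSpecIso R).hom.hom)
  rw [Scheme.IdealSheafData.equivOfIsAffine_apply] at h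
  rw [specIdeal, h, Ideal.comap_comap, ← CommRingCat.hom_comp, Iso.inv_hom_id]
  exact Ideal.comap_id _

lemma specIdeal_le_iff {R : CommRingCat.{u}} {I J : (Spec R).IdealSheafData} :
    specIdeal I ≤ specIdeal J ↔ I ≤ J := by
  constructor
  · intro h
    refine Scheme.IdealSheafData.le_of_isAffine fun f hf ↦ ?_
    obtain ⟨r, rfl⟩ := (bijective_of_iso (Scheme.ΓSpecIso R).symm).2 f
    exact h hf
  · intro h
    exact Ideal.comap_mono (h _)

lemma specIdeal_map {R S : CommRingCat.{u}} (φ : R ⟶ S) (I : (Spec S).IdealSheafData) :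
    specIdeal (I.map (Spec.map φ)) = (specIdeal I).comap φ.hom := by
  have h := I.ideal_map (Spec.map φ) ⟨⊤, isAffineOpen_top _⟩ (isAffineOpen_top _)
  rw [specIdeal, h, specIdeal, Ideal.comap_comap, Ideal.comap_comap, ← CommRingCat.hom_comp,
    ← CommRingCat.hom_comp]
  congr 2
  exact (Scheme.ΓSpecIso_inv_naturality φ).symm

/-- Inverse image is left adjoint to `map`, and extension of ideals to contraction. The right
adjoints agree by `specIdeal_map`, hence so do the left ones. -/
lemma specIdeal_comap {R S : CommRingCat.{u}} (φ : R ⟶ S) (I : (Spec R).IdealSheafData) :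
    specIdeal (I.comap (Spec.map φ)) = (specIdeal I).map φ.hom := by
  have key : ∀ K : (Spec S).IdealSheafData,
      specIdeal (I.comap (Spec.map φ)) ≤ specIdeal K ↔ (specIdeal I).map φ.hom ≤ specIdeal K := by
    intro K
    rw [specIdeal_le_iff, ← Scheme.IdealSheafData.le_map_iff_comap_le, ← specIdeal_le_iff,
      specIdeal_map, Ideal.map_le_iff_le_comap]
  obtain ⟨K, hK⟩ := exists_specIdeal_eq ((specIdeal I).map φ.hom)
  refine le_antisymm ?_ ((key _).1 le_rfl)
  have := (key K).2 hK.ge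
  rwa [hK] at this

lemma specIdeal_comap_fromSpec (I : X.IdealSheafData) (U : X.affineOpens) :
    specIdeal (I.comap U.2.fromSpec) = I.ideal U := by
  have : IsOpenImmersion U.2.fromSpec := IsAffineOpen.isOpenImmersion_fromSpec U.2
  have h0 := I.ideal_comap_of_isOpenImmersion U.2.fromSpec ⟨⊤, isAffineOpen_top _⟩
  refine (congrArg (Ideal.comap _) h0).trans ?_
  rw [Ideal.comap_comap, ← CommRingCat.hom_comp]
  have hU : U.2.fromSpec ''ᵁ ⊤ = U.1 := by
    rw [Scheme.Hom.image_top_eq_opensRange, U.2.opensRange_fromSpec]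
  let V : X.affineOpens := ⟨U.2.fromSpec ''ᵁ ⊤, (isAffineOpen_top _).image_of_isOpenImmersion _⟩
  have hVU : V.1 ≤ U.1 := hU.le
  have h1 : (Scheme.ΓSpecIso Γ(X, U.1)).inv ≫ (U.2.fromSpec.appIso ⊤).inv =
      X.presheaf.map (homOfLE hVU).op := by
    have h2 : (Scheme.ΓSpecIso Γ(X, U.1)).inv =
        U.2.fromSpec.appLE U.1 ⊤ (U.2.fromSpec_preimage_self).ge := by
      rw [Scheme.Hom.appLE, U.2.fromSpec_app_self, Category.assoc, ← Functor.map_comp]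
      exact (Category.comp_id _).symm.trans (congrArg _ ((Spec _).presheaf.map_id _).symm)
    rw [h2, Scheme.Hom.appLE_appIso_inv]
  rw [h1]
  have h3 : I.ideal V = (I.ideal U).map (X.presheaf.map (homOfLE hVU).op).hom :=
    (I.map_ideal (U := V) (V := U) hVU).symm
  have h4 : I.ideal U = (I.ideal V).comap (X.presheaf.map (homOfLE hVU).op).hom := by
    have h5 : Function.Bijective (X.presheaf.map (homOfLE hVU).op).hom := by
      have : IsIso (homOfLE hVU) := ⟨homOfLE hU.ge, rfl, rfl⟩
      exact bijective_of_iso (asIso (X.presheaf.map (homOfLE hVU).op))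
    rw [h3, Ideal.comap_map_of_bijective _ h5]
  exact h4.symm

/-- Between the affine charts `f` is `Spec` of `appLE`, so this reduces to `specIdeal_comap`. -/
theorem ideal_comap (I : X.IdealSheafData) (f : Y ⟶ X) (U : X.affineOpens) (V : Y.affineOpens)
    (e : V.1 ≤ f ⁻¹ᵁ U.1) :
    (I.comap f).ideal V = (I.ideal U).map (f.appLE U.1 V.1 e).hom := by
  rw [← specIdeal_comap_fromSpec, ← Scheme.IdealSheafData.comap_comp,
    ← IsAffineOpen.SpecMap_appLE_fromSpec f U.2 V.2 e, Scheme.IdealSheafData.comap_comp,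
    specIdeal_comap, specIdeal_comap_fromSpec]

theorem stalkIdeal_comap (I : X.IdealSheafData) (f : Y ⟶ X) (b : Y) :
    stalkIdeal (I.comap f) b = (stalkIdeal I (f b)).map (f.stalkMap b).hom := by
  obtain ⟨U, hU, -⟩ := exists_affineOpen_mem (f b) (V := ⊤) trivial
  obtain ⟨V, hV, hVU⟩ := exists_affineOpen_mem b (V := f ⁻¹ᵁ U.1) hU
  rw [stalkIdeal_eq _ V hV, ideal_comap I f U V hVU, stalkIdeal_eq I U hU, Ideal.map_map,
    Ideal.map_map, ← CommRingCat.hom_comp, ← CommRingCat.hom_comp]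
  congr 2
  rw [Scheme.Hom.germ_stalkMap, Scheme.Hom.appLE, Category.assoc]
  congr 1
  exact Y.presheaf.germ_res _ _ _

/-- Serves the test objects `Spec R` in the universal property: pulling back the center to them is
extending its stalk along `θ`. -/
theorem specIdeal_comap_fromSpecStalk (I : X.IdealSheafData) (x : X) {R : CommRingCat.{u}}
    (θ : X.presheaf.stalk x ⟶ R) :
    specIdeal (I.comap (Spec.map θ ≫ X.fromSpecStalk x)) = (stalkIdeal I x).map θ.hom := by
  obtain ⟨U, hx, -⟩ := exists_affineOpen_mem x (V := ⊤) trivial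
  have : X.fromSpecStalk x = Spec.map (X.presheaf.germ U.1 x hx) ≫ U.2.fromSpec :=
    (U.2.fromSpecStalk_eq_fromSpecStalk hx).symm.trans rfl
  rw [Scheme.IdealSheafData.comap_comp, specIdeal_comap, this, Scheme.IdealSheafData.comap_comp,
    specIdeal_comap, specIdeal_comap_fromSpec, stalkIdeal_eq I U hx]

lemma isInvertible_of_specIdeal {R : CommRingCat.{u}} (I : (Spec R).IdealSheafData) (f : R)
    (hf : f ∈ nonZeroDivisors R) (h : specIdeal I = Ideal.span {f}) : IsInvertible I := by
  have hbij := bijective_of_iso (Scheme.ΓSpecIso R).symm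
  let e : R ≃+* Γ(Spec R, ⊤) := (Scheme.ΓSpecIso R).symm.commRingCatIsoToRingEquiv
  refine fun x ↦ ⟨⟨⊤, isAffineOpen_top _⟩, trivial, e f, ?_, ?_⟩
  · rw [mem_nonZeroDivisors_iff_right] at hf ⊢
    intro r hr
    obtain ⟨r, rfl⟩ := e.surjective r
    rw [← map_mul, EmbeddingLike.map_eq_zero_iff] at hr
    rw [hf r hr, map_zero]
  · have h1 : (specIdeal I).map (Scheme.ΓSpecIso R).inv.hom = I.ideal ⟨⊤, isAffineOpen_top _⟩ :=
      Ideal.map_comap_of_surjective _ hbij.2 _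
    rw [← h1, h, Ideal.map_span, Set.image_singleton]
    rfl

/-- The stalks of an invertible ideal sheaf are generated by a nonzerodivisor. -/
lemma IsInvertible.exists_stalkIdeal_eq {I : X.IdealSheafData} (hI : IsInvertible I) (x : X) :
    ∃ e ∈ nonZeroDivisors (X.presheaf.stalk x), stalkIdeal I x = Ideal.span {e} := by
  obtain ⟨U, hx, f, hf, h⟩ := hI x
  refine ⟨X.presheaf.germ U.1 x hx f, ?_, ?_⟩
  · let := (X.presheaf.germ U.1 x hx).hom.toAlgebra
    have hloc := stalk_isLocalization U hx
    exact IsLocalization.map_nonZeroDivisors_le ((IsLocalRing.maximalIdeal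
      (X.presheaf.stalk x)).comap (X.presheaf.germ U.1 x hx).hom).primeCompl _
      (Submonoid.mem_map_of_mem _ hf)
  · rw [stalkIdeal_eq I U hx, h, Ideal.map_span, Set.image_singleton]

end Comap

end Toroidal

namespace Toroidal

/-! ### Monomial ideals and monomial hulls in snc coordinates -/

section SNC

variable {A : Type*} [CommRing A] {ι : Type*} {n : ℕ}

/-- The exponent of the monomial in the regular parameters given by an exponent of the ideals. -/
noncomputable def parameterExponent {S : Set ι} (c : S → Fin n) (a : ι → ℕ) : Fin n → ℕ :=
  Function.extend c (fun i ↦ a i) 0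

lemma parameterExponent_apply {S : Set ι} {c : S → Fin n} (hc : Function.Injective c) (a : ι → ℕ)
    (i : S) : parameterExponent c a (c i) = a i :=
  hc.extend_apply _ _ i

lemma parameterExponent_of_notMem {S : Set ι} {c : S → Fin n} (a : ι → ℕ) {j : Fin n}
    (hj : j ∉ Set.range c) : parameterExponent c a j = 0 :=
  Function.extend_apply' _ _ _ hj

lemma exists_parameterExponent_eq {S : Set ι} {c : S → Fin n} (hc : Function.Injective c)
    (b : Fin n → ℕ) (hb : ∀ j ∉ Set.range c, b j = 0) : ∃ a : ι → ℕ, parameterExponent c a = b := by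
  classical
  refine ⟨fun i ↦ if h : i ∈ S then b (c ⟨i, h⟩) else 0, funext fun j ↦ ?_⟩
  by_cases hj : j ∈ Set.range c
  · obtain ⟨i, rfl⟩ := hj
    rw [parameterExponent_apply hc]
    simp
  · rw [parameterExponent_of_notMem _ hj, hb j hj]

lemma parameterExponent_le_iff {S : Set ι} {c : S → Fin n} (hc : Function.Injective c)
    (d a : ι → ℕ) : parameterExponent c d ≤ parameterExponent c a ↔ ∀ i ∈ S, d i ≤ a i := by
  constructor
  · intro h i hi
    have := h (c ⟨i, hi⟩)
    rwa [parameterExponent_apply hc, parameterExponent_apply hc] at this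
  · intro h j
    by_cases hj : j ∈ Set.range c
    · obtain ⟨i, rfl⟩ := hj
      rw [parameterExponent_apply hc, parameterExponent_apply hc]
      exact h i i.2
    · rw [parameterExponent_of_notMem _ hj]
      exact Nat.zero_le _

lemma apply_eq_zero_of_mem_image_parameterExponent {S : Set ι} {c : S → Fin n} (M : Set (ι → ℕ)) :
    ∀ a ∈ parameterExponent c '' M, ∀ i ∉ Set.range c, a i = 0 := by
  rintro _ ⟨a, -, rfl⟩ i hi
  exact parameterExponent_of_notMem a hi

variable [Fintype ι]

/-- The ideal generated by the monomials in the ideals `P i` with exponents in `M`. -/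
def monoIdeal (P : ι → Ideal A) (M : Set (ι → ℕ)) : Ideal A := ⨆ a ∈ M, ∏ i, P i ^ a i

lemma prod_le_monoIdeal (P : ι → Ideal A) {M : Set (ι → ℕ)} {a : ι → ℕ} (ha : a ∈ M) :
    ∏ i, P i ^ a i ≤ monoIdeal P M :=
  le_iSup₂_of_le a ha le_rfl

lemma monoIdeal_mono (P : ι → Ideal A) {M N : Set (ι → ℕ)} (h : M ⊆ N) :
    monoIdeal P M ≤ monoIdeal P N :=
  biSup_mono h

lemma map_prod_pow {B : Type*} [CommRing B] (f : A →+* B) (P : ι → Ideal A) (a : ι → ℕ) :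
    (∏ i, P i ^ a i).map f = ∏ i, (P i).map f ^ a i := by
  exact (map_prod (Ideal.mapHom f) (fun i ↦ P i ^ a i) Finset.univ).trans
    (Finset.prod_congr rfl fun i _ ↦ Ideal.map_pow f _ _)

lemma map_monoIdeal {B : Type*} [CommRing B] (f : A →+* B) (P : ι → Ideal A) (M : Set (ι → ℕ)) :
    (monoIdeal P M).map f = monoIdeal (fun i ↦ (P i).map f) M := by
  simp only [monoIdeal, Ideal.map_iSup, map_prod_pow]

/-- The ideals `P i` with `i ∈ S` are generated by distinct regular parameters, the others are
trivial. -/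
structure IsSNCAt [IsLocalRing A] (P : ι → Ideal A) (S : Set ι) (z : Fin n → A) (c : S → Fin n) :
    Prop where
  isRSP : IsRSP z
  injective : Function.Injective c
  eq_span : ∀ i : S, P i = Ideal.span {z (c i)}
  eq_top : ∀ i ∉ S, P i = ⊤

/-- The exponents of the monomial hull of an ideal. -/
def hullExponents (P : ι → Ideal A) (𝔧 : Ideal A) : Set (ι → ℕ) :=
  {a | ∀ M, 𝔧 ≤ monoIdeal P M → ∏ i, P i ^ a i ≤ monoIdeal P M}

lemma monoIdeal_hullExponents_le (P : ι → Ideal A) (𝔧 : Ideal A) {M : Set (ι → ℕ)}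
    (h : 𝔧 ≤ monoIdeal P M) : monoIdeal P (hullExponents P 𝔧) ≤ monoIdeal P M :=
  iSup₂_le fun _ ha ↦ ha M h

lemma prod_pow_eq_span {P : ι → Ideal A} {S : Set ι} {y : Fin n → A} {c : S → Fin n}
    (hc : Function.Injective c) (hP : ∀ i : S, P i = Ideal.span {y (c i)})
    (hP' : ∀ i ∉ S, P i = ⊤) (a : ι → ℕ) :
    ∏ i, P i ^ a i = Ideal.span {mon y (parameterExponent c a)} := by
  classical
  have h1 : ∏ i : S, P i ^ a i = ∏ i, P i ^ a i :=
    Fintype.prod_of_injective _ Subtype.val_injective _ _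
      (fun i hi ↦ by
        rw [hP' i (by simpa using hi), ← Ideal.one_eq_top, one_pow]) fun _ ↦ rfl
  have h2 : ∏ i : S, y (c i) ^ a i = mon y (parameterExponent c a) :=
    Fintype.prod_of_injective _ hc _ _
      (fun i hi ↦ by rw [parameterExponent_of_notMem _ hi, pow_zero])
      fun i ↦ by rw [parameterExponent_apply hc]
  rw [← h1, ← h2, ← Ideal.prod_span_singleton]
  exact Finset.prod_congr rfl fun i _ ↦ by rw [hP, Ideal.span_singleton_pow]

namespace IsSNCAt

variable [IsLocalRing A] {P : ι → Ideal A} {S : Set ι} {z : Fin n → A} {c : S → Fin n}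

lemma prod_eq_span (h : IsSNCAt P S z c) (a : ι → ℕ) :
    ∏ i, P i ^ a i = Ideal.span {mon z (parameterExponent c a)} :=
  prod_pow_eq_span h.injective h.eq_span h.eq_top a

lemma monoIdeal_eq (h : IsSNCAt P S z c) (M : Set (ι → ℕ)) :
    monoIdeal P M = monIdeal z (parameterExponent c '' M) := by
  refine le_antisymm (iSup₂_le fun a ha ↦ ?_) (Ideal.span_le.2 ?_)
  · rw [h.prod_eq_span, Ideal.span_singleton_le_iff_mem]
    exact mon_mem_monIdeal z ⟨a, ha, rfl⟩ le_rfl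
  · rintro _ ⟨_, ⟨a, ha, rfl⟩, rfl⟩
    refine prod_le_monoIdeal P ha ?_
    rw [h.prod_eq_span]
    exact Ideal.mem_span_singleton_self _

lemma prod_le_of_le (h : IsSNCAt P S z c) {M : Set (ι → ℕ)} {a d : ι → ℕ} (hd : d ∈ M)
    (hda : ∀ i ∈ S, d i ≤ a i) : ∏ i, P i ^ a i ≤ monoIdeal P M := by
  rw [h.monoIdeal_eq, h.prod_eq_span, Ideal.span_singleton_le_iff_mem]
  exact mon_mem_monIdeal z ⟨d, hd, rfl⟩ ((parameterExponent_le_iff h.injective _ _).2 hda)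

variable [IsNoetherianRing A]

/-- A monomial is its own expansion with coefficient `1`, so membership is divisibility by a
generator. Only the divisors in `S` count, the other ideals being trivial. -/
lemma prod_le_monoIdeal_iff (h : IsSNCAt P S z c) {M : Set (ι → ℕ)} {a : ι → ℕ} :
    ∏ i, P i ^ a i ≤ monoIdeal P M ↔ ∃ d ∈ M, ∀ i ∈ S, d i ≤ a i := by
  refine ⟨fun h1 ↦ ?_, fun ⟨d, hd, hda⟩ ↦ h.prod_le_of_le hd hda⟩
  rw [h.monoIdeal_eq, h.prod_eq_span, Ideal.span_singleton_le_iff_mem] at h1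
  obtain ⟨_, ⟨d, hd, rfl⟩, hle⟩ := h.isRSP.mon_mem_of_sum_mem (Set.range c)
    (apply_eq_zero_of_mem_image_parameterExponent M) {parameterExponent c a} 1
    (by simpa using fun j hj ↦ parameterExponent_of_notMem (c := c) a (j := j) (by simpa using hj))
    (fun _ _ h1 ↦ (h.isRSP.isPrime_span _).ne_top ((Ideal.eq_top_iff_one _).2 h1))
    (by simpa using h1) _ (Finset.mem_singleton_self _)
  exact ⟨d, hd, (parameterExponent_le_iff h.injective _ _).1 hle⟩

/-- The monomial hull contains the ideal. -/
theorem le_monoIdeal_hullExponents (h : IsSNCAt P S z c) (𝔧 : Ideal A) :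
    𝔧 ≤ monoIdeal P (hullExponents P 𝔧) := by
  intro f hf
  obtain ⟨C, v, hC, hv, rfl⟩ := exists_expansion z (Set.range c) (fun i _ ↦ h.isRSP.mem i) f
  refine sum_mem fun b hb ↦ Ideal.mul_mem_left _ _ ?_
  obtain ⟨a, rfl⟩ := exists_parameterExponent_eq h.injective b (hC b hb)
  rw [← Ideal.span_singleton_le_iff_mem, ← h.prod_eq_span]
  -- Each monomial ideal containing `𝔧` contains every monomial of `f`, so these monomials belong to
  -- the hull.
  refine prod_le_monoIdeal P fun M hM ↦ ?_
  have h1 := hM hf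
  rw [h.monoIdeal_eq] at h1
  obtain ⟨_, ⟨d, hd, rfl⟩, hle⟩ := h.isRSP.mon_mem_of_sum_mem (Set.range c)
    (apply_eq_zero_of_mem_image_parameterExponent M) C v hC hv h1 _ hb
  exact h.prod_le_of_le hd ((parameterExponent_le_iff h.injective _ _).1 hle)

/-- Meant for `𝔭` the prime of a generization and `S'` the divisors through it: functions invertible
there can be cancelled modulo monomial ideals in these divisors. -/
lemma mem_of_mul_mem (h : IsSNCAt P S z c) {S' : Set ι} {M : Set (ι → ℕ)}
    (hM : ∀ a ∈ M, ∀ i ∉ S', a i = 0) {𝔭 : Ideal A} (h𝔭 : ∀ i ∈ S ∩ S', P i ≤ 𝔭) {u x : A}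
    (hu : u ∉ 𝔭) (hux : u * x ∈ monoIdeal P M) : x ∈ monoIdeal P M := by
  rw [h.monoIdeal_eq] at hux ⊢
  refine h.isRSP.mem_of_mul_mem (c '' {i | i.1 ∈ S'}) ?_ (fun hu' ↦ hu (?_)) hux
  · rintro _ ⟨a, ha, rfl⟩ j hj
    by_cases hj' : j ∈ Set.range c
    · obtain ⟨i, rfl⟩ := hj'
      rw [parameterExponent_apply h.injective]
      exact hM a ha i fun hi ↦ hj ⟨i, hi, rfl⟩
    · exact parameterExponent_of_notMem a hj'
  · refine Ideal.span_le.2 ?_ hu'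
    rintro _ ⟨_, ⟨i, hi, rfl⟩, rfl⟩
    refine h𝔭 i ⟨i.2, hi⟩ ?_
    rw [h.eq_span]
    exact Ideal.mem_span_singleton_self _

end IsSNCAt

end SNC

end Toroidal

namespace Toroidal

/-! ### Existence of the toroidal hull -/

section Hull

variable {X : Scheme.{u}} {ι : Type*}

lemma map_stalkSpecializes (I : X.IdealSheafData) {x y : X} (h : y ⤳ x) :
    (stalkIdeal I x).map (X.presheaf.stalkSpecializes h).hom = stalkIdeal I y := by
  obtain ⟨U, hx, -⟩ := exists_affineOpen_mem x (V := ⊤) trivial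
  have hy : y ∈ U.1 := h.mem_open U.1.2 hx
  rw [stalkIdeal_eq I U hx, stalkIdeal_eq I U hy, Ideal.map_map, ← CommRingCat.hom_comp,
    TopCat.Presheaf.germ_stalkSpecializes]

/-- The stalk at a generization is a localization of the stalk at `x`; denominators are found among
sections over a common affine open set. -/
lemma exists_mul_mem_of_stalkSpecializes_mem {x y : X} (h : y ⤳ x)
    (𝔟 : Ideal (X.presheaf.stalk x)) (f : X.presheaf.stalk x)
    (hf : X.presheaf.stalkSpecializes h f ∈ 𝔟.map (X.presheaf.stalkSpecializes h).hom) :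
    ∃ u, IsUnit (X.presheaf.stalkSpecializes h u) ∧ u * f ∈ 𝔟 := by
  obtain ⟨U, hx, -⟩ := exists_affineOpen_mem x (V := ⊤) trivial
  have hy : y ∈ U.1 := h.mem_open U.1.2 hx
  have hgerm : ∀ r : Γ(X, U.1), X.presheaf.stalkSpecializes h (X.presheaf.germ U.1 x hx r) =
      X.presheaf.germ U.1 y hy r := fun r ↦ X.presheaf.germ_stalkSpecializes_apply hx h r
  have hcomp : (X.presheaf.stalkSpecializes h).hom.comp (X.presheaf.germ U.1 x hx).hom =
      (X.presheaf.germ U.1 y hy).hom := RingHom.ext hgerm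
  let := (X.presheaf.germ U.1 x hx).hom.toAlgebra
  have hloc := stalk_isLocalization U hx
  let M := ((IsLocalRing.maximalIdeal (X.presheaf.stalk x)).comap
      (X.presheaf.germ U.1 x hx).hom).primeCompl
  obtain ⟨⟨f₀, s⟩, hs⟩ := IsLocalization.surj M f
  have hs' : f * X.presheaf.germ U.1 x hx s.1 = X.presheaf.germ U.1 x hx f₀ := hs
  have h𝔟 : (𝔟.comap (X.presheaf.germ U.1 x hx).hom).map (X.presheaf.germ U.1 x hx).hom = 𝔟 :=
    IsLocalization.map_under M _ 𝔟
  rw [← h𝔟, Ideal.map_map, hcomp] at hf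
  have hf₀ : X.presheaf.germ U.1 y hy f₀ ∈ (𝔟.comap (X.presheaf.germ U.1 x hx).hom).map
      (X.presheaf.germ U.1 y hy).hom := by
    rw [← hgerm, ← hs', map_mul]
    exact Ideal.mul_mem_right _ _ hf
  obtain ⟨t, ht, htf⟩ := (germ_mem_map_iff U hy _ f₀).1 hf₀
  refine ⟨X.presheaf.germ U.1 x hx t, by rwa [hgerm], ?_⟩
  have hsu : IsUnit (X.presheaf.germ U.1 x hx s.1) := IsLocalization.map_units _ s
  rw [← Ideal.mul_unit_mem_iff_mem _ hsu, mul_assoc, hs', ← map_mul]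
  exact htf

/-- An inclusion of stalks of a finitely generated ideal sheaf extends to a neighbourhood. -/
lemma exists_affineOpen_stalkIdeal_le [IsLocallyNoetherian X] (J : X.IdealSheafData)
    (U : X.affineOpens) (𝔞 : Ideal Γ(X, U.1)) {x : X} (hx : x ∈ U.1)
    (h : stalkIdeal J x ≤ 𝔞.map (X.presheaf.germ U.1 x hx).hom) :
    ∃ V : X.Opens, x ∈ V ∧ V ≤ U.1 ∧ ∀ (y : X) (hy : y ∈ U.1), y ∈ V →
      stalkIdeal J y ≤ 𝔞.map (X.presheaf.germ U.1 y hy).hom := by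
  classical
  have := IsLocallyNoetherian.component_noetherian U
  obtain ⟨G, hG⟩ : (J.ideal U).FG := IsNoetherian.noetherian _
  have key : ∀ g : G, ∃ s : Γ(X, U.1), IsUnit (X.presheaf.germ U.1 x hx s) ∧ s * g ∈ 𝔞 := by
    intro g
    refine (germ_mem_map_iff U hx 𝔞 g).1 (h ?_)
    rw [stalkIdeal_eq J U hx]
    exact Ideal.mem_map_of_mem _ (hG ▸ Ideal.subset_span g.2)
  choose s hs hsg using key
  refine ⟨X.basicOpen (∏ g, s g), (X.mem_basicOpen _ _ hx).2 ?_, X.basicOpen_le _,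
    fun y hy hyV ↦ ?_⟩
  · rw [map_prod]
    exact (IsUnit.prod_univ_iff).2 hs
  · rw [stalkIdeal_eq J U hy, ← hG, Ideal.span, Ideal.map_span, Ideal.span_le]
    rintro _ ⟨g, hg, rfl⟩
    refine (germ_mem_map_iff U hy 𝔞 g).2 ⟨s ⟨g, hg⟩, ?_, hsg ⟨g, hg⟩⟩
    have h1 := (X.mem_basicOpen _ _ hy).1 hyV
    rw [map_prod] at h1
    exact (IsUnit.prod_univ_iff).1 h1 ⟨g, hg⟩

/-- The stalks of the ideal sheaves of the divisors. -/
noncomputable def divisorStalk (D : ι → Closeds X) (x : X) (i : ι) : Ideal (X.presheaf.stalk x) :=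
  stalkIdeal (divisorIdeal (D i)) x

lemma divisorStalk_of_notMem (D : ι → Closeds X) {x : X} {i : ι} (h : x ∉ D i) :
    divisorStalk D x i = ⊤ :=
  stalkIdeal_vanishingIdeal_of_notMem _ h

lemma divisorStalk_le (D : ι → Closeds X) {x : X} {i : ι} (h : x ∈ D i) :
    divisorStalk D x i ≤ IsLocalRing.maximalIdeal _ :=
  stalkIdeal_vanishingIdeal_le_maximalIdeal _ h

lemma map_divisorStalk (D : ι → Closeds X) {x y : X} (h : y ⤳ x) :
    (fun i ↦ (divisorStalk D x i).map (X.presheaf.stalkSpecializes h).hom) = divisorStalk D y :=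
  funext fun _ ↦ map_stalkSpecializes _ h

lemma IsSNC.exists_isSNCAt {D : ι → Closeds X} (hD : IsSNC D) (x : X) :
    ∃ (n : ℕ) (z : Fin n → X.presheaf.stalk x) (c : {i | x ∈ D i} → Fin n),
      IsSNCAt (divisorStalk D x) {i | x ∈ D i} z c := by
  obtain ⟨n, z, c, h1, h2, h3, h4⟩ := hD x
  exact ⟨n, z, c, ⟨h1, h2⟩, h3, h4, fun i hi ↦ divisorStalk_of_notMem D hi⟩

variable [Fintype ι]

lemma map_prod_divisorStalk (D : ι → Closeds X) {x y : X} (h : y ⤳ x) (a : ι → ℕ) :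
    (∏ i, divisorStalk D x i ^ a i).map (X.presheaf.stalkSpecializes h).hom =
      ∏ i, divisorStalk D y i ^ a i := by
  rw [map_prod_pow]
  exact Finset.prod_congr rfl fun i _ ↦ congrArg (· ^ a i) (map_stalkSpecializes _ h)

lemma map_germ_monoIdeal (D : ι → Closeds X) (U : X.affineOpens) {x : X} (hx : x ∈ U.1)
    (M : Set (ι → ℕ)) : (monoIdeal (fun i ↦ (divisorIdeal (D i)).ideal U) M).map
      (X.presheaf.germ U.1 x hx).hom = monoIdeal (divisorStalk D x) M := by
  rw [map_monoIdeal]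
  congr 1
  exact funext fun i ↦ (stalkIdeal_eq _ U hx).symm

lemma IsToroidal.exists_stalkIdeal_eq {D : ι → Closeds X} {I : X.IdealSheafData}
    (h : IsToroidal D I) (x : X) : ∃ M, stalkIdeal I x = monoIdeal (divisorStalk D x) M := by
  obtain ⟨U, hx, M, hM⟩ := h x
  exact ⟨M, by rw [stalkIdeal_eq I U hx, hM, ← map_germ_monoIdeal D U hx]; rfl⟩

lemma isToroidal_of_stalkIdeal {D : ι → Closeds X} {I : X.IdealSheafData}
    (h : ∀ x : X, ∃ V : X.Opens, x ∈ V ∧ ∃ M, ∀ y ∈ V,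
      stalkIdeal I y = monoIdeal (divisorStalk D y) M) : IsToroidal D I := by
  intro x
  obtain ⟨V, hx, M, hM⟩ := h x
  obtain ⟨U, hxU, hUV⟩ := exists_affineOpen_mem x hx
  refine ⟨U, hxU, M, ideal_eq_of_stalkIdeal I U _ fun y hy ↦ ?_⟩
  rw [hM y (hUV hy)]
  exact (map_germ_monoIdeal D U hy M).symm

/-- Near every point `x`, every point lies in the closure of a point which also specializes to `x`
and lies on the same divisors. -/
lemma exists_open_specializes [NoetherianSpace X] (D : ι → Closeds X) (x : X) :
    ∃ V : X.Opens, x ∈ V ∧ ∀ y ∈ V, ∃ η : X, η ⤳ x ∧ η ⤳ y ∧ ∀ i, y ∈ D i → η ∈ D i := by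
  classical
  have hcl : ∀ T : Finset ι, IsClosed (⋂ i ∈ T, (D i : Set X)) := fun T ↦
    isClosed_biInter fun i _ ↦ (D i).isClosed
  choose S hSfin hScl hSirr hS using fun T ↦
    NoetherianSpace.exists_finite_set_isClosed_irreducible (hcl T)
  let F : Set X := ⋃ T : Finset ι, ⋃ W ∈ {W ∈ S T | x ∉ W}, W
  have hF : IsClosed F := isClosed_iUnion_of_finite fun T ↦
    ((hSfin T).subset fun _ h ↦ h.1).isClosed_biUnion fun W hW ↦ hScl T W hW.1
  refine ⟨⟨Fᶜ, hF.isOpen_compl⟩, ?_, fun y hy ↦ ?_⟩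
  · simp only [← SetLike.mem_coe, Opens.coe_mk, F, Set.mem_compl_iff, Set.mem_iUnion, not_exists]
    exact fun T W hW hxW ↦ hW.2 hxW
  · let T : Finset ι := Finset.univ.filter fun i ↦ y ∈ D i
    have hyT : y ∈ ⋂ i ∈ T, (D i : Set X) := by simp [T]
    rw [hS T] at hyT
    obtain ⟨W, hW, hyW⟩ := hyT
    have hxW : x ∈ W := by
      by_contra hxW
      exact hy (Set.mem_iUnion.2 ⟨T, Set.mem_biUnion (x := W) ⟨hW, hxW⟩ hyW⟩)
    obtain ⟨η, hη⟩ := QuasiSober.sober (hSirr T W hW) (hScl T W hW)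
    have hηW : η ∈ W := hη.mem
    refine ⟨η, hη.specializes hxW, hη.specializes hyW, fun i hi ↦ ?_⟩
    have h1 : W ⊆ ⋂ i ∈ T, (D i : Set X) := by
      rw [hS T]; exact Set.subset_sUnion_of_mem hW
    exact Set.mem_iInter₂.1 (h1 hηW) i (by simpa [T] using hi)

section

variable [IsLocallyNoetherian X] {D : ι → Closeds X}

/-- Functions invertible at `η` are nonzerodivisors modulo monomial ideals in the divisors through
`η`, so the inclusion descends from `η` to `x`. -/
lemma le_of_map_stalkSpecializes (hD : IsSNC D) {x η : X} (h : η ⤳ x) {𝔧 : Ideal (X.presheaf.stalk x)}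
    {M : Set (ι → ℕ)} (hM : ∀ a ∈ M, ∀ i, η ∉ D i → a i = 0)
    (h𝔧 : 𝔧.map (X.presheaf.stalkSpecializes h).hom ≤ monoIdeal (divisorStalk D η) M) :
    𝔧 ≤ monoIdeal (divisorStalk D x) M := by
  obtain ⟨n, z, c, hz⟩ := hD.exists_isSNCAt x
  intro f hf
  have h1 := h𝔧 (Ideal.mem_map_of_mem _ hf)
  rw [← map_divisorStalk D h, ← map_monoIdeal] at h1
  obtain ⟨u, hu, huf⟩ := exists_mul_mem_of_stalkSpecializes_mem h _ f h1
  refine hz.mem_of_mul_mem (S' := {i | η ∈ D i}) (𝔭 := (IsLocalRing.maximalIdeal _).comap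
    (X.presheaf.stalkSpecializes h).hom) hM (fun i hi ↦ ?_) (fun h2 ↦ h2 hu) huf
  rw [← Ideal.map_le_iff_le_comap]
  exact (map_stalkSpecializes _ h).le.trans (divisorStalk_le D hi.2)

/-- Setting exponents of divisors missing `η` to zero does not change a monomial ideal at `η`. After
this, if it contains the stalk of `J` at `η`, the same exponents at `x` give an ideal containing the
stalk there, hence the hull. -/
lemma hullExponents_subset_of_specializes (hD : IsSNC D) (J : X.IdealSheafData) {x η : X} (h : η ⤳ x) :
    hullExponents (divisorStalk D x) (stalkIdeal J x) ⊆
      hullExponents (divisorStalk D η) (stalkIdeal J η) := by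
  classical
  intro a ha M hM
  let r : (ι → ℕ) → ι → ℕ := fun d i ↦ if η ∈ D i then d i else 0
  have hr : monoIdeal (divisorStalk D η) M = monoIdeal (divisorStalk D η) (r '' M) := by
    simp only [monoIdeal, iSup_image]
    refine iSup_congr fun d ↦ iSup_congr fun _ ↦ Finset.prod_congr rfl fun i _ ↦ ?_
    by_cases hi : η ∈ D i
    · simp [r, hi]
    · rw [divisorStalk_of_notMem D hi, ← Ideal.one_eq_top, one_pow, one_pow]
  rw [hr] at hM ⊢
  have h1 := le_of_map_stalkSpecializes hD h (M := r '' M)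
    (by rintro _ ⟨d, -, rfl⟩ i hi; simp [r, hi]) (by rwa [map_stalkSpecializes])
  have h2 := Ideal.map_mono (f := (X.presheaf.stalkSpecializes h).hom) (ha _ h1)
  rwa [map_prod_divisorStalk, map_monoIdeal, map_divisorStalk] at h2

/-- All divisors through `y` pass through `η`, so divisibility of monomials at `η` implies
divisibility at `y`. -/
lemma hullExponents_subset_of_specializes' (hD : IsSNC D) (J : X.IdealSheafData) {y η : X}
    (h : η ⤳ y) (hS : ∀ i, y ∈ D i → η ∈ D i) :
    hullExponents (divisorStalk D η) (stalkIdeal J η) ⊆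
      hullExponents (divisorStalk D y) (stalkIdeal J y) := by
  intro a ha M hM
  obtain ⟨_, _, _, hη⟩ := hD.exists_isSNCAt η
  obtain ⟨_, _, _, hy⟩ := hD.exists_isSNCAt y
  have h1 := Ideal.map_mono (f := (X.presheaf.stalkSpecializes h).hom) hM
  rw [map_stalkSpecializes, map_monoIdeal, map_divisorStalk] at h1
  obtain ⟨d, hd, hda⟩ := hη.prod_le_monoIdeal_iff.1 (ha M h1)
  exact hy.prod_le_of_le hd fun i hi ↦ hda i (hS i hi)

variable [NoetherianSpace X]

/-- The stalks of the toroidal hull are the monomial hulls of the stalks. -/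
theorem exists_hull (hD : IsSNC D) (J : X.IdealSheafData) : ∃ H : X.IdealSheafData,
    IsToroidal D H ∧ ∀ x, stalkIdeal H x =
    monoIdeal (divisorStalk D x) (hullExponents (divisorStalk D x) (stalkIdeal J x)) := by
  let N : X → Set (ι → ℕ) := fun x ↦ hullExponents (divisorStalk D x) (stalkIdeal J x)
  -- The exponents found at `x` serve nearby. One inclusion spreads because `J` is of finite type.
  -- The other holds because each nearby `y` shares with `x` a generization on all divisors through
  -- `y`.
  have key : ∀ x : X, ∃ U : X.affineOpens, x ∈ U.1 ∧ ∀ y ∈ U.1,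
      monoIdeal (divisorStalk D y) (N y) = monoIdeal (divisorStalk D y) (N x) := by
    intro x
    obtain ⟨V, hxV, hV⟩ := exists_open_specializes D x
    obtain ⟨U, hxU, -⟩ := exists_affineOpen_mem x (V := ⊤) trivial
    obtain ⟨_, _, _, hx⟩ := hD.exists_isSNCAt x
    obtain ⟨V', hxV', hV'U, hV'⟩ := exists_affineOpen_stalkIdeal_le J U
      (monoIdeal (fun i ↦ (divisorIdeal (D i)).ideal U) (N x)) hxU
      (by rw [map_germ_monoIdeal]; exact hx.le_monoIdeal_hullExponents _)
    obtain ⟨U', hxU', hU'⟩ := exists_affineOpen_mem x (V := V ⊓ V') ⟨hxV, hxV'⟩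
    refine ⟨U', hxU', fun y hy ↦ le_antisymm ?_ ?_⟩
    · refine monoIdeal_hullExponents_le _ _ ?_
      rw [← map_germ_monoIdeal D U (hV'U (hU' hy).2)]
      exact hV' y (hV'U (hU' hy).2) (hU' hy).2
    · obtain ⟨η, hηx, hηy, hη⟩ := hV y (hU' hy).1
      exact monoIdeal_mono _ ((hullExponents_subset_of_specializes hD J hηx).trans
        (hullExponents_subset_of_specializes' hD J hηy hη))
  obtain ⟨H, hH⟩ := exists_stalkIdeal_eq (fun x ↦ monoIdeal (divisorStalk D x) (N x)) fun x ↦ by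
    obtain ⟨U, hx, hU⟩ := key x
    exact ⟨U, hx, _, fun y hy ↦ (hU y hy).trans (map_germ_monoIdeal D U hy _).symm⟩
  refine ⟨H, isToroidal_of_stalkIdeal fun x ↦ ?_, hH⟩
  obtain ⟨U, hx, hU⟩ := key x
  exact ⟨U.1, hx, N x, fun y hy ↦ (hH y).trans (hU y hy)⟩

theorem isLeast_toroidalHull (hD : IsSNC D) (J : X.IdealSheafData) :
    IsLeast (toroidalAbove D J) (toroidalHull D J) := by
  obtain ⟨H, hH, hstalk⟩ := exists_hull hD J
  have h : IsLeast (toroidalAbove D J) H := by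
    refine ⟨⟨hH, le_iff_stalkIdeal_le.2 fun x ↦ ?_⟩, fun K hK ↦ le_iff_stalkIdeal_le.2 fun x ↦ ?_⟩
    · obtain ⟨_, _, _, hx⟩ := hD.exists_isSNCAt x
      rw [hstalk]
      exact hx.le_monoIdeal_hullExponents _
    · obtain ⟨M, hM⟩ := hK.1.exists_stalkIdeal_eq x
      rw [hstalk, hM]
      exact monoIdeal_hullExponents_le _ _ (hM ▸ stalkIdeal_mono hK.2 x)
  rwa [toroidalHull, h.isGLB.sInf_eq]

theorem stalkIdeal_toroidalHull (hD : IsSNC D) (J : X.IdealSheafData) (x : X) :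
    stalkIdeal (toroidalHull D J) x =
    monoIdeal (divisorStalk D x) (hullExponents (divisorStalk D x) (stalkIdeal J x)) := by
  have h := isLeast_toroidalHull hD J
  obtain ⟨M, hM⟩ := h.1.1.exists_stalkIdeal_eq x
  obtain ⟨H, hH, hstalk⟩ := exists_hull hD J
  obtain ⟨_, _, _, hx⟩ := hD.exists_isSNCAt x
  refine le_antisymm ?_ ?_
  · rw [← hstalk]
    refine stalkIdeal_mono (h.2 ⟨hH, le_iff_stalkIdeal_le.2 fun y ↦ ?_⟩) x
    obtain ⟨_, _, _, hy⟩ := hD.exists_isSNCAt y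
    rw [hstalk]
    exact hy.le_monoIdeal_hullExponents _
  · rw [hM]
    exact monoIdeal_hullExponents_le _ _ (hM ▸ stalkIdeal_mono h.1.2 x)

end

end Hull

end Toroidal

namespace Toroidal

/-! ### Toroidal centers and equimultiplicity -/

section Center

variable {X : Scheme.{u}} {ι : Type*}

lemma natCast_le_mult_iff (I : X.IdealSheafData) (x : X) (n : ℕ) :
    (n : ℕ∞) ≤ mult I x ↔
      stalkIdeal I x ≤ IsLocalRing.maximalIdeal (X.presheaf.stalk x) ^ n := by
  constructor
  · intro h
    rcases n with - | n
    · simp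
    · have h1 : (n : ℕ∞) < mult I x := lt_of_lt_of_le (by exact_mod_cast n.lt_succ_self) h
      rw [mult] at h1
      obtain ⟨k, hk⟩ := lt_iSup_iff.1 h1
      obtain ⟨hk', hlt⟩ := lt_iSup_iff.1 hk
      exact hk'.trans (Ideal.pow_le_pow_right (by exact_mod_cast hlt))
  · intro h
    exact le_iSup₂_of_le n h le_rfl

lemma mult_antitone {I J : X.IdealSheafData} (h : I ≤ J) (x : X) : mult J x ≤ mult I x :=
  iSup₂_le fun n hn ↦ le_iSup₂_of_le n ((stalkIdeal_mono h x).trans hn) le_rfl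

lemma primePt_injective (x : X) : Function.Injective (primePt x) :=
  (X.fromSpecStalk x).injective

lemma primePt_specializes_of_le (x : X) {p q : PrimeSpectrum (X.presheaf.stalk x)} (h : p ≤ q) :
    primePt x p ⤳ primePt x q :=
  ((PrimeSpectrum.le_iff_specializes p q).1 h).map (X.fromSpecStalk x).continuous

lemma stalkIdeal_vanishingIdeal_eq_maximalIdeal (Z : Closeds X) {η : X} (hη : η ∈ Z)
    (h : ∀ y ∈ Z, y ⤳ η → η ⤳ y) :
    stalkIdeal (Scheme.IdealSheafData.vanishingIdeal Z) η = IsLocalRing.maximalIdeal _ := by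
  refine le_antisymm (stalkIdeal_vanishingIdeal_le_maximalIdeal Z hη) fun f hf ↦ ?_
  rw [mem_stalkIdeal_vanishingIdeal]
  intro p hp
  have h1 : primePt η p = η :=
    ((primePt_specializes η p).antisymm (h _ hp (primePt_specializes η p))).eq
  have h2 : primePt η (IsLocalRing.closedPoint _) = η := Scheme.fromSpecStalk_closedPoint
  have h3 : p = IsLocalRing.closedPoint _ := primePt_injective η (h1.trans h2.symm)
  rw [h3]
  exact hf

lemma IsStratum.isClosed {D : ι → Closeds X} {W : Set X} (h : IsStratum D W) : IsClosed W := by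
  obtain ⟨T, -, hW⟩ := h
  have h1 : closure W ⊆ W := hW.2 ⟨hW.1.1.closure, closure_minimal hW.1.2
    (isClosed_biInter fun i _ ↦ (D i).isClosed)⟩ subset_closure
  exact closure_subset_iff_isClosed.1 h1

lemma IsStratum.isIrreducible {D : ι → Closeds X} {W : Set X} (h : IsStratum D W) :
    IsIrreducible W := by
  obtain ⟨T, -, hW⟩ := h
  exact hW.1.1

lemma IsSNCAt.iSup_eq_span {A : Type*} [CommRing A] [IsLocalRing A] {n : ℕ}
    {P : ι → Ideal A} {S : Set ι} {z : Fin n → A} {c : S → Fin n} (h : IsSNCAt P S z c)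
    {T : Set ι} (hT : T ⊆ S) : ⨆ i ∈ T, P i = Ideal.span (z '' (c '' {i | i.1 ∈ T})) := by
  refine le_antisymm (iSup₂_le fun i hi ↦ ?_) (Ideal.span_le.2 ?_)
  · rw [h.eq_span ⟨i, hT hi⟩, Ideal.span_singleton_le_iff_mem]
    exact Ideal.subset_span ⟨_, ⟨⟨i, hT hi⟩, hi, rfl⟩, rfl⟩
  · rintro _ ⟨_, ⟨i, hi, rfl⟩, rfl⟩
    have h1 : z (c i) ∈ P i := by
      rw [h.eq_span]; exact Ideal.mem_span_singleton_self _
    exact (le_iSup₂_of_le (f := fun (i : ι) (_ : i ∈ T) ↦ P i) i.1 hi le_rfl) h1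

/-- The ideal of `Z` at `y` is the sum of the ideals of the divisors `D i` with `i ∈ T`, all of
which contain `y`. -/
structure IsCenterAt (D : ι → Closeds X) (Z : Closeds X) (T : Set ι) (y : X) : Prop where
  mem : ∀ i ∈ T, y ∈ D i
  stalkIdeal_eq : stalkIdeal (Scheme.IdealSheafData.vanishingIdeal Z) y =
    ⨆ i ∈ T, divisorStalk D y i

variable [IsLocallyNoetherian X] {D : ι → Closeds X} {Z : Closeds X}

/-- Distinct regular parameters generate a prime, so the `D i` with `i ∈ T` have a single largest
irreducible piece through `x`. It contains `W`, hence equals it by maximality, and among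
generizations of `x` the sets `Z` and `W` agree. -/
lemma isCenterAt_of_maximal (hD : IsSNC D) {T : Finset ι} {W : Set X}
    (hW : Maximal (fun V : Set X ↦ IsIrreducible V ∧ V ⊆ ⋂ i ∈ T, (D i : Set X)) W)
    (hWcl : IsClosed W) {x : X} (hx : x ∈ W) (hZ : ∀ y ∈ Z, y ⤳ x → y ∈ W) (hWZ : W ⊆ Z) :
    IsCenterAt D Z T x := by
  have hmem : ∀ y ∈ W, ∀ i ∈ T, y ∈ D i := fun y hy i hi ↦ Set.mem_iInter₂.1 (hW.1.2 hy) i hi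
  refine ⟨hmem x hx, ?_⟩
  obtain ⟨n, z, c, h⟩ := hD.exists_isSNCAt x
  have hspan := h.iSup_eq_span (T := T) fun i hi ↦ hmem x hx i hi
  have hprime : (⨆ i ∈ (T : Set ι), divisorStalk D x i).IsPrime := by
    rw [hspan]
    exact h.isRSP.isPrime_span _
  let p₀ : PrimeSpectrum (X.presheaf.stalk x) := ⟨_, hprime⟩
  have hle : ∀ p : PrimeSpectrum (X.presheaf.stalk x),
      p₀ ≤ p ↔ ∀ i ∈ T, primePt x p ∈ D i := by
    intro p
    change (⨆ i ∈ (T : Set ι), divisorStalk D x i) ≤ p.asIdeal ↔ _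
    rw [iSup₂_le_iff]
    exact forall₂_congr fun i _ ↦ (primePt_mem_iff (D i) p).symm
  have hsub : closure {primePt x p₀} ⊆ ⋂ i ∈ T, (D i : Set X) :=
    closure_minimal (Set.singleton_subset_iff.2 (Set.mem_iInter₂.2 ((hle p₀).1 le_rfl)))
      (isClosed_biInter fun i _ ↦ (D i).isClosed)
  obtain ⟨η, hη⟩ := QuasiSober.sober hW.1.1 hWcl
  obtain ⟨q, hq⟩ := exists_primePt_eq (hη.specializes hx)
  have hηW : η ∈ W := hη.mem
  have hWsub : W ⊆ closure {primePt x p₀} := by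
    have h1 : primePt x p₀ ⤳ η := by
      rw [← hq]
      exact primePt_specializes_of_le x ((hle q).2 (by rw [hq]; exact hmem η hηW))
    rw [← hη.def]
    exact closure_minimal (Set.singleton_subset_iff.2 h1.mem_closure) isClosed_closure
  have hcl : closure {primePt x p₀} ⊆ W := hW.2 ⟨isIrreducible_singleton.closure, hsub⟩ hWsub
  refine (stalkIdeal_vanishingIdeal_eq Z x _ fun p ↦ ?_).trans hprime.radical
  refine ⟨fun hp ↦ (hle p).2 (hmem _ (hZ _ hp (primePt_specializes x p))), fun hp ↦ hWZ (hcl ?_)⟩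
  exact (primePt_specializes_of_le x (p := p₀) hp).mem_closure

/-- Near every point, the center is cut out by a fixed set of the divisors. -/
theorem IsToroidalCenter.exists_open [NoetherianSpace X] (hD : IsSNC D)
    (hZ : IsToroidalCenter D Z) (x : X) :
    ∃ V : X.Opens, x ∈ V ∧ ∃ T : Set ι, ∀ y ∈ V, y ∈ Z → IsCenterAt D Z T y := by
  by_cases hx : x ∈ Z
  swap
  · exact ⟨⟨(Z : Set X)ᶜ, Z.isClosed.isOpen_compl⟩, hx, ∅, fun y hy hyZ ↦ absurd hyZ hy⟩
  obtain ⟨S, -, hS, hdisj, hZS⟩ := hZ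
  have hx' : x ∈ ⋃₀ S := hZS ▸ hx
  obtain ⟨W, hWS, hxW⟩ := hx'
  obtain ⟨F, hFfin, hFcl, hFirr, hF⟩ :=
    NoetherianSpace.exists_finite_set_isClosed_irreducible Z.isClosed
  -- A component of `Z` lies in the stratum containing its generic point, and by disjointness only
  -- `W` passes through `x`. The finitely many components missing `x` are then removed.
  have hFW : ∀ C ∈ F, x ∈ C → C ⊆ W := by
    intro C hC hxC
    obtain ⟨ξ, hξ⟩ := QuasiSober.sober (hFirr C hC) (hFcl C hC)
    have h1 : ξ ∈ ⋃₀ S := by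
      rw [← hZS, hF]
      exact ⟨C, hC, hξ.mem⟩
    obtain ⟨W', hW'S, hξW'⟩ := h1
    have h2 : C ⊆ W' := by
      rw [← hξ.def]
      exact closure_minimal (Set.singleton_subset_iff.2 hξW') (hS W' hW'S).isClosed
    have h3 : W' = W := hdisj.elim hW'S hWS
      (Set.not_disjoint_iff.2 ⟨x, h2 hxC, hxW⟩)
    exact h3 ▸ h2
  let F' : Set X := ⋃ C ∈ {C ∈ F | x ∉ C}, C
  have hF' : IsClosed F' := (hFfin.subset fun _ h ↦ h.1).isClosed_biUnion fun C hC ↦ hFcl C hC.1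
  obtain ⟨T, -, hT⟩ := hS W hWS
  refine ⟨⟨F'ᶜ, hF'.isOpen_compl⟩, ?_, T, fun y hy hyZ ↦ ?_⟩
  · intro h
    obtain ⟨C, hC, hxC⟩ := Set.mem_iUnion₂.1 h
    exact hC.2 hxC
  · have hW : ∀ w ∈ Z, w ∈ F'ᶜ → w ∈ W := by
      intro w hw hwF
      have h1 : w ∈ ⋃₀ F := hF ▸ hw
      obtain ⟨C, hC, hwC⟩ := h1
      refine hFW C hC ?_ hwC
      by_contra hxC
      exact hwF (Set.mem_biUnion (x := C) ⟨hC, hxC⟩ hwC)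
    refine isCenterAt_of_maximal hD hT (hS W hWS).isClosed (hW y hyZ hy)
      (fun w hw hwy ↦ hW w hw (hwy.mem_open hF'.isOpen_compl hy)) ?_
    rw [hZS]
    exact Set.subset_sUnion_of_mem hWS

lemma exists_monoIdeal_eq {A : Type*} [CommRing A] [IsLocalRing A] [Fintype ι] {n : ℕ}
    {P : ι → Ideal A} {S : Set ι} {z : Fin n → A} {c : S → Fin n} (h : IsSNCAt P S z c)
    {M : Set (Fin n → ℕ)} (hM : ∀ a ∈ M, ∀ i ∉ Set.range c, a i = 0) :
    ∃ M', monIdeal z M = monoIdeal P M' := by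
  refine ⟨parameterExponent c ⁻¹' M, ?_⟩
  rw [h.monoIdeal_eq, Set.image_preimage_eq_of_subset]
  intro a ha
  exact exists_parameterExponent_eq h.injective a (hM a ha)

/-- An ideal sheaf which is equimultiple along the center of multiplicity `m` is contained in the
`m`-th power of the ideal sheaf of the center. -/
theorem IsToroidallyEquimultiple.le_pow [NoetherianSpace X] (hD : IsSNC D) (hZ : IsToroidalCenter D Z)
    {J : X.IdealSheafData} {m : ℕ} (hJ : IsToroidallyEquimultiple D J Z m) :
    J ≤ Scheme.IdealSheafData.vanishingIdeal Z ^ m := by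
  rw [le_iff_stalkIdeal_le]
  intro x
  rw [stalkIdeal_pow]
  by_cases hx : x ∈ Z
  swap
  · rw [stalkIdeal_vanishingIdeal_of_notMem Z hx, ← Ideal.one_eq_top, one_pow, Ideal.one_eq_top]
    exact le_top
  obtain ⟨V, hxV, T, hV⟩ := hZ.exists_open hD x
  have hT := hV x hxV hx
  obtain ⟨S, -, hS, hdisj, hZS⟩ := hZ
  have hx' : x ∈ ⋃₀ S := hZS ▸ hx
  obtain ⟨W, hWS, hxW⟩ := hx'
  have hWZ : W ⊆ Z := hZS ▸ Set.subset_sUnion_of_mem hWS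
  obtain ⟨η, hη⟩ := QuasiSober.sober (hS W hWS).isIrreducible (hS W hWS).isClosed
  have hmax : stalkIdeal (Scheme.IdealSheafData.vanishingIdeal Z) η =
      IsLocalRing.maximalIdeal _ := by
    refine stalkIdeal_vanishingIdeal_eq_maximalIdeal Z (hWZ hη.mem) fun y hy hyη ↦ ?_
    have h1 : y ∈ ⋃₀ S := hZS ▸ hy
    obtain ⟨W', hW'S, hyW'⟩ := h1
    have h3 : W' = W := hdisj.elim hW'S hWS
      (Set.not_disjoint_iff.2 ⟨η, hyη.mem_closed (hS W' hW'S).isClosed hyW', hη.mem⟩)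
    exact hη.specializes (h3 ▸ hyW')
  have hηx : η ⤳ x := hη.specializes hxW
  have hJη : stalkIdeal J η ≤ IsLocalRing.maximalIdeal _ ^ m :=
    (natCast_le_mult_iff J η m).1 (hJ W (hS W hWS) hWZ η hη).ge
  rw [← hmax, ← map_stalkSpecializes (Scheme.IdealSheafData.vanishingIdeal Z) hηx,
    ← Ideal.map_pow] at hJη
  obtain ⟨n, z, c, h⟩ := hD.exists_isSNCAt x
  have hspan := hT.stalkIdeal_eq.trans (h.iSup_eq_span hT.mem)
  intro f hf
  have h1 : X.presheaf.stalkSpecializes hηx f ∈ stalkIdeal J η := by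
    rw [← map_stalkSpecializes _ hηx]
    exact Ideal.mem_map_of_mem _ hf
  -- From the generic point the inclusion descends up to a factor `u` outside the ideal of `Z`,
  -- which cancels modulo powers of that ideal.
  obtain ⟨u, hu, huf⟩ := exists_mul_mem_of_stalkSpecializes_mem hηx _ f (hJη h1)
  have hu' : u ∉ stalkIdeal (Scheme.IdealSheafData.vanishingIdeal Z) x := by
    intro hmem
    have h2 := Ideal.mem_map_of_mem (X.presheaf.stalkSpecializes hηx).hom hmem
    rw [map_stalkSpecializes _ hηx, hmax] at h2
    exact h2 hu
  rw [hspan] at hu' huf ⊢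
  rw [span_pow_eq_monIdeal] at huf ⊢
  exact h.isRSP.mem_of_mul_mem _ (fun a ha ↦ ha.1) hu' huf

variable [Fintype ι] [NoetherianSpace X]

/-- Needed so that `J ≤ I_Z^m` passes to the hull of `J`. -/
lemma exists_stalkIdeal_pow_eq_monoIdeal (hD : IsSNC D) (hZ : IsToroidalCenter D Z) (m : ℕ)
    (x : X) : ∃ M, stalkIdeal (Scheme.IdealSheafData.vanishingIdeal Z) x ^ m =
      monoIdeal (divisorStalk D x) M := by
  by_cases hx : x ∈ Z
  swap
  · refine ⟨{0}, ?_⟩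
    rw [stalkIdeal_vanishingIdeal_of_notMem Z hx, ← Ideal.one_eq_top, one_pow]
    simp only [monoIdeal, Set.mem_singleton_iff, iSup_iSup_eq_left, Pi.zero_apply, pow_zero,
      Finset.prod_const_one]
  obtain ⟨V, hxV, T, hV⟩ := hZ.exists_open hD x
  obtain ⟨n, z, c, h⟩ := hD.exists_isSNCAt x
  have hT := hV x hxV hx
  rw [hT.stalkIdeal_eq, h.iSup_eq_span hT.mem, span_pow_eq_monIdeal]
  refine exists_monoIdeal_eq h fun a ha i hi ↦ ha.1 i ?_
  rintro ⟨j, -, rfl⟩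
  exact hi ⟨j, rfl⟩

theorem toroidalHull_le_pow (hD : IsSNC D) (hZ : IsToroidalCenter D Z)
    {J : X.IdealSheafData} {m : ℕ} (hJ : IsToroidallyEquimultiple D J Z m) :
    toroidalHull D J ≤ Scheme.IdealSheafData.vanishingIdeal Z ^ m := by
  rw [le_iff_stalkIdeal_le]
  intro x
  have h1 := stalkIdeal_mono (hJ.le_pow hD hZ) x
  rw [stalkIdeal_pow] at h1 ⊢
  obtain ⟨M, hM⟩ := exists_stalkIdeal_pow_eq_monoIdeal hD hZ m x
  rw [hM] at h1 ⊢
  rw [stalkIdeal_toroidalHull hD]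
  exact monoIdeal_hullExponents_le _ _ h1

/-- Enlarging `J` cannot raise the multiplicity, and `Jᵗ ≤ I_Z^m` bounds it from below. -/
theorem IsToroidallyEquimultiple.toroidalHull (hD : IsSNC D) (hZ : IsToroidalCenter D Z)
    {J : X.IdealSheafData} {m : ℕ} (hJ : IsToroidallyEquimultiple D J Z m) :
    IsToroidallyEquimultiple D (toroidalHull D J) Z m := by
  intro W hW hWZ η hη
  refine le_antisymm ?_ ?_
  · rw [← hJ W hW hWZ η hη]
    exact mult_antitone (isLeast_toroidalHull hD J).1.2 η
  · rw [natCast_le_mult_iff]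
    have h1 := stalkIdeal_mono (toroidalHull_le_pow hD hZ hJ) η
    rw [stalkIdeal_pow] at h1
    exact h1.trans (Ideal.pow_right_mono
      (stalkIdeal_vanishingIdeal_le_maximalIdeal Z (hWZ hη.mem)) m)

end Center

end Toroidal

namespace Toroidal

/-! ### Local rings of the blow-up as rings of fractions -/

section Fractions

variable {A O : Type u} [CommRing A] [IsDomain A] [CommRing O]

/-- Pairs of fractions `f / g ^ N` with `f ∈ I ^ N`, one in the fraction field of `A` and one
in `O`. -/
def blowupSubring (φ : A →+* O) (I : Ideal A) {g : A} (hg : g ∈ I) :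
    Subring (FractionRing A × O) where
  carrier := {w | ∃ (N : ℕ) (f : A), f ∈ I ^ N ∧
    algebraMap A (FractionRing A) g ^ N * w.1 = algebraMap A (FractionRing A) f ∧
    φ g ^ N * w.2 = φ f}
  mul_mem' := by
    rintro w w' ⟨N, f, hf, h1, h2⟩ ⟨N', f', hf', h1', h2'⟩
    refine ⟨N + N', f * f', by rw [pow_add]; exact Ideal.mul_mem_mul hf hf', ?_, ?_⟩
    · rw [map_mul, ← h1, ← h1', Prod.fst_mul]; ring
    · rw [map_mul, ← h2, ← h2', Prod.snd_mul]; ring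
  one_mem' := ⟨0, 1, by simp, by simp, by simp⟩
  add_mem' := by
    rintro w w' ⟨N, f, hf, h1, h2⟩ ⟨N', f', hf', h1', h2'⟩
    refine ⟨N + N', f * g ^ N' + g ^ N * f', ?_, ?_, ?_⟩
    · rw [pow_add]
      exact add_mem (Ideal.mul_mem_mul hf (Ideal.pow_mem_pow hg _))
        (Ideal.mul_mem_mul (Ideal.pow_mem_pow hg _) hf')
    · rw [map_add, map_mul, map_mul, map_pow, map_pow, ← h1, ← h1', Prod.fst_add]; ring
    · rw [map_add, map_mul, map_mul, map_pow, map_pow, ← h2, ← h2', Prod.snd_add]; ring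
  zero_mem' := ⟨0, 0, by simp, by simp, by simp⟩
  neg_mem' := by
    rintro w ⟨N, f, hf, h1, h2⟩
    exact ⟨N, -f, neg_mem hf, by rw [Prod.fst_neg, map_neg, mul_neg, h1],
      by rw [Prod.snd_neg, map_neg, mul_neg, h2]⟩

/-- The candidate for the local ring of the blow-up: a local ring `R` between `A` and `O`, all of
whose elements map to fractions in `O`, and in which `I` becomes principal. -/
theorem exists_blowup_localization [IsLocalRing O] (φ : A →+* O) (I : Ideal A) {g : A}
    (hg : g ∈ I) (he : φ g ∈ nonZeroDivisors O) (hI : I.map φ = Ideal.span {φ g}) :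
    ∃ (R : Type u) (_ : CommRing R) (_ : IsLocalRing R) (θ : A →+* R) (ρ : R →+* O),
      ρ.comp θ = φ ∧ IsLocalHom ρ ∧ Function.Injective θ ∧ θ g ∈ nonZeroDivisors R ∧
      I.map θ = Ideal.span {θ g} ∧
      ∀ r : R, ∃ (N : ℕ) (f h : A) (u : O), f ∈ I ^ N ∧ h ∈ I ^ N ∧ IsUnit u ∧
        φ h = φ g ^ N * u ∧ φ h * ρ r = φ f := by
  have hg0 : g ≠ 0 := by
    rintro rfl
    rw [map_zero] at he
    exact zero_ne_one ((mul_cancel_left_mem_nonZeroDivisors he).1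
      (show (0 : O) * 0 = 0 * 1 by simp))
  have hgK : algebraMap A (FractionRing A) g ≠ 0 := by
    simpa using hg0
  -- The coordinate in the fraction field keeps `A` embedded, the one in `O` provides `ρ`.
  -- Localizing at the preimage of the maximal ideal of `O` makes `ρ` a local homomorphism.
  let Γ := blowupSubring φ I hg
  let pr : Γ →+* O := (RingHom.snd _ _).comp Γ.subtype
  let j : A →+* Γ := RingHom.codRestrict ((algebraMap A (FractionRing A)).prod φ) Γ
    fun a ↦ ⟨0, a, by simp, by simp, by simp⟩
  let q : Ideal Γ := (IsLocalRing.maximalIdeal O).comap pr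
  have hq : q.IsPrime := Ideal.comap_isPrime _ _
  let R := Localization.AtPrime q
  have hunit : ∀ w : q.primeCompl, IsUnit (pr w) := fun w ↦ by
    by_contra hw
    exact w.2 hw
  let ρ : R →+* O := IsLocalization.lift (M := q.primeCompl) hunit
  have hρ : ∀ w : Γ, ρ (algebraMap Γ R w) = pr w := fun w ↦ IsLocalization.lift_eq hunit w
  have hmk : ∀ (w : Γ) (s : q.primeCompl), ρ (IsLocalization.mk' R w s) * pr s = pr w := by
    intro w s
    rw [← hρ s, ← map_mul, IsLocalization.mk'_spec, hρ]
  let θ : A →+* R := (algebraMap Γ R).comp j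
  have hcomp : ρ.comp θ = φ := by
    ext a
    exact hρ (j a)
  have hjg : ∀ w : Γ, j g * w = 0 → w = 0 := by
    intro w hw
    have h1 := congrArg (fun v : Γ ↦ v.1.1) hw
    have h2 := congrArg (fun v : Γ ↦ v.1.2) hw
    have h1' : algebraMap A (FractionRing A) g * w.1.1 = 0 := h1
    have h2' : φ g * w.1.2 = 0 := h2
    refine Subtype.ext (Prod.ext ?_ ?_)
    · exact (mul_eq_zero.1 h1').resolve_left hgK
    · exact (mul_cancel_left_mem_nonZeroDivisors he).1 (h2'.trans (mul_zero _).symm)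
  refine ⟨R, inferInstance, inferInstance, θ, ρ, hcomp, ⟨?_⟩, ?_, ?_, ?_, ?_⟩
  · intro r hr
    obtain ⟨w, s, rfl⟩ := IsLocalization.exists_mk'_eq q.primeCompl r
    have h1 := hmk w s
    have h2 : w ∈ q.primeCompl := fun hw ↦ hw (h1 ▸ hr.mul (hunit s))
    exact (IsLocalization.AtPrime.isUnit_mk'_iff R q w s).2 h2
  · rw [injective_iff_map_eq_zero]
    intro a ha
    have h1 : algebraMap Γ R (j a) = 0 := ha
    rw [IsLocalization.map_eq_zero_iff q.primeCompl] at h1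
    obtain ⟨⟨w, hw⟩, hwa⟩ := h1
    have h2 := congrArg (fun v : Γ ↦ v.1.1) hwa
    have h2' : w.1.1 * algebraMap A (FractionRing A) a = 0 := h2
    rcases mul_eq_zero.1 h2' with h3 | h3
    · exfalso
      obtain ⟨N, f, -, h4, h5⟩ := w.2
      rw [h3, mul_zero] at h4
      have hf0 : f = 0 := by simpa using h4.symm
      rw [hf0, map_zero] at h5
      have h6 : w.1.2 = 0 :=
        (mul_cancel_left_mem_nonZeroDivisors (pow_mem he N)).1 (h5.trans (mul_zero _).symm)
      have h7 : pr w = 0 := h6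
      exact hw (Ideal.mem_comap.2 (by rw [h7]; exact zero_mem _))
    · simpa using h3
  · refine IsLocalization.map_nonZeroDivisors_le q.primeCompl R
      (Submonoid.mem_map_of_mem _ (mem_nonZeroDivisors_iff_right.2 fun w hw ↦ hjg w ?_))
    rwa [mul_comm]
  · refine le_antisymm (Ideal.map_le_iff_le_comap.2 fun f hf ↦ ?_)
      ((Ideal.span_singleton_le_iff_mem _).2 (Ideal.mem_map_of_mem _ hg))
    have h1 : φ f ∈ Ideal.span {φ g} := hI ▸ Ideal.mem_map_of_mem _ hf
    obtain ⟨β, hβ⟩ := Ideal.mem_span_singleton.1 h1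
    let w : Γ := ⟨(algebraMap A (FractionRing A) f / algebraMap A (FractionRing A) g, β),
      1, f, by simpa using hf, by rw [pow_one]; exact mul_div_cancel₀ _ hgK, by rw [pow_one, hβ]⟩
    have h2 : j f = j g * w := Subtype.ext (Prod.ext (mul_div_cancel₀ _ hgK).symm hβ)
    exact Ideal.mem_span_singleton.2 ⟨algebraMap Γ R w,
      (congrArg (algebraMap Γ R) h2).trans (map_mul _ _ _)⟩
  · intro r
    obtain ⟨w, s, rfl⟩ := IsLocalization.exists_mk'_eq q.primeCompl r
    have h1 := hmk w s
    obtain ⟨N, f, hf, -, h2⟩ := w.2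
    obtain ⟨N', f', hf', -, h2'⟩ := s.1.2
    refine ⟨N + N', f * g ^ N', g ^ N * f', pr s, ?_, ?_, hunit s, ?_, ?_⟩
    · rw [pow_add]; exact Ideal.mul_mem_mul hf (Ideal.pow_mem_pow hg _)
    · rw [pow_add]; exact Ideal.mul_mem_mul (Ideal.pow_mem_pow hg _) hf'
    · rw [map_mul, map_pow, ← h2', pow_add, mul_assoc]; rfl
    · rw [map_mul, map_mul, map_pow, map_pow, ← h2', ← h2]
      have h3 : w.1.2 = ρ (IsLocalization.mk' R w s) * s.1.1.2 := h1.symm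
      rw [h3]; ring

end Fractions

section Blowup

variable {X B : Scheme.{u}}

lemma exists_specMap_fromSpecStalk {R : CommRingCat.{u}} [IsLocalRing R] (h : Spec R ⟶ B) (b : B)
    (hb : h (IsLocalRing.closedPoint R) = b) :
    ∃ τ : B.presheaf.stalk b ⟶ R, Spec.map τ ≫ B.fromSpecStalk b = h := by
  subst hb
  exact ⟨Scheme.stalkClosedPointTo h, Scheme.Spec_stalkClosedPointTo_fromSpecStalk h⟩

lemma specMap_fromSpecStalk_injective {R : CommRingCat.{u}} {b : B}
    {τ τ' : B.presheaf.stalk b ⟶ R}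
    (h : Spec.map τ ≫ B.fromSpecStalk b = Spec.map τ' ≫ B.fromSpecStalk b) : τ = τ' :=
  Spec.map_injective ((cancel_mono _).1 h)

/-- The local rings of a blow-up consist of fractions of elements of powers of the center. -/
theorem IsBlowup.exists_fraction {π : B ⟶ X} {I : X.IdealSheafData} (hπ : IsBlowup π I) (b : B)
    [IsDomain (X.presheaf.stalk (π b))] {g : X.presheaf.stalk (π b)} (hg : g ∈ stalkIdeal I (π b))
    (he : π.stalkMap b g ∈ nonZeroDivisors (B.presheaf.stalk b))
    (hI : stalkIdeal (I.comap π) b = Ideal.span {π.stalkMap b g}) :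
    Function.Injective (π.stalkMap b) ∧ ∀ β : B.presheaf.stalk b,
      ∃ (N : ℕ) (f h : X.presheaf.stalk (π b)) (u : B.presheaf.stalk b),
        f ∈ stalkIdeal I (π b) ^ N ∧ h ∈ stalkIdeal I (π b) ^ N ∧ IsUnit u ∧
        π.stalkMap b h = π.stalkMap b g ^ N * u ∧ π.stalkMap b h * β = π.stalkMap b f := by
  rw [stalkIdeal_comap] at hI
  obtain ⟨R, _, _, θ, ρ, hρθ, hρ, hθ, hθg, hθI, hfrac⟩ :=
    exists_blowup_localization (π.stalkMap b).hom (stalkIdeal I (π b)) hg he hI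
  let R' : CommRingCat.{u} := CommRingCat.of R
  let θ' : X.presheaf.stalk (π b) ⟶ R' := CommRingCat.ofHom θ
  let ρ' : R' ⟶ B.presheaf.stalk b := CommRingCat.ofHom ρ
  have hθρ : θ' ≫ ρ' = π.stalkMap b := CommRingCat.hom_ext hρθ
  have : IsLocalRing R' := ‹IsLocalRing R›
  have : IsLocalHom ρ'.hom := hρ
  obtain ⟨h, hh, -⟩ := hπ.existsUnique_lift (Spec.map θ' ≫ X.fromSpecStalk (π b))
    (isInvertible_of_specIdeal _ (θ' g) hθg
      ((specIdeal_comap_fromSpecStalk I (π b) θ').trans hθI))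
  obtain ⟨_, -, huniq⟩ := hπ.existsUnique_lift (B.fromSpecStalk b ≫ π) (by
    refine isInvertible_of_specIdeal _ (π.stalkMap b g) he ?_
    rw [← Scheme.SpecMap_stalkMap_fromSpecStalk, specIdeal_comap_fromSpecStalk, hI])
  -- Both sides lift the same morphism to `X`, along which the center becomes invertible, so
  -- uniqueness applies.
  have hρh : Spec.map ρ' ≫ h = B.fromSpecStalk b := by
    refine (huniq _ ?_).trans (huniq _ rfl).symm
    change (Spec.map ρ' ≫ h) ≫ π = _
    rw [Category.assoc, hh, ← Spec.map_comp_assoc, hθρ, Scheme.SpecMap_stalkMap_fromSpecStalk]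
  -- Since `ρ` is local, `h` sends the closed point to `b` and therefore factors through the local
  -- ring of `B` at `b`.
  have hb : h (IsLocalRing.closedPoint R') = b := by
    have h1 : B.fromSpecStalk b (IsLocalRing.closedPoint _) = b := Scheme.fromSpecStalk_closedPoint
    have h2 : Spec.map ρ' (IsLocalRing.closedPoint (B.presheaf.stalk b)) =
        IsLocalRing.closedPoint R' := IsLocalRing.comap_closedPoint ρ'.hom
    have h3 : h (Spec.map ρ' (IsLocalRing.closedPoint (B.presheaf.stalk b))) = b :=
      (congrArg (fun f : Spec _ ⟶ B ↦ f (IsLocalRing.closedPoint _)) hρh).trans h1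
    exact (congrArg h h2).symm.trans h3
  obtain ⟨τ, hτ⟩ := exists_specMap_fromSpecStalk h b hb
  -- Thus every `β` equals `ρ (τ β)`, and values of `ρ` are fractions by construction.
  have hτρ : τ ≫ ρ' = 𝟙 _ := by
    apply specMap_fromSpecStalk_injective
    rw [Spec.map_comp, Category.assoc, hτ, hρh, Spec.map_id, Category.id_comp]
  have hθτ : π.stalkMap b ≫ τ = θ' := by
    apply specMap_fromSpecStalk_injective
    rw [Spec.map_comp, Category.assoc, Scheme.SpecMap_stalkMap_fromSpecStalk, reassoc_of% hτ, hh]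
  refine ⟨fun a a' haa' ↦ hθ ?_, fun β ↦ ?_⟩
  · have h1 : ∀ a, θ a = τ (π.stalkMap b a) := fun a ↦ by
      rw [← CommRingCat.comp_apply, hθτ]; rfl
    rw [h1, h1, haa']
  · have h1 : ρ (τ β) = β := by
      have := congrArg (fun f : B.presheaf.stalk b ⟶ B.presheaf.stalk b ↦ f β) hτρ
      exact this
    obtain ⟨N, f, h, u, h2⟩ := hfrac (τ β)
    rw [h1] at h2
    exact ⟨N, f, h, u, h2⟩

end Blowup

end Toroidal

namespace Toroidal

/-! ### Birational transforms of divisors -/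

section StrictTransform

variable {X B : Scheme.{u}}

/-- An open set meeting the closure of `S` meets `S`, so vanishing on `S` passes to the closure. -/
lemma mem_stalkIdeal_closure (S : Set B) (V : B.affineOpens) {b : B} (hb : b ∈ V.1)
    (β : Γ(B, V.1)) (h : ∀ y ∈ S, y ∉ B.basicOpen β) : B.presheaf.germ V.1 b hb β ∈
      stalkIdeal (Scheme.IdealSheafData.vanishingIdeal (Closeds.closure S)) b := by
  rw [mem_stalkIdeal_vanishingIdeal]
  intro p hp
  by_contra hβ
  have h1 : primePt b p ∈ B.basicOpen β := by
    rw [primePt_eq V hb]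
    change Spec.map (B.presheaf.germ V.1 b hb) p ∈ V.2.fromSpec ⁻¹ᵁ B.basicOpen β
    rw [V.2.fromSpec_preimage_basicOpen]
    exact hβ
  obtain ⟨y, hy, hyS⟩ := mem_closure_iff.1 hp _ (B.basicOpen β).2 h1
  exact h y hyS hy

lemma exists_mul_germ_eq (V : B.affineOpens) {b : B} (hb : b ∈ V.1) (β : B.presheaf.stalk b) :
    ∃ β₀ s : Γ(B, V.1), IsUnit (B.presheaf.germ V.1 b hb s) ∧
      β * B.presheaf.germ V.1 b hb s = B.presheaf.germ V.1 b hb β₀ := by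
  let := (B.presheaf.germ V.1 b hb).hom.toAlgebra
  have hloc := stalk_isLocalization V hb
  let M := ((IsLocalRing.maximalIdeal (B.presheaf.stalk b)).comap
      (B.presheaf.germ V.1 b hb).hom).primeCompl
  obtain ⟨⟨f₀, s⟩, hs⟩ := IsLocalization.surj M β
  exact ⟨f₀, s, IsLocalization.map_units _ s, hs⟩

lemma primePt_comap (π : B ⟶ X) (b : B) (p : PrimeSpectrum (B.presheaf.stalk b)) :
    π (primePt b p) = primePt (π b) (p.comap (π.stalkMap b).hom) :=
  congrArg (fun f : Spec _ ⟶ X ↦ f p) (Scheme.SpecMap_stalkMap_fromSpecStalk (f := π)).symm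

lemma map_primePt_mem_iff (π : B ⟶ X) (b : B) (D : Closeds X)
    (p : PrimeSpectrum (B.presheaf.stalk b)) : π (primePt b p) ∈ D ↔
      (stalkIdeal (Scheme.IdealSheafData.vanishingIdeal D) (π b)).map (π.stalkMap b).hom ≤
        p.asIdeal := by
  rw [primePt_comap, primePt_mem_iff, Ideal.map_le_iff_le_comap]
  rfl

/-- The ideal of the closure of `π⁻¹(D \ Z)`, if `Z` has invertible inverse image. -/
theorem mem_strictTransform_iff (π : B ⟶ X) (D Z : Closeds X)
    (hE : IsInvertible (exceptionalIdeal π Z)) {b : B} {e : B.presheaf.stalk b}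
    (he : stalkIdeal (exceptionalIdeal π Z) b = Ideal.span {e}) (β : B.presheaf.stalk b) :
    β ∈ stalkIdeal (divisorIdeal (Closeds.closure (π ⁻¹' ((D : Set X) \ Z)))) b ↔
      e * β ∈ ((stalkIdeal (divisorIdeal D) (π b)).map (π.stalkMap b).hom).radical := by
  constructor
  · intro hβ
    rw [Ideal.radical_eq_sInf, Ideal.mem_sInf]
    rintro P ⟨hP, hPp⟩
    let p : PrimeSpectrum (B.presheaf.stalk b) := ⟨P, hPp⟩
    have hpD : π (primePt b p) ∈ D := (map_primePt_mem_iff π b D p).2 hP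
    by_cases hpZ : π (primePt b p) ∈ Z
    · have h1 := (map_primePt_mem_iff π b Z p).1 hpZ
      rw [← stalkIdeal_comap] at h1
      exact Ideal.mul_mem_right _ _ (h1 (he ▸ Ideal.mem_span_singleton_self e))
    · exact Ideal.mul_mem_left _ _ ((mem_stalkIdeal_vanishingIdeal _ b β).1 hβ p
        (subset_closure ⟨hpD, hpZ⟩))
  · intro hβ
    -- Spread the relation over an affine `V`. Off `Z` the equation `e₁` is a unit, so if `s' * β₀`
    -- were nonzero at a point of `π⁻¹(D \ Z)`, the ideal of `D` would contain a unit there.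
    obtain ⟨V, hb, e₁, -, he₁⟩ := hE b
    obtain ⟨β₀, s, hs, hβs⟩ := exists_mul_germ_eq V hb β
    have h1 : stalkIdeal (exceptionalIdeal π Z) b = Ideal.span {B.presheaf.germ V.1 b hb e₁} := by
      rw [stalkIdeal_eq _ V hb, he₁, Ideal.map_span, Set.image_singleton]
    have h2 : B.presheaf.germ V.1 b hb e₁ ∈ Ideal.span {e} :=
      he ▸ h1 ▸ Ideal.mem_span_singleton_self _
    obtain ⟨r, hr⟩ := Ideal.mem_span_singleton.1 h2
    have h3 : B.presheaf.germ V.1 b hb (e₁ * β₀) ∈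
        ((stalkIdeal (divisorIdeal D) (π b)).map (π.stalkMap b).hom).radical := by
      rw [map_mul, hr, ← hβs, show e * r * (β * B.presheaf.germ V.1 b hb s) =
        e * β * (r * B.presheaf.germ V.1 b hb s) by ring]
      exact Ideal.mul_mem_right _ _ hβ
    obtain ⟨k, hk⟩ := h3
    rw [← stalkIdeal_comap, stalkIdeal_eq _ V hb, ← map_pow] at hk
    obtain ⟨s', hs', hk'⟩ := (germ_mem_map_iff V hb _ _).1 hk
    have h4 : B.presheaf.germ V.1 b hb (s' * β₀) ∈
        stalkIdeal (divisorIdeal (Closeds.closure (π ⁻¹' ((D : Set X) \ Z)))) b := by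
      refine mem_stalkIdeal_closure _ V hb _ fun y hy hyβ ↦ ?_
      have hyV : y ∈ V.1 := B.basicOpen_le _ hyβ
      have h5 := (B.mem_basicOpen _ _ hyV).1 hyβ
      rw [map_mul] at h5
      have h6 : IsUnit (B.presheaf.germ V.1 y hyV e₁) := by
        have h7 : stalkIdeal (exceptionalIdeal π Z) y = ⊤ := by
          rw [exceptionalIdeal, stalkIdeal_comap, stalkIdeal_vanishingIdeal_of_notMem Z hy.2,
            Ideal.map_top]
        rw [stalkIdeal_eq _ V hyV, he₁, Ideal.map_span, Set.image_singleton] at h7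
        exact Ideal.span_singleton_eq_top.1 h7
      have h7 : B.presheaf.germ V.1 y hyV (s' * (e₁ * β₀) ^ k) ∈
          stalkIdeal ((divisorIdeal D).comap π) y := by
        rw [stalkIdeal_eq _ V hyV]
        exact Ideal.mem_map_of_mem _ hk'
      have h8 : IsUnit (B.presheaf.germ V.1 y hyV (s' * (e₁ * β₀) ^ k)) := by
        rw [map_mul, map_pow, map_mul]
        exact (isUnit_of_mul_isUnit_left h5).mul
          ((h6.mul (isUnit_of_mul_isUnit_right h5)).pow k)
      rw [stalkIdeal_comap] at h7
      have h9 : (stalkIdeal (divisorIdeal D) (π y)).map (π.stalkMap y).hom ≤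
          IsLocalRing.maximalIdeal _ := by
        rw [Ideal.map_le_iff_le_comap]
        refine (stalkIdeal_vanishingIdeal_le_maximalIdeal D hy.1).trans (fun w hw hu ↦ hw ?_)
        exact (isUnit_map_iff (π.stalkMap y).hom w).1 hu
      exact h9 h7 h8
    rw [map_mul, Ideal.unit_mul_mem_iff_mem _ hs', ← hβs, Ideal.mul_unit_mem_iff_mem _ hs] at h4
    exact h4

end StrictTransform

/-! ### The birational transform as a colon ideal -/

section Transform

variable {X B : Scheme.{u}} {π : B ⟶ X} {Z : Closeds X}

lemma mem_map_germ_colon_iff (I : B.IdealSheafData) (V : B.affineOpens) {b : B} (hb : b ∈ V.1)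
    (e : Γ(B, V.1)) (β : B.presheaf.stalk b) :
    β ∈ ((I.ideal V).colon {e}).map (B.presheaf.germ V.1 b hb).hom ↔
      B.presheaf.germ V.1 b hb e * β ∈ stalkIdeal I b := by
  obtain ⟨β₀, s, hs, hβs⟩ := exists_mul_germ_eq V hb β
  rw [← Ideal.mul_unit_mem_iff_mem _ hs, hβs, ← Ideal.mul_unit_mem_iff_mem (stalkIdeal I b) hs,
    mul_assoc, hβs, ← map_mul, stalkIdeal_eq I V hb]
  refine (germ_mem_map_iff V hb _ _).trans (Iff.trans ?_ (germ_mem_map_iff V hb _ _).symm)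
  refine exists_congr fun r ↦ and_congr_right fun _ ↦ ?_
  rw [Submodule.mem_colon_singleton, smul_eq_mul, mul_assoc, mul_comm β₀]

/-- The ideal `E ^ m` is locally generated by one section, so the colon commutes with localization
and glues. -/
lemma exists_stalkIdeal_colon_eq {E : B.IdealSheafData} (hE : IsInvertible E)
    (I : B.IdealSheafData) (m : ℕ) : ∃ K : B.IdealSheafData, ∀ (b : B) (β : B.presheaf.stalk b),
      β ∈ stalkIdeal K b ↔ ∀ ε ∈ stalkIdeal E b ^ m, ε * β ∈ stalkIdeal I b := by
  have key : ∀ (b : B) (β : B.presheaf.stalk b),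
      β ∈ (stalkIdeal I b).colon ((stalkIdeal E b ^ m : Ideal _) : Set (B.presheaf.stalk b)) ↔
        ∀ ε ∈ stalkIdeal E b ^ m, ε * β ∈ stalkIdeal I b := fun b β ↦
    Submodule.mem_colon.trans (forall₂_congr fun ε _ ↦ by rw [smul_eq_mul, mul_comm])
  obtain ⟨K, hK⟩ := exists_stalkIdeal_eq (fun b : B ↦
    (stalkIdeal I b).colon ((stalkIdeal E b ^ m : Ideal _) : Set (B.presheaf.stalk b))) fun b ↦ by
      obtain ⟨V, hb, e, -, he⟩ := hE b
      refine ⟨V, hb, (I.ideal V).colon {e ^ m}, fun y hy ↦ ?_⟩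
      have h1 : stalkIdeal E y ^ m = Ideal.span {B.presheaf.germ V.1 y hy (e ^ m)} := by
        rw [stalkIdeal_eq _ V hy, he, Ideal.map_span, Set.image_singleton,
          Ideal.span_singleton_pow, map_pow]
      ext β
      rw [key, h1, mem_map_germ_colon_iff]
      refine ⟨fun h ↦ h _ (Ideal.mem_span_singleton_self _), fun h ε hε ↦ ?_⟩
      obtain ⟨r, rfl⟩ := Ideal.mem_span_singleton.1 hε
      rw [mul_right_comm]
      exact Ideal.mul_mem_right _ _ h
  exact ⟨K, fun b β ↦ by rw [hK, key]⟩

/-- The supremum in the definition is attained by the colon sheaf. -/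
lemma mem_stalkIdeal_birationalTransform (hE : IsInvertible (exceptionalIdeal π Z)) (m : ℕ)
    (J : X.IdealSheafData) {b : B} {e : B.presheaf.stalk b}
    (he : stalkIdeal (exceptionalIdeal π Z) b = Ideal.span {e}) (β : B.presheaf.stalk b) :
    β ∈ stalkIdeal (birationalTransform π Z m J) b ↔
      e ^ m * β ∈ (stalkIdeal J (π b)).map (π.stalkMap b).hom := by
  obtain ⟨K, hK⟩ := exists_stalkIdeal_colon_eq hE (J.comap π) m
  have h1 : IsGreatest {K | exceptionalIdeal π Z ^ m * K ≤ J.comap π} K := by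
    constructor
    · refine le_iff_stalkIdeal_le.2 fun b ↦ ?_
      rw [stalkIdeal_mul, stalkIdeal_pow, Ideal.mul_le]
      exact fun ε hε β hβ ↦ (hK b β).1 hβ ε hε
    · intro K' hK'
      refine le_iff_stalkIdeal_le.2 fun b β hβ ↦ (hK b β).2 fun ε hε ↦ ?_
      have h2 := stalkIdeal_mono hK' b
      rw [stalkIdeal_mul, stalkIdeal_pow] at h2
      exact h2 (Ideal.mul_mem_mul hε hβ)
  rw [birationalTransform, h1.isLUB.sSup_eq, hK, he, Ideal.span_singleton_pow, stalkIdeal_comap]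
  refine ⟨fun h ↦ h _ (Ideal.mem_span_singleton_self _), fun h ε hε ↦ ?_⟩
  obtain ⟨r, rfl⟩ := Ideal.mem_span_singleton.1 hε
  rw [mul_right_comm]
  exact Ideal.mul_mem_right _ _ h

lemma comap_le_pow {J : X.IdealSheafData} {m : ℕ}
    (hJ : J ≤ Scheme.IdealSheafData.vanishingIdeal Z ^ m) :
    J.comap π ≤ exceptionalIdeal π Z ^ m := by
  refine le_iff_stalkIdeal_le.2 fun b ↦ ?_
  have h := stalkIdeal_mono hJ (π b)
  rw [stalkIdeal_pow] at h
  rw [stalkIdeal_pow, exceptionalIdeal, stalkIdeal_comap, stalkIdeal_comap, ← Ideal.map_pow]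
  exact Ideal.map_mono h

/-- Every germ of `π^*J` is a multiple of `e ^ m`, and the quotient lies in the colon. -/
theorem pow_mul_birationalTransform (hE : IsInvertible (exceptionalIdeal π Z)) {m : ℕ}
    {J : X.IdealSheafData} (hJ : J ≤ Scheme.IdealSheafData.vanishingIdeal Z ^ m) :
    exceptionalIdeal π Z ^ m * birationalTransform π Z m J = J.comap π := by
  refine ext_stalkIdeal fun b ↦ ?_
  obtain ⟨e, -, he⟩ := hE.exists_stalkIdeal_eq b
  have h := stalkIdeal_mono (comap_le_pow (π := π) hJ) b
  rw [stalkIdeal_pow, he, Ideal.span_singleton_pow] at h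
  rw [stalkIdeal_mul, stalkIdeal_pow, he, Ideal.span_singleton_pow]
  ext β
  rw [Ideal.mem_span_singleton_mul]
  constructor
  · rintro ⟨γ, hγ, rfl⟩
    rw [stalkIdeal_comap]
    exact (mem_stalkIdeal_birationalTransform hE m J he γ).1 hγ
  · intro hβ
    obtain ⟨γ, rfl⟩ := Ideal.mem_span_singleton.1 (h hβ)
    rw [stalkIdeal_comap] at hβ
    exact ⟨γ, (mem_stalkIdeal_birationalTransform hE m J he γ).2 hβ, rfl⟩

lemma birationalTransform_mono (m : ℕ) {I J : X.IdealSheafData} (h : I ≤ J) :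
    birationalTransform π Z m I ≤ birationalTransform π Z m J :=
  sSup_le_sSup fun _ hK ↦ le_trans hK (Scheme.IdealSheafData.comap_mono π h)

end Transform

end Toroidal

namespace Toroidal

/-! ### The boundary of the blow-up in local coordinates -/

section LocalStructure

/-- In a local ring, a principal ideal generated by a nonzerodivisor is generated by one of the
members of any generating set. -/
lemma exists_span_singleton_eq {O : Type*} [CommRing O] [IsLocalRing O] {G : Set O} {e : O}
    (he : e ∈ nonZeroDivisors O) (h : Ideal.span G = Ideal.span {e}) :
    ∃ g ∈ G, Ideal.span {g} = Ideal.span {e} := by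
  by_contra! hne
  have h1 : Ideal.span G ≤ IsLocalRing.maximalIdeal O * Ideal.span {e} := by
    refine Ideal.span_le.2 fun g hg ↦ ?_
    obtain ⟨r, hr⟩ := Ideal.mem_span_singleton.1
      (show g ∈ Ideal.span {e} from h ▸ Ideal.subset_span hg)
    have hr' : r ∈ IsLocalRing.maximalIdeal O := by
      intro hu
      refine hne g hg ?_
      rw [hr, Ideal.span_singleton_mul_right_unit hu]
    rw [hr, mul_comm e r]
    exact Ideal.mul_mem_mul hr' (Ideal.mem_span_singleton_self e)
  have h2 : e ∈ IsLocalRing.maximalIdeal O * Ideal.span {e} :=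
    h1 (h ▸ Ideal.mem_span_singleton_self e)
  rw [mul_comm, Ideal.mem_span_singleton_mul] at h2
  obtain ⟨r, hr, hre⟩ := h2
  have h3 : r = 1 := (mul_cancel_left_mem_nonZeroDivisors he).1 (hre.trans (mul_one e).symm)
  exact (IsLocalRing.maximalIdeal.isMaximal O).ne_top ((Ideal.eq_top_iff_one _).2 (h3 ▸ hr))

variable {X B : Scheme.{u}} {π : B ⟶ X} {Z : Closeds X}

/-- Off `Z` the ideal of the center is generated by `1`; denominators then map to units and are
units, the stalk map being local. -/
lemma stalkMap_bijective_of_notMem [IsIntegral X]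
    (hπ : IsBlowup π (Scheme.IdealSheafData.vanishingIdeal Z)) {b : B} (hb : π b ∉ Z) :
    Function.Bijective (π.stalkMap b) := by
  have h1 := stalkIdeal_vanishingIdeal_of_notMem Z hb
  obtain ⟨hinj, hfrac⟩ := hπ.exists_fraction b (g := 1) (by rw [h1]; trivial)
    (by rw [map_one]; exact one_mem _)
    (by rw [stalkIdeal_comap, h1, Ideal.map_top, map_one, Ideal.span_singleton_one])
  refine ⟨hinj, fun β ↦ ?_⟩
  obtain ⟨N, f, h, u, -, -, hu, hh, hβ⟩ := hfrac β
  rw [map_one, one_pow, one_mul] at hh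
  have hu' : IsUnit h := (isUnit_map_iff (π.stalkMap b).hom h).1 (hh.symm ▸ hu)
  obtain ⟨h', hh'⟩ := hu'.exists_right_inv
  refine ⟨h' * f, ?_⟩
  rw [map_mul, ← hβ, ← mul_assoc, ← map_mul, mul_comm h' h, hh', map_one, one_mul]

lemma stalkIdeal_exceptionalIdeal_of_notMem {b : B} (hb : π b ∉ Z) :
    stalkIdeal (exceptionalIdeal π Z) b = ⊤ := by
  rw [exceptionalIdeal, stalkIdeal_comap, stalkIdeal_vanishingIdeal_of_notMem Z hb, Ideal.map_top]

/-- The local rings of the blow-up of a center generated by regular parameters. -/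
theorem exists_isBlowupStalk [IsIntegral X]
    (hπ : IsBlowup π (Scheme.IdealSheafData.vanishingIdeal Z)) (b : B)
    {n : ℕ} {z : Fin n → X.presheaf.stalk (π b)} {T : Set (Fin n)}
    (hT : stalkIdeal (Scheme.IdealSheafData.vanishingIdeal Z) (π b) = Ideal.span (z '' T)) :
    ∃ t y, IsBlowupStalk (π.stalkMap b).hom z T t y ∧
      stalkIdeal (exceptionalIdeal π Z) b = Ideal.span {π.stalkMap b (z t)} := by
  classical
  obtain ⟨e, he, hE⟩ := hπ.invertible.exists_stalkIdeal_eq b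
  have hE' := hE
  rw [stalkIdeal_comap, hT, Ideal.map_span] at hE'
  obtain ⟨_, ⟨_, ⟨t, ht, rfl⟩, rfl⟩, hte⟩ := exists_span_singleton_eq he hE'
  have hE'' : stalkIdeal (exceptionalIdeal π Z) b = Ideal.span {π.stalkMap b (z t)} :=
    hE.trans hte.symm
  have hreg : π.stalkMap b (z t) ∈ nonZeroDivisors (B.presheaf.stalk b) := by
    obtain ⟨r, hr⟩ := Ideal.mem_span_singleton.1 (hte.ge (Ideal.mem_span_singleton_self e))
    rw [hr] at he
    exact (mul_mem_nonZeroDivisors.1 he).1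
  have hdvd : ∀ i ∈ T, ∃ y, π.stalkMap b (z i) = π.stalkMap b (z t) * y := by
    intro i hi
    refine Ideal.mem_span_singleton.1 (hE'' ▸ ?_)
    rw [exceptionalIdeal, stalkIdeal_comap, hT]
    exact Ideal.mem_map_of_mem _ (Ideal.subset_span ⟨i, hi, rfl⟩)
  choose! y hy using hdvd
  obtain ⟨hinj, hfrac⟩ := hπ.exists_fraction b (g := z t)
    (hT ▸ Ideal.subset_span ⟨t, ht, rfl⟩) hreg hE''
  rw [hT] at hfrac
  refine ⟨t, fun i ↦ if i ∈ T then y i else π.stalkMap b (z i), ⟨ht, inferInstance, hinj, hreg,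
    fun i hi ↦ ?_, fun i hi ↦ ?_, hfrac⟩, hE''⟩
  · rw [if_pos hi]; exact hy i hi
  · rw [if_neg hi]

/-- Over `Z` the stalk of `I_Z · 𝒪_B` is prime, hence radical, so it is the ideal of the closed set
`π⁻¹(Z)`. -/
lemma divisorStalk_none {ι : Type*} [IsIntegral X] [IsLocallyNoetherian X] {D : ι → Closeds X}
    (hD : IsSNC D) (hπ : IsBlowup π (Scheme.IdealSheafData.vanishingIdeal Z)) {b : B}
    {T : Set ι} (hT : π b ∈ Z → IsCenterAt D Z T (π b)) :
    divisorStalk (blowupBoundary π Z D) b none = stalkIdeal (exceptionalIdeal π Z) b := by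
  by_cases hb : π b ∈ Z
  · obtain ⟨n, z, c, h⟩ := hD.exists_isSNCAt (π b)
    obtain ⟨t, y, H, hE⟩ := exists_isBlowupStalk hπ b
      ((hT hb).stalkIdeal_eq.trans (h.iSup_eq_span (hT hb).mem))
    refine (stalkIdeal_vanishingIdeal_eq _ b _ fun p ↦ ?_).trans
      (hE ▸ (H.isPrime_span h.isRSP).radical)
    rw [exceptionalIdeal, stalkIdeal_comap]
    exact map_primePt_mem_iff π b Z p
  · rw [stalkIdeal_exceptionalIdeal_of_notMem hb]
    exact stalkIdeal_vanishingIdeal_of_notMem _ hb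

lemma stalkIdeal_vanishingIdeal_isRadical (Z : Closeds X) (x : X) :
    (stalkIdeal (Scheme.IdealSheafData.vanishingIdeal Z) x).IsRadical := by
  have := stalkIdeal_vanishingIdeal_eq Z x _ (fun p ↦ primePt_mem_iff Z p)
  rw [this]
  exact Ideal.radical_isRadical _

lemma map_radical_of_bijective {A O : Type*} [CommRing A] [CommRing O] {φ : A →+* O}
    (hφ : Function.Bijective φ) {I : Ideal A} (hI : I.IsRadical) : (I.map φ).radical = I.map φ := by
  refine le_antisymm (fun β ↦ ?_) Ideal.le_radical
  rintro ⟨k, hk⟩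
  obtain ⟨a, rfl⟩ := hφ.2 β
  refine Ideal.mem_map_of_mem _ (hI ⟨k, ?_⟩)
  rw [← map_pow, ← Ideal.mem_comap, Ideal.comap_map_of_bijective _ hφ] at hk
  exact hk

lemma divisorStalk_some_of_notMem {ι : Type*} [IsIntegral X] (D : ι → Closeds X)
    (hπ : IsBlowup π (Scheme.IdealSheafData.vanishingIdeal Z)) {b : B} (hb : π b ∉ Z) (i : ι) :
    divisorStalk (blowupBoundary π Z D) b (some i) =
      (divisorStalk D (π b) i).map (π.stalkMap b).hom := by
  have hE : stalkIdeal (exceptionalIdeal π Z) b = Ideal.span {1} := by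
    rw [stalkIdeal_exceptionalIdeal_of_notMem hb, Ideal.span_singleton_one]
  ext β
  refine (mem_strictTransform_iff π (D i) Z hπ.invertible hE β).trans ?_
  have h1 : ((divisorStalk D (π b) i).map (π.stalkMap b).hom).radical = _ :=
    map_radical_of_bijective (stalkMap_bijective_of_notMem hπ hb)
      (stalkIdeal_vanishingIdeal_isRadical (D i) (π b))
  rw [one_mul, ← h1]
  rfl

lemma divisorStalk_some_eq_span {ι : Type*} [IsLocallyNoetherian X] {D : ι → Closeds X}
    (hπ : IsBlowup π (Scheme.IdealSheafData.vanishingIdeal Z)) {b : B}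
    {n : ℕ} {z : Fin n → X.presheaf.stalk (π b)} {c : {i | π b ∈ D i} → Fin n}
    (h : IsSNCAt (divisorStalk D (π b)) {i | π b ∈ D i} z c) {T : Set (Fin n)} {t : Fin n}
    {y : Fin n → B.presheaf.stalk b} (H : IsBlowupStalk (π.stalkMap b).hom z T t y)
    (hE : stalkIdeal (exceptionalIdeal π Z) b = Ideal.span {π.stalkMap b (z t)})
    (i : {i | π b ∈ D i}) :
    divisorStalk (blowupBoundary π Z D) b (some i) = Ideal.span {y (c i)} := by
  ext β
  refine (mem_strictTransform_iff π (D i) Z hπ.invertible hE β).trans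
    (Iff.trans ?_ (H.mul_mem_radical_iff h.isRSP (c i) β))
  have h1 : (stalkIdeal (divisorIdeal (D i)) (π b)).map (π.stalkMap b).hom =
      Ideal.span {π.stalkMap b (z (c i))} := by
    rw [show stalkIdeal (divisorIdeal (D i)) (π b) = _ from h.eq_span i, Ideal.map_span,
      Set.image_singleton]
  rw [h1]

lemma divisorStalk_some_eq_top {ι : Type*} (D : ι → Closeds X) {b : B} {i : ι}
    (hi : π b ∉ D i) : divisorStalk (blowupBoundary π Z D) b (some i) = ⊤ := by
  refine divisorStalk_of_notMem _ fun hb ↦ hi ?_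
  have h1 : closure (π ⁻¹' ((D i : Set X) \ Z)) ⊆ π ⁻¹' (D i : Set X) :=
    closure_minimal (Set.preimage_mono Set.sdiff_subset)
      ((D i).isClosed.preimage π.continuous)
  exact h1 hb

open scoped Classical in
/-- The total transform of `D i` is the sum of its birational transform and, if `D i` contains
the center, of the exceptional divisor. -/
theorem map_divisorStalk_eq {ι : Type*} [IsIntegral X] [IsLocallyNoetherian X] {D : ι → Closeds X}
    (hD : IsSNC D) (hπ : IsBlowup π (Scheme.IdealSheafData.vanishingIdeal Z)) {b : B}
    {T : Set ι} (hT : π b ∈ Z → IsCenterAt D Z T (π b)) (i : ι) :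
    (divisorStalk D (π b) i).map (π.stalkMap b).hom =
      divisorStalk (blowupBoundary π Z D) b (some i) *
        stalkIdeal (exceptionalIdeal π Z) b ^ (if i ∈ T then 1 else 0) := by
  by_cases hb : π b ∈ Z
  · obtain ⟨n, z, c, h⟩ := hD.exists_isSNCAt (π b)
    obtain ⟨t, y, H, hE⟩ := exists_isBlowupStalk hπ b
      ((hT hb).stalkIdeal_eq.trans (h.iSup_eq_span (hT hb).mem))
    by_cases hi : π b ∈ D i
    · rw [divisorStalk_some_eq_span hπ h H hE ⟨i, hi⟩, h.eq_span ⟨i, hi⟩, Ideal.map_span,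
        Set.image_singleton, hE, Ideal.span_singleton_pow, Ideal.span_singleton_mul_span_singleton]
      congr 2
      by_cases hiT : i ∈ T
      · rw [if_pos hiT, pow_one, mul_comm]
        exact H.map_of_mem _ ⟨⟨i, hi⟩, hiT, rfl⟩
      · rw [if_neg hiT, pow_zero, mul_one]
        refine H.map_of_notMem _ ?_
        rintro ⟨j, hj, hji⟩
        rw [h.injective hji] at hj
        exact hiT hj
    · rw [divisorStalk_some_eq_top D hi, divisorStalk_of_notMem D hi, Ideal.map_top,
        if_neg fun hiT ↦ hi ((hT hb).mem i hiT), pow_zero, mul_one]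
  · rw [divisorStalk_some_of_notMem D hπ hb, stalkIdeal_exceptionalIdeal_of_notMem hb,
      ← Ideal.one_eq_top, one_pow, mul_one]

end LocalStructure

end Toroidal

namespace Toroidal

/-! ### Transforms of toroidal ideal sheaves and of hulls -/

section MonomialTransform

variable {ι : Type*} [Fintype ι]

/-- The order of a monomial along the center is its degree in the divisors of `T`; this makes the
subtraction of `m` in `transformExponents` exact. -/
lemma IsSNCAt.le_sum_of_prod_le {A : Type*} [CommRing A] [IsLocalRing A] [IsNoetherianRing A]
    {n : ℕ} {P : ι → Ideal A} {S : Set ι} {z : Fin n → A} {c : S → Fin n} (h : IsSNCAt P S z c)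
    {T : Finset ι} (hT : (T : Set ι) ⊆ S) {a : ι → ℕ} {m : ℕ}
    (hle : ∏ i, P i ^ a i ≤ (⨆ i ∈ (T : Set ι), P i) ^ m) : m ≤ ∑ i ∈ T, a i := by
  classical
  rw [h.prod_eq_span, h.iSup_eq_span hT, span_pow_eq_monIdeal,
    Ideal.span_singleton_le_iff_mem] at hle
  obtain ⟨d, ⟨hd, rfl⟩, hda⟩ := h.isRSP.mon_mem_of_sum_mem Set.univ (by simp)
    {parameterExponent c a} 1 (by simp)
    (fun _ _ h1 ↦ (h.isRSP.isPrime_span _).ne_top ((Ideal.eq_top_iff_one _).2 h1))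
    (by simpa using hle) _ (Finset.mem_singleton_self _)
  have h1 : deg d = ∑ i : {i // i ∈ T}, d (c ⟨i, hT i.2⟩) := by
    refine (Finset.sum_of_injOn (fun i : {i // i ∈ T} ↦ c ⟨i, hT i.2⟩) ?_ (by simp) ?_
      fun _ _ ↦ rfl).symm
    · intro i _ j _ hij
      exact Subtype.ext (Subtype.mk.inj (h.injective hij))
    · intro j _ hj
      refine hd j fun i hi _ hij ↦ hj ⟨⟨i, hi⟩, by simp, hij⟩
  rw [h1, ← Finset.sum_coe_sort T]
  refine Finset.sum_le_sum fun i _ ↦ (hda _).trans ?_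
  rw [parameterExponent_apply h.injective]

lemma prod_option {A : Type*} [CommRing A] (Q : Option ι → Ideal A) (a : Option ι → ℕ) :
    ∏ o, Q o ^ a o = Q none ^ a none * ∏ i, Q (some i) ^ a (some i) :=
  Fintype.prod_option _

variable {X B : Scheme.{u}} [IsIntegral X] [IsLocallyNoetherian X] {π : B ⟶ X} {Z : Closeds X}
  {D : ι → Closeds X}

/-- A monomial ideal on the blow-up which contains the image of an ideal contains the image of
its monomial hull. -/
theorem map_hull_le (hD : IsSNC D) (hπ : IsBlowup π (Scheme.IdealSheafData.vanishingIdeal Z))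
    {b : B} {T : Set ι} (hT : π b ∈ Z → IsCenterAt D Z T (π b)) (𝔧 : Ideal (X.presheaf.stalk (π b)))
    (M : Set (Option ι → ℕ)) (hM : 𝔧.map (π.stalkMap b).hom ≤
      monoIdeal (divisorStalk (blowupBoundary π Z D) b) M) :
    (monoIdeal (divisorStalk D (π b)) (hullExponents (divisorStalk D (π b)) 𝔧)).map
      (π.stalkMap b).hom ≤ monoIdeal (divisorStalk (blowupBoundary π Z D) b) M := by
  -- One monomial ideal between `𝔧` and the contraction of the given ideal suffices.
  suffices ∃ M', 𝔧 ≤ monoIdeal (divisorStalk D (π b)) M' ∧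
      (monoIdeal (divisorStalk D (π b)) M').map (π.stalkMap b).hom ≤
        monoIdeal (divisorStalk (blowupBoundary π Z D) b) M by
    obtain ⟨M', h1, h2⟩ := this
    exact (Ideal.map_mono (monoIdeal_hullExponents_le _ _ h1)).trans h2
  have hnone := divisorStalk_none hD hπ hT
  by_cases hb : π b ∈ Z
  · obtain ⟨n, z, c, h⟩ := hD.exists_isSNCAt (π b)
    obtain ⟨t, y, H, hE⟩ := exists_isBlowupStalk hπ b
      ((hT hb).stalkIdeal_eq.trans (h.iSup_eq_span (hT hb).mem))
    let 𝔑 : Set (ℕ × (Fin n → ℕ)) :=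
      (fun a : Option ι → ℕ ↦ (a none, parameterExponent c (fun i ↦ a (some i)))) '' M
    have hprod : ∀ a : Option ι → ℕ,
        ∏ o, divisorStalk (blowupBoundary π Z D) b o ^ a o = Ideal.span
          {π.stalkMap b (z t) ^ a none * mon y (parameterExponent c (fun i ↦ a (some i)))} := by
      intro a
      rw [prod_option, hnone, hE, prod_pow_eq_span h.injective
        (fun i ↦ divisorStalk_some_eq_span hπ h H hE i)
        (fun i hi ↦ divisorStalk_some_eq_top D hi), Ideal.span_singleton_pow,
        Ideal.span_singleton_mul_span_singleton]
    have hmono : monoIdeal (divisorStalk (blowupBoundary π Z D) b) M =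
        Ideal.span ((fun c : ℕ × (Fin n → ℕ) ↦ (π.stalkMap b).hom (z t) ^ c.1 * mon y c.2) '' 𝔑) := by
      refine le_antisymm (iSup₂_le fun a ha ↦ ?_) (Ideal.span_le.2 ?_)
      · rw [hprod, Ideal.span_singleton_le_iff_mem]
        exact Ideal.subset_span ⟨_, ⟨a, ha, rfl⟩, rfl⟩
      · rintro _ ⟨_, ⟨a, ha, rfl⟩, rfl⟩
        refine prod_le_monoIdeal _ ha ?_
        rw [hprod]
        exact Ideal.mem_span_singleton_self _
    -- All boundary monomials mapping into the given ideal; `map_mon_mem` shows that every monomial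
    -- of an element of `𝔧` is among them.
    let 𝔐 : Set (Fin n → ℕ) := {a | (∀ i ∉ Set.range c, a i = 0) ∧ (π.stalkMap b).hom (mon z a) ∈
      monoIdeal (divisorStalk (blowupBoundary π Z D) b) M}
    obtain ⟨M', hM'⟩ := exists_monoIdeal_eq h (M := 𝔐) fun a ha ↦ ha.1
    refine ⟨M', ?_, ?_⟩
    · rw [← hM']
      intro f hf
      obtain ⟨C, v, hC, hv, rfl⟩ :=
        exists_expansion z (Set.range c) (fun i _ ↦ h.isRSP.mem i) f
      refine sum_mem fun a ha ↦ Ideal.mul_mem_left _ _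
        (mon_mem_monIdeal z (b := a) ⟨hC a ha, ?_⟩ le_rfl)
      have h1 := hM (Ideal.mem_map_of_mem _ hf)
      rw [hmono] at h1 ⊢
      refine H.map_mon_mem h.isRSP (Set.image_subset_range _ _) 𝔑 ?_ C v hC hv h1 a ha
      rintro _ ⟨a, -, rfl⟩ i hi
      exact parameterExponent_of_notMem (fun i ↦ a (some i)) hi
    · rw [← hM', monIdeal, Ideal.map_span, Ideal.span_le]
      rintro _ ⟨_, ⟨a, ha, rfl⟩, rfl⟩
      exact ha.2
  · have hbij := stalkMap_bijective_of_notMem hπ hb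
    have hmono : monoIdeal (divisorStalk (blowupBoundary π Z D) b) M =
        (monoIdeal (divisorStalk D (π b)) ((fun a i ↦ a (some i)) '' M)).map
          (π.stalkMap b).hom := by
      rw [map_monoIdeal]
      simp only [monoIdeal, iSup_image]
      refine iSup_congr fun a ↦ iSup_congr fun _ ↦ ?_
      rw [prod_option, hnone, stalkIdeal_exceptionalIdeal_of_notMem hb, ← Ideal.one_eq_top,
        one_pow, one_mul]
      exact Finset.prod_congr rfl fun i _ ↦ by rw [divisorStalk_some_of_notMem D hπ hb]
    refine ⟨_, ?_, hmono.ge⟩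
    rw [hmono, Ideal.map_le_iff_le_comap] at hM
    refine hM.trans (le_of_eq ?_)
    exact Ideal.comap_map_of_bijective _ hbij

open scoped Classical in
lemma map_prod_divisorStalk_eq (hD : IsSNC D)
    (hπ : IsBlowup π (Scheme.IdealSheafData.vanishingIdeal Z))
    {b : B} {T : Set ι} (hT : π b ∈ Z → IsCenterAt D Z T (π b)) (a : ι → ℕ) :
    (∏ i, divisorStalk D (π b) i ^ a i).map (π.stalkMap b).hom =
      stalkIdeal (exceptionalIdeal π Z) b ^ (∑ i ∈ T.toFinset, a i) *
        ∏ i, divisorStalk (blowupBoundary π Z D) b (some i) ^ a i := by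
  have hsum : ∑ i ∈ T.toFinset, a i = ∑ i, if i ∈ T then a i else 0 := by
    rw [← Finset.sum_filter]
    congr 1
    ext i
    simp
  rw [map_prod_pow, hsum, ← Finset.prod_pow_eq_pow_sum,
    ← Finset.prod_mul_distrib]
  refine Finset.prod_congr rfl fun i _ ↦ ?_
  rw [map_divisorStalk_eq hD hπ hT, mul_pow, mul_comm, ← pow_mul]
  congr 2
  split_ifs <;> simp

open scoped Classical in
/-- The exponents of the birational transform of a toroidal ideal sheaf. -/
noncomputable def transformExponents (T : Set ι) (m : ℕ) (M : Set (ι → ℕ)) :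
    Set (Option ι → ℕ) :=
  (fun a o ↦ o.elim ((∑ i ∈ T.toFinset, a i) - m) a) '' M

/-- A monomial pulls back with exceptional exponent the sum of its exponents over `T`, and the
transform divides by `e ^ m`. Over `Z` that sum is at least `m`; off `Z` the exceptional ideal is
trivial and its exponent irrelevant. -/
lemma stalkIdeal_birationalTransform_eq (hD : IsSNC D)
    (hπ : IsBlowup π (Scheme.IdealSheafData.vanishingIdeal Z))
    {b : B} {T : Set ι} (hT : π b ∈ Z → IsCenterAt D Z T (π b)) {m : ℕ} {H : X.IdealSheafData}
    (hH : H ≤ Scheme.IdealSheafData.vanishingIdeal Z ^ m) {M : Set (ι → ℕ)}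
    (hM : stalkIdeal H (π b) = monoIdeal (divisorStalk D (π b)) M) :
    stalkIdeal (birationalTransform π Z m H) b =
      monoIdeal (divisorStalk (blowupBoundary π Z D) b) (transformExponents T m M) := by
  classical
  have hinv : IsInvertible (exceptionalIdeal π Z) := hπ.invertible
  obtain ⟨e, he, hE⟩ := hinv.exists_stalkIdeal_eq b
  have key : (stalkIdeal H (π b)).map (π.stalkMap b).hom = Ideal.span {e ^ m} *
      monoIdeal (divisorStalk (blowupBoundary π Z D) b) (transformExponents T m M) := by
    rw [hM, ← Ideal.span_singleton_pow, ← hE]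
    simp only [monoIdeal, transformExponents, iSup_image, Ideal.map_iSup, Ideal.mul_iSup]
    refine iSup_congr fun a ↦ iSup_congr fun ha ↦ ?_
    rw [map_prod_divisorStalk_eq hD hπ hT, prod_option, divisorStalk_none hD hπ hT, ← mul_assoc,
      ← pow_add]
    congr 1
    by_cases hb : π b ∈ Z
    · congr 1
      obtain ⟨n, z, c, h⟩ := hD.exists_isSNCAt (π b)
      have h1 := stalkIdeal_mono hH (π b)
      rw [stalkIdeal_pow, (hT hb).stalkIdeal_eq, hM] at h1
      have h2 : m ≤ ∑ i ∈ T.toFinset, a i := by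
        refine h.le_sum_of_prod_le (by rw [Set.coe_toFinset]; exact (hT hb).mem) ?_
        rw [Set.coe_toFinset]
        exact (prod_le_monoIdeal _ ha).trans h1
      exact (Nat.add_sub_cancel' h2).symm
    · rw [stalkIdeal_exceptionalIdeal_of_notMem hb, ← Ideal.one_eq_top, one_pow, one_pow]
  ext β
  rw [mem_stalkIdeal_birationalTransform hπ.invertible m H hE, key, Ideal.mem_span_singleton_mul]
  constructor
  · rintro ⟨γ, hγ, h1⟩
    rwa [← (mul_cancel_left_mem_nonZeroDivisors (pow_mem he m)).1 h1]
  · exact fun h ↦ ⟨β, h, rfl⟩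

variable [NoetherianSpace X]

/-- Near `π b` both the exponents of `H` and the set `T` can be kept fixed, so one set of exponents
serves on a whole preimage. -/
theorem isToroidal_birationalTransform (hD : IsSNC D) (hZ : IsToroidalCenter D Z)
    (hπ : IsBlowup π (Scheme.IdealSheafData.vanishingIdeal Z)) {m : ℕ} {H : X.IdealSheafData}
    (hH : H ≤ Scheme.IdealSheafData.vanishingIdeal Z ^ m) (hHt : IsToroidal D H) :
    IsToroidal (blowupBoundary π Z D) (birationalTransform π Z m H) := by
  refine isToroidal_of_stalkIdeal fun b ↦ ?_
  obtain ⟨U, hbU, M, hM⟩ := hHt (π b)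
  obtain ⟨V, hbV, T, hT⟩ := hZ.exists_open hD (π b)
  refine ⟨π ⁻¹ᵁ (U.1 ⊓ V), ⟨hbU, hbV⟩, transformExponents T m M, fun b' hb' ↦ ?_⟩
  refine stalkIdeal_birationalTransform_eq hD hπ (hT _ hb'.2) hH ?_
  rw [stalkIdeal_eq _ U hb'.1, hM]
  exact map_germ_monoIdeal D U hb'.1 M

/-- The product `𝒪(-mE) * K` is locally monomial and contains `π^*J`. By `map_hull_le` it contains
`π^*Jᵗ`, and `e ^ m` cancels. -/
theorem birationalTransform_toroidalHull_le (hD : IsSNC D) (hZ : IsToroidalCenter D Z)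
    (hπ : IsBlowup π (Scheme.IdealSheafData.vanishingIdeal Z)) {m : ℕ} {J : X.IdealSheafData}
    (hJ : J ≤ Scheme.IdealSheafData.vanishingIdeal Z ^ m) {K : B.IdealSheafData}
    (hK : IsToroidal (blowupBoundary π Z D) K) (hJK : birationalTransform π Z m J ≤ K) :
    birationalTransform π Z m (toroidalHull D J) ≤ K := by
  refine le_iff_stalkIdeal_le.2 fun b β hβ ↦ ?_
  have hinv : IsInvertible (exceptionalIdeal π Z) := hπ.invertible
  obtain ⟨e, he, hE⟩ := hinv.exists_stalkIdeal_eq b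
  obtain ⟨V, hbV, T, hT⟩ := hZ.exists_open hD (π b)
  obtain ⟨M, hM⟩ := hK.exists_stalkIdeal_eq b
  let M' : Set (Option ι → ℕ) := (fun a o ↦ o.elim (m + a none) fun i ↦ a (some i)) '' M
  have hM' : monoIdeal (divisorStalk (blowupBoundary π Z D) b) M' =
      Ideal.span {e ^ m} * stalkIdeal K b := by
    rw [hM, ← Ideal.span_singleton_pow, ← hE]
    simp only [monoIdeal, M', iSup_image, Ideal.mul_iSup]
    refine iSup_congr fun a ↦ iSup_congr fun ha ↦ ?_
    rw [prod_option, prod_option, divisorStalk_none hD hπ (hT _ hbV), ← mul_assoc, ← pow_add]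
    rfl
  have h1 : (stalkIdeal J (π b)).map (π.stalkMap b).hom ≤
      monoIdeal (divisorStalk (blowupBoundary π Z D) b) M' := by
    rw [← stalkIdeal_comap, ← pow_mul_birationalTransform hπ.invertible hJ, stalkIdeal_mul,
      stalkIdeal_pow, hM', hE, Ideal.span_singleton_pow]
    exact Ideal.mul_mono_right (stalkIdeal_mono hJK b)
  have h2 := map_hull_le hD hπ (hT _ hbV) _ M' h1
  rw [← stalkIdeal_toroidalHull hD, hM'] at h2
  obtain ⟨γ, hγ, h3⟩ := Ideal.mem_span_singleton_mul.1
    (h2 ((mem_stalkIdeal_birationalTransform hπ.invertible m _ hE β).1 hβ))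
  rwa [← (mul_cancel_left_mem_nonZeroDivisors (pow_mem he m)).1 h3]

/-- The toroidal hull of the birational transform is the birational transform of the toroidal
hull. -/
theorem isLeast_birationalTransform_toroidalHull (hD : IsSNC D) (hZ : IsToroidalCenter D Z)
    (hπ : IsBlowup π (Scheme.IdealSheafData.vanishingIdeal Z)) {m : ℕ} {J : X.IdealSheafData}
    (hJ : IsToroidallyEquimultiple D J Z m) :
    IsLeast (toroidalAbove (blowupBoundary π Z D) (birationalTransform π Z m J))
      (birationalTransform π Z m (toroidalHull D J)) := by
  have h := isLeast_toroidalHull hD J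
  exact ⟨⟨isToroidal_birationalTransform hD hZ hπ (toroidalHull_le_pow hD hZ hJ) h.1.1,
    birationalTransform_mono m h.1.2⟩,
    fun K hK ↦ birationalTransform_toroidalHull_le hD hZ hπ (hJ.le_pow hD hZ) hK.1 hK.2⟩

end MonomialTransform

end Toroidal
theorem mainTheorem7 {k : Type u} [Field k] {X B : Scheme.{u}}
    (s : X ⟶ Spec (CommRingCat.of k))
    [IsIntegral X] [Smooth s] [IsSeparated s] [QuasiCompact s]
    {ι : Type*} [Fintype ι] (D : ι → Closeds X) (hD : Toroidal.IsSNC D)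
    (J : X.IdealSheafData) (Z : Closeds X) (hZ : Toroidal.IsToroidalCenter D Z)
    (m : ℕ) (hJ : Toroidal.IsToroidallyEquimultiple D J Z m)
    (π : B ⟶ X) (hπ : Toroidal.IsBlowup π (Scheme.IdealSheafData.vanishingIdeal Z)) :
    -- the toroidal hull of `J` exists and is toroidally equimultiple of the same multiplicity
    IsLeast (Toroidal.toroidalAbove D J) (Toroidal.toroidalHull D J) ∧
    Toroidal.IsToroidallyEquimultiple D (Toroidal.toroidalHull D J) Z m ∧
    -- `𝒪(mE) · π^*J` and `𝒪(mE) · π^*Jᵗ` are ideal sheaves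
    Toroidal.exceptionalIdeal π Z ^ m * Toroidal.birationalTransform π Z m J = J.comap π ∧
    Toroidal.exceptionalIdeal π Z ^ m *
        Toroidal.birationalTransform π Z m (Toroidal.toroidalHull D J) =
      (Toroidal.toroidalHull D J).comap π ∧
    -- the toroidal hull of the birational transform exists
    IsLeast
      (Toroidal.toroidalAbove (Toroidal.blowupBoundary π Z D)
        (Toroidal.birationalTransform π Z m J))
      (Toroidal.toroidalHull (Toroidal.blowupBoundary π Z D)
        (Toroidal.birationalTransform π Z m J)) ∧
    -- the toroidal hull commutes with the birational transform
    Toroidal.toroidalHull (Toroidal.blowupBoundary π Z D)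
        (Toroidal.birationalTransform π Z m J) =
      Toroidal.birationalTransform π Z m (Toroidal.toroidalHull D J) := by
  have : IsLocallyNoetherian X := LocallyOfFiniteType.isLocallyNoetherian s
  have : CompactSpace X := QuasiCompact.compactSpace_of_compactSpace s
  have : IsNoetherian X := {}
  have hle := hJ.le_pow hD hZ
  have hle' := Toroidal.toroidalHull_le_pow hD hZ hJ
  have hleast := Toroidal.isLeast_birationalTransform_toroidalHull hD hZ hπ hJ
  have heq : Toroidal.toroidalHull (Toroidal.blowupBoundary π Z D)
      (Toroidal.birationalTransform π Z m J) =
        Toroidal.birationalTransform π Z m (Toroidal.toroidalHull D J) := by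
    -- The hull on `B` is identified through an explicit least element, so regularity of `B` and of
    -- its boundary need not be established.
    rw [Toroidal.toroidalHull, hleast.isGLB.sInf_eq]
  exact ⟨Toroidal.isLeast_toroidalHull hD J, hJ.toroidalHull hD hZ,
    Toroidal.pow_mul_birationalTransform hπ.invertible hle,
    Toroidal.pow_mul_birationalTransform hπ.invertible hle', heq ▸ hleast, heq⟩
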